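/- **Setting.** Let $N$ be a finite set of nodes, let $E\subseteq N\times N$ be an orientation of a connected simple graph on $N$ (write $i\to j$ for $(i,j)\in E$), and let $H$ be a connected simple graph on $N$ (communication graph), $N_{cj}$ being the set of neighbours of $j$ in $H$. Let $M_j,D_j,\beta_j>0$, $B_{ij}>0$ for $(i,j)\in E$, $\overline P_j\in\mathbb R$, $k_\alpha,\gamma>0$, and let $d_j\in\mathbb R$ be the damping gains. For each $j$ let $s_j\ge 1$ and $$q_j(t)=q_{j0}+\sum_{k=1}^{s_j}q_{jk}\sin(a_{jk}t+\phi_{jk}),\qquad q_{jk}\neq 0,\quad a_{jk}>0 \text{ pairwise distinct in } k .$$ Put $\bar s_j=2s_j+1$. For $\alpha\in\mathbb R^{s_j}$ let $A_j(\alpha)$ be the $\bar s_j\times\bar s_j$ matrix with ones on the superdiagonal, last row $(0,\alpha_1,0,\alpha_2,\dots,0,\alpha_{s_j},0)$, and all other entries zero; let $\alpha_j\in\mathbb R^{s_j}$ have the entries $\alpha_{jm}=-e_{s_j-m+1}(a_{j1}^2,\dots,a_{js_j}^2)$, with $e_k$ the elementary symmetric polynomials. Let $R_j=(r_{j1},\dots,r_{j,2s_j},1)$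 be such that all roots of $\tau^{2s_j}+r_{j,2s_j}\tau^{2s_j-1}+\dots+r_{j1}$ have negative real part, $\tilde A_j(\alpha)=R_j(I+A_j(\alpha))$, let $O_j$ be the matrix with rows $\tilde A_j(\alpha_j)A_j(\alpha_j)^{i}$, $0\le i\le 2s_j$, and $\varphi_j(t)=O_j^{-1}\,(q_j,q_j',\dots,q_j^{(2s_j)})^T(t)$. Let $G_j=(0,\dots,0,1,\gamma)^T\in\mathbb R^{\bar s_j}$ and $\Lambda_j(\zeta)=(\zeta_2,\zeta_4,\dots,\zeta_{2s_j})^T$. The state is $x=(\tilde\theta,\omega,\mu,\nu)$ with $\tilde\theta\in\mathbb R^E$ a vector of angle differences ($\tilde\theta_{ij}=\theta_i-\theta_j$ for some $\theta\in\mathbb R^N$), $\omega,\mu\in\mathbb R^N$, and $\nu_j=(\hat\eta_j,\tilde\zeta_j,\tilde\alpha_j)\in\mathbb R\times\mathbb R^{\bar s_j}\times\mathbb R^{s_j}$. With $\zeta_j=\tilde\zeta_j+\varphi_j(t)$, $\hat\alpha_j=\tilde\alpha_j+\alpha_j$ and $\rho_{qj}=\tilde A_j(\alpha_j)\varphi_j-\tilde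 A_j(\hat\alpha_j)\zeta_j$, the closed-loop system is $$\begin{aligned} \dot{\tilde\theta}_{ij}&=\omega_i-\omega_j,\\ \dot\omega_j&=\tfrac1{M_j}\Big(\overline P_j+\rho_{qj}+\sum_{i:i\to j}B_{ij}\tilde\theta_{ij}-\sum_{k:j\to k}B_{jk}\tilde\theta_{jk}-\mu_j/\beta_j-d_j\omega_j-D_j\omega_j\Big),\\ \dot\mu_j&=-\sum_{k\in N_{cj}}(\mu_j-\mu_k)+\omega_j/\beta_j,\\ \dot\nu_j&=\phi_j(t,\nu_j,\omega_j), \end{aligned}$$ where $$\phi_j(t,\nu_j,\omega_j)=\begin{pmatrix}-\hat\eta_j-M_j\omega_j\\ (A_j(\hat\alpha_j)-A_j(\alpha_j))\zeta_j-G_j(\hat\eta_j+M_j\omega_j)+(A_j(\alpha_j)-G_jR_j)\tilde\zeta_j\\ -k_\alpha\Lambda_j(\zeta_j)(\hat\eta_j+M_j\omega_j+R_j\tilde\zeta_j)\end{pmatrix}.$$ An equilibrium is a state $x^*$ at which the right-hand side vanishes for all $t\ge0$. All norms are Euclidean. "Positive definite with respect to a point" means continuous, zero at that point and positive elsewhere.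 **Theorem.** 1. The closed-loop system has exactly one equilibrium $x^*=(\tilde\theta^*,\omega^*,\mu^*,\nu^*)$. 2. For every $j$ there exist a $C^1$ function $U_j(t,\nu_j)$, functions $\underline U_j,\overline U_j$ that are positive definite (with respect to $0$) and radially unbounded, and a constant $b_{j0}>0$, such that for all $t\ge0$ and all $\nu_j$: $\underline U_j(\nu_j)\le U_j(t,\nu_j)\le\overline U_j(\nu_j)$, $\ \partial_tU_j+\partial_{\nu_j}U_j\,\phi_j(t,\nu_j,0)\le-\|\nu_j\|^2$, and $\|\partial_{\nu_j}U_j\|\le b_{j0}(\|\nu_j\|+\|\nu_j\|^3)$. 3. Let $U_j,\underline U_j,\overline U_j,b_{j0}$ be any functions and constants as in 2. Let $\tilde c\in\mathbb R$ and let $\bar c>0$ be such that, for all $t\ge 0$, $\sum_jU_j(t,\nu_j)\le\tilde c$ implies $\|\nu_j\|\le\bar c$ for all $j$. Let $\|\varphi_j(t)\|\le\bar\varphi_j$ for all $t\ge0$, and let $c_2,c_3$ satisfy, for all $j$, $$c_2\ge\|R_j\|\bar\varphi_j+\|R_j\|+\|R_jA_j(\alpha_j)\|,$$ $$c_3\ge\max\{1,\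 c_2(1+\bar c),\ b_{j0}(1+\bar c^2),\ M_j+\|G_j\|M_j+k_\alpha M_j(\bar c+\bar\varphi_j)\}.$$ Assume (A1) that for all $j$ $$d_j>\max\Big\{\tfrac{1+2c_3^6}{2}-D_j,\ \tfrac{2c_3^2+1}{4c_3^2}+\tfrac{2c_3^6-c_3^4}{2c_3^2-2}+2c_3^2-D_j\Big\}.$$ Let $$V(t,x)=\tfrac1{2c_3^2}\cdot\tfrac12\Big(\sum_{(i,j)\in E}B_{ij}(\tilde\theta_{ij}-\tilde\theta_{ij}^*)^2+\sum_jM_j(\omega_j-\omega_j^*)^2+\sum_j(\mu_j-\mu_j^*)^2\Big)+\sum_jU_j(t,\nu_j),$$ let $\overline V$ be a positive definite (with respect to $x^*$), radially unbounded function with $V(t,x)\le\overline V(x)$ for all $t\ge0$ and all $x$, and $\Omega_{\overline V}=\{x:\overline V(x)\le\tilde c\}$. Then every trajectory $x(t)$, $t\ge0$, of the closed-loop system with $x(0)\in\Omega_{\overline V}$ satisfies $x(t)\to x^*$ as $t\to\infty$. -/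

import Mathlib

open Filter Topology

noncomputable section

namespace FreqControl

/-- A function that is continuous, positive definite with respect to the point `c`, and radially
unbounded. -/
structure PosDefRadial {X : Type*} [NormedAddCommGroup X] (c : X) (W : X → ℝ) : Prop where
  continuous : Continuous W
  zero_at : W c = 0
  pos : ∀ x, x ≠ c → 0 < W x
  radial : Tendsto W (Bornology.cobounded X) atTop

/-- Euclidean norm of a coordinate vector. -/
def enorm2 {ι : Type*} [Fintype ι] (v : ι → ℝ) : ℝ := ‖WithLp.toLp 2 v‖

/-- Data of the power network, of the power imbalance and of the controller (all but the damping
gains `d`).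

* `E` is the arbitrarily oriented physical graph, `H` the communication graph.
* The variation of the power injection at node `j` is
  `q j t = q0 j + ∑ k, amp j k * sin (freq j k * t + phase j k)`, a superposition of `s j ≥ 1`
  genuine sinusoids: nonzero amplitudes, pairwise distinct positive frequencies.
* `r j` are the lower coefficients of the monic Hurwitz polynomial
  `τ ^ (2 s) + ∑ i, r i * τ ^ i`. -/
structure Network (N : Type*) [Fintype N] [DecidableEq N] where
  E : Finset (N × N)
  E_asymm : ∀ i j, (i, j) ∈ E → (j, i) ∉ E
  E_connected : (SimpleGraph.fromRel fun i j => (i, j) ∈ E).Connected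
  H : SimpleGraph N
  H_connected : H.Connected
  M : N → ℝ
  M_pos : ∀ j, 0 < M j
  D : N → ℝ
  D_pos : ∀ j, 0 < D j
  B : N × N → ℝ
  B_pos : ∀ e ∈ E, 0 < B e
  β : N → ℝ
  β_pos : ∀ j, 0 < β j
  Pbar : N → ℝ
  s : N → ℕ
  s_pos : ∀ j, 1 ≤ s j
  q0 : N → ℝ
  amp : ∀ j, Fin (s j) → ℝ
  amp_ne : ∀ j k, amp j k ≠ 0
  freq : ∀ j, Fin (s j) → ℝ
  freq_pos : ∀ j k, 0 < freq j k
  freq_inj : ∀ j, Function.Injective (freq j)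
  phase : ∀ j, Fin (s j) → ℝ
  r : ∀ j, Fin (2 * s j) → ℝ
  r_hurwitz : ∀ j (τ : ℂ), τ ^ (2 * s j) + ∑ i, (r j i : ℂ) * τ ^ (i : ℕ) = 0 → τ.re < 0
  kα : ℝ
  kα_pos : 0 < kα
  γ : ℝ
  γ_pos : 0 < γ

/-- The companion-type matrix `A(α)` of size `2 s + 1`: shift on top, last row
`(0, α₁, 0, α₂, …, α_s, 0)`. -/
def matA (s : ℕ) (α : Fin s → ℝ) : Matrix (Fin (2 * s + 1)) (Fin (2 * s + 1)) ℝ :=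
  Matrix.of fun i k =>
    if (i : ℕ) = 2 * s then ∑ m : Fin s, (if (k : ℕ) = 2 * (m : ℕ) + 1 then α m else 0)
    else if (k : ℕ) = (i : ℕ) + 1 then 1 else 0

/-- `Λ(ζ) = (ζ₂, ζ₄, …, ζ_{2s})` (one-based coordinates). -/
def vecΛ (s : ℕ) (ζ : Fin (2 * s + 1) → ℝ) : Fin s → ℝ :=
  fun m => ζ ⟨2 * (m : ℕ) + 1, by have := m.isLt; omega⟩

/-- `G = (0, …, 0, 1, γ)ᵀ`. -/
def vecG (s : ℕ) (γ : ℝ) : Fin (2 * s + 1) → ℝ :=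
  fun i => if (i : ℕ) = 2 * s then γ else if (i : ℕ) + 1 = 2 * s then 1 else 0

/-- The space of `ν = (η̂, ζ̃, α̃)` with its Euclidean norm. -/
abbrev NuSpace (s : ℕ) : Type := EuclideanSpace ℝ (Unit ⊕ Fin (2 * s + 1) ⊕ Fin s)

/-- The three blocks of `ν`. -/
def etaPart {s : ℕ} (ν : NuSpace s) : ℝ := ν (Sum.inl ())
def zetaPart {s : ℕ} (ν : NuSpace s) : Fin (2 * s + 1) → ℝ := fun i => ν (Sum.inr (Sum.inl i))
def alphaPart {s : ℕ} (ν : NuSpace s) : Fin s → ℝ := fun m => ν (Sum.inr (Sum.inr m))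

/-- The vector with given blocks. -/
def mkNu {s : ℕ} (η : ℝ) (ζ : Fin (2 * s + 1) → ℝ) (α : Fin s → ℝ) : NuSpace s :=
  WithLp.toLp 2 (Sum.elim (fun _ => η) (Sum.elim ζ α))

namespace Network

variable {N : Type*} [Fintype N] [DecidableEq N] (P : Network N)

/-- The variation `q_j(t)`. -/
def q (j : N) (t : ℝ) : ℝ :=
  P.q0 j + ∑ k, P.amp j k * Real.sin (P.freq j k * t + P.phase j k)

/-- `α_{jm}`: minus the elementary symmetric function of degree `s - m + 1` (one-based `m`) in the
squared frequencies. -/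
def α (j : N) : Fin (P.s j) → ℝ := fun m =>
  -∑ T ∈ Finset.powersetCard (P.s j - (m : ℕ)) Finset.univ, ∏ l ∈ T, P.freq j l ^ 2

/-- `λ_j = (q_j, q_j', q_j'', …)`. -/
def lam (j : N) (t : ℝ) : Fin (2 * P.s j + 1) → ℝ := fun k => iteratedDeriv (k : ℕ) (P.q j) t

/-- `R_j = (r_{j1}, …, r_{j,2s}, 1)`. -/
def R (j : N) : Fin (2 * P.s j + 1) → ℝ := Fin.snoc (P.r j) 1

/-- The row vector `Ã_j(α) = R_j (I + A_j(α))`. -/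
def Atilde (j : N) (α : Fin (P.s j) → ℝ) : Fin (2 * P.s j + 1) → ℝ :=
  Matrix.vecMul (P.R j) (1 + matA (P.s j) α)

/-- The matrix `O_j(α_j)` with rows `Ã_j A_j ^ i`, `i = 0, …, 2 s`. -/
def matO (j : N) : Matrix (Fin (2 * P.s j + 1)) (Fin (2 * P.s j + 1)) ℝ :=
  Matrix.of fun i => Matrix.vecMul (P.Atilde j (P.α j)) (matA (P.s j) (P.α j) ^ (i : ℕ))

/-- `φ_j(t) = O_j(α_j)⁻¹ λ_j(t)`. -/
def varphi (j : N) (t : ℝ) : Fin (2 * P.s j + 1) → ℝ := Matrix.mulVec (P.matO j)⁻¹ (P.lam j t)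

/-- `ζ_j = ζ̃_j + φ_j(t)`. -/
def zeta (j : N) (t : ℝ) (ν : NuSpace (P.s j)) : Fin (2 * P.s j + 1) → ℝ :=
  zetaPart ν + P.varphi j t

/-- `α̂_j = α̃_j + α_j`. -/
def alphaHat (j : N) (ν : NuSpace (P.s j)) : Fin (P.s j) → ℝ := alphaPart ν + P.α j

/-- `ρ_{qj} = Ã_j(α_j) φ_j - Ã_j(α̂_j) ζ_j`. -/
def rho (j : N) (t : ℝ) (ν : NuSpace (P.s j)) : ℝ :=
  P.Atilde j (P.α j) ⬝ᵥ P.varphi j t - P.Atilde j (P.alphaHat j ν) ⬝ᵥ P.zeta j t ν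

/-- The right-hand side of the adaptive internal-model subsystem; it depends on time through
`φ_j(t)`. -/
def nuField (j : N) (t : ℝ) (ν : NuSpace (P.s j)) (ω : ℝ) : NuSpace (P.s j) :=
  mkNu
    (-etaPart ν - P.M j * ω)
    (Matrix.mulVec (matA (P.s j) (P.alphaHat j ν) - matA (P.s j) (P.α j)) (P.zeta j t ν)
      - (etaPart ν + P.M j * ω) • vecG (P.s j) P.γ
      + Matrix.mulVec
          (matA (P.s j) (P.α j) - Matrix.vecMulVec (vecG (P.s j) P.γ) (P.R j)) (zetaPart ν))
    (-(P.kα * (etaPart ν + P.M j * ω + P.R j ⬝ᵥ zetaPart ν)) • vecΛ (P.s j) (P.zeta j t ν))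

/-- The states `x = (θ̃, ω, μ, ν)`, with `θ̃` indexed by the oriented edges. -/
abbrev State : Type _ := ({e // e ∈ P.E} → ℝ) × (N → ℝ) × (N → ℝ) × (∀ j, NuSpace (P.s j))

/-- The edge variables are angle differences: `θ̃_{ij} = θ_i - θ_j` for some angles `θ`. -/
def Admissible (x : P.State) : Prop :=
  ∃ θ : N → ℝ, ∀ e : {e // e ∈ P.E}, x.1 e = θ e.1.1 - θ e.1.2

open Classical in
/-- The right-hand side of the closed-loop system with damping gains `d`. -/
def field (d : N → ℝ) (t : ℝ) (x : P.State) : P.State :=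
  let θ := x.1
  let ω := x.2.1
  let μ := x.2.2.1
  let ν := x.2.2.2
  (fun e => ω e.1.1 - ω e.1.2,
   fun j => 1 / P.M j * (P.Pbar j + P.rho j t (ν j)
      + (∑ e : {e // e ∈ P.E}, if e.1.2 = j then P.B e.1 * θ e else 0)
      - (∑ e : {e // e ∈ P.E}, if e.1.1 = j then P.B e.1 * θ e else 0)
      - μ j / P.β j - d j * ω j - P.D j * ω j),
   fun j => -(∑ k, if P.H.Adj j k then μ j - μ k else 0) + ω j / P.β j,
   fun j => P.nuField j t (ν j) (ω j))

/-- Equilibrium points of the closed-loop system. -/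
def IsEquilibrium (d : N → ℝ) (x : P.State) : Prop :=
  P.Admissible x ∧ ∀ t, 0 ≤ t → P.field d t x = 0

/-- Trajectories of the closed-loop system on `[0, ∞)`. -/
def IsTrajectory (d : N → ℝ) (x : ℝ → P.State) : Prop :=
  P.Admissible (x 0) ∧
    ∀ t, 0 ≤ t → HasDerivWithinAt x (P.field d t (x t)) (Set.Ici 0) t

/-- `U` is a `C¹` time-varying strict Lyapunov function of the `j`-th adaptive internal-model
subsystem with zero input, with lower and upper bounds `Ulow`, `Uup` and gradient constant `b`. -/
structure IsSubLyapunov (j : N) (U : ℝ → NuSpace (P.s j) → ℝ)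
    (Ulow Uup : NuSpace (P.s j) → ℝ) (b : ℝ) : Prop where
  contDiff : ContDiff ℝ 1 (fun p : ℝ × NuSpace (P.s j) => U p.1 p.2)
  low_posDef : PosDefRadial 0 Ulow
  up_posDef : PosDefRadial 0 Uup
  low_le : ∀ t, 0 ≤ t → ∀ ν, Ulow ν ≤ U t ν
  le_up : ∀ t, 0 ≤ t → ∀ ν, U t ν ≤ Uup ν
  decay : ∀ t, 0 ≤ t → ∀ ν,
    deriv (fun τ => U τ ν) t + fderiv ℝ (U t) ν (P.nuField j t ν 0) ≤ -‖ν‖ ^ 2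
  b_pos : 0 < b
  grad_le : ∀ t, 0 ≤ t → ∀ ν, ‖fderiv ℝ (U t) ν‖ ≤ b * (‖ν‖ + ‖ν‖ ^ 3)

/-- `V₁ = ½ (x₁ - x₁*)ᵀ diag(B, M, I) (x₁ - x₁*)` with `x₁ = (θ̃, ω, μ)`. -/
def V1 (xs x : P.State) : ℝ :=
  1 / 2 * ((∑ e : {e // e ∈ P.E}, P.B e.1 * (x.1 e - xs.1 e) ^ 2)
    + (∑ j, P.M j * (x.2.1 j - xs.2.1 j) ^ 2)
    + ∑ j, (x.2.2.1 j - xs.2.2.1 j) ^ 2)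

/-- The composite Lyapunov function `V = V₁ / (2 c₃²) + ∑ j, U_j(t, ν_j)`. -/
def V (U : ∀ j, ℝ → NuSpace (P.s j) → ℝ) (c3 : ℝ) (xs : P.State) (t : ℝ) (x : P.State) : ℝ :=
  1 / (2 * c3 ^ 2) * P.V1 xs x + ∑ j, U j t (x.2.2.2 j)

/-- Admissible constants `c₂`, `c₃`, given gradient constants `b j`, a bound `cbar` of the `‖ν_j‖`
on the sublevel set and bounds `φbar j` of the `‖φ_j(t)‖`. -/
structure IsGainConst (b φbar : N → ℝ) (cbar c2 c3 : ℝ) : Prop where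
  c2_ge : ∀ j, enorm2 (P.R j) * φbar j + enorm2 (P.R j)
    + enorm2 (Matrix.vecMul (P.R j) (matA (P.s j) (P.α j))) ≤ c2
  one_le : 1 ≤ c3
  c3_ge_rho : c2 * (1 + cbar) ≤ c3
  c3_ge_grad : ∀ j, b j * (1 + cbar ^ 2) ≤ c3
  c3_ge_input : ∀ j, P.M j + enorm2 (vecG (P.s j) P.γ) * P.M j
    + P.kα * P.M j * (cbar + φbar j) ≤ c3

/-- The damping gains are large enough. -/
def AssumptionA1 (d : N → ℝ) (c3 : ℝ) : Prop :=
  ∀ j, max ((1 + 2 * c3 ^ 6) / 2 - P.D j)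
    ((2 * c3 ^ 2 + 1) / (4 * c3 ^ 2) + (2 * c3 ^ 6 - c3 ^ 4) / (2 * c3 ^ 2 - 2)
      + 2 * c3 ^ 2 - P.D j) < d j

end Network

end FreqControl

end

noncomputable section

namespace FreqControl

/-! ### Companion matrices `A(α)` and their characteristic polynomial. -/

section Companion

/-! The proof is a composite Lyapunov argument; steady state, adaptive subsystem and power network
are treated separately.

Steady state. The matrix A_j(α_j) has the eigenvalues 0 and ±i a_{jk}, and its first unit row vector
is cyclic. Hence O_j = p(A_j(α_j)) with p(τ) = (1 + τ)(τ^{2s} + Σ r_i τ^i). No root of p lies on the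
imaginary axis, so O_j is invertible (`isUnit_matO`), and φ_j is the sum of the modes of q_j with
amplitudes divided by p(i a) (`exists_varphi_eq`). The constant mode drops out of w = Λ(φ_j). As
amplitudes are nonzero and frequencies distinct, w wᵀ is a positive definite mean minus the
derivative of a bounded matrix S(t): persistent excitation (`exists_excitation`).

Subsystem with ω = 0. Let v = η̂ + R ζ̃ and let z be ζ̃ without its last entry. Then η̂ decays, z
follows a Hurwitz companion system driven by η̂, and v' = -γ v + α̃·Λ(ζ) + O(|z| + |η̂|). The
adaptation law cancels α̃·Λ(ζ), so B = v²/2 + |α̃|²/(2 kα) + k₂ Q(z) + k₃ η̂² decreases, but only at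
the rate of v² + |z|² + η̂² (`exists_weak_form`). Adding -2 v (α̃·w) - α̃ᵀ S α̃ yields -κ |α̃|². Its
remainders are dominated by the decay of a multiple of B + B² (`exists_strictLyapunov_of_forms`);
the quartic B² is why the gradient bound is cubic.

Network. Along the closed loop the flow and price couplings in V₁ cancel, leaving Σ (ω_j ρ_j - (d_j
+ D_j) ω_j²) minus the Laplacian form of μ (`power_balance`). While ‖ν_j‖ ≤ c̄, both ρ_j and the
effect of ω_j on U_j are bounded through c₃, and (A1) makes the resulting form in (‖ν_j‖, |ω_j|)
negative definite (`exists_dV_le`). Continuous induction keeps V ≤ c̃ (`V_le_of_isTrajectory`).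

Convergence. Barbalat's lemma sends the dissipation to 0, hence ω, ν and all price differences.
Applied again to M_j ω_j, whose derivative is the static imbalance plus vanishing terms, it sends
the imbalance to 0. On angle differences and prices, imbalance and price differences form an
injective linear map, which also underlies uniqueness of the equilibrium, so θ̃ and μ converge. -/

theorem matA_mulVec_castSucc (s : ℕ) (α : Fin s → ℝ) (ζ : Fin (2 * s + 1) → ℝ) (k : Fin (2 * s)) :
    Matrix.mulVec (matA s α) ζ k.castSucc = ζ k.succ := by
  have hk := k.isLt
  rw [Matrix.mulVec, dotProduct, Finset.sum_eq_single k.succ]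
  · simp [matA, hk.ne]
  · intro b _ hb
    have : (b : ℕ) ≠ (k : ℕ) + 1 := fun h => hb (Fin.ext (by simpa using h))
    simp [matA, hk.ne, this]
  · simp

theorem matA_mulVec_last (s : ℕ) (α : Fin s → ℝ) (ζ : Fin (2 * s + 1) → ℝ) :
    Matrix.mulVec (matA s α) ζ (Fin.last _) = α ⬝ᵥ vecΛ s ζ := by
  simp only [Matrix.mulVec, dotProduct, matA, Matrix.of_apply, Fin.val_last, if_true,
    Finset.sum_mul]
  rw [Finset.sum_comm]
  refine Finset.sum_congr rfl fun m _ => ?_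
  rw [Finset.sum_eq_single ⟨2 * (m : ℕ) + 1, by have := m.isLt; omega⟩]
  · simp [vecΛ]
  · intro b _ hb
    have : (b : ℕ) ≠ 2 * (m : ℕ) + 1 := fun h => hb (Fin.ext h)
    simp [this]
  · simp

theorem single_vecMul_matA (s : ℕ) (α : Fin s → ℝ) (k : Fin (2 * s)) :
    Matrix.vecMul (Pi.single k.castSucc 1) (matA s α) = Pi.single k.succ 1 := by
  refine dotProduct_eq _ _ fun ζ => ?_
  rw [← Matrix.dotProduct_mulVec, single_dotProduct, single_dotProduct,
    matA_mulVec_castSucc]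

theorem single_vecMul_matA_last (s : ℕ) (α : Fin s → ℝ) :
    Matrix.vecMul (Pi.single (Fin.last (2 * s)) 1) (matA s α) =
      ∑ m : Fin s, α m • Pi.single ⟨2 * (m : ℕ) + 1, by have := m.isLt; omega⟩ 1 := by
  refine dotProduct_eq _ _ fun ζ => ?_
  rw [← Matrix.dotProduct_mulVec, single_dotProduct, one_mul, matA_mulVec_last, sum_dotProduct]
  simp only [smul_dotProduct, single_dotProduct, one_mul, smul_eq_mul]
  rfl

/-- The first unit row vector is cyclic for `A(α)`, so a polynomial in `A(α)` is determined by its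
first row. -/
theorem single_zero_vecMul_matA_pow (s : ℕ) (α : Fin s → ℝ) (i : Fin (2 * s + 1)) :
    Matrix.vecMul (Pi.single 0 1) (matA s α ^ (i : ℕ)) = Pi.single i 1 := by
  induction i using Fin.induction with
  | zero => simp
  | succ k ih =>
    rw [Fin.val_succ, pow_succ, ← Matrix.vecMul_vecMul, ← Fin.val_castSucc, ih,
      single_vecMul_matA]

/-- The characteristic polynomial of `matA s α`. -/
def charA (s : ℕ) (α : Fin s → ℝ) : Polynomial ℝ :=
  Polynomial.X * (Polynomial.X ^ (2 * s)
    - ∑ m : Fin s, Polynomial.C (α m) * Polynomial.X ^ (2 * (m : ℕ)))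

/-- Cayley–Hamilton from the first row alone: row `i` is e₀ Aⁱ χ(A) = e₀ χ(A) Aⁱ, and e₀ χ(A) = 0 is
the definition of the last row of `A`. -/
theorem aeval_matA_charA (s : ℕ) (α : Fin s → ℝ) :
    Polynomial.aeval (matA s α) (charA s α) = 0 := by
  have hrow : Matrix.vecMul (Pi.single 0 1) (Polynomial.aeval (matA s α) (charA s α)) = 0 := by
    have h1 : Polynomial.aeval (matA s α) (charA s α) = matA s α ^ (2 * s) * matA s α -
        ∑ m : Fin s, α m • matA s α ^ (2 * (m : ℕ) + 1) := by
      simp only [charA, map_mul, map_sub, map_sum, Polynomial.aeval_X, map_pow,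
        Polynomial.aeval_C, mul_sub, Finset.mul_sum, ← pow_succ, ← pow_succ']
      congr 1
      refine Finset.sum_congr rfl fun m _ => ?_
      rw [← Algebra.smul_def, mul_smul_comm, ← pow_succ']
    have h2 := single_zero_vecMul_matA_pow s α (Fin.last _)
    rw [Fin.val_last] at h2
    have h3 : ∀ m : Fin s, Matrix.vecMul (Pi.single 0 1) (matA s α ^ (2 * (m : ℕ) + 1)) =
        Pi.single ⟨2 * (m : ℕ) + 1, by have := m.isLt; omega⟩ 1 := fun m =>
      single_zero_vecMul_matA_pow s α ⟨2 * (m : ℕ) + 1, by have := m.isLt; omega⟩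
    have h4 : Matrix.vecMul (Pi.single 0 1) (∑ m : Fin s, α m • matA s α ^ (2 * (m : ℕ) + 1)) =
        ∑ m : Fin s, α m • Pi.single ⟨2 * (m : ℕ) + 1, by have := m.isLt; omega⟩ 1 := by
      rw [Matrix.vecMul_sum]
      exact Finset.sum_congr rfl fun m _ => by rw [Matrix.vecMul_smul, h3]
    rw [h1, Matrix.vecMul_sub, ← Matrix.vecMul_vecMul, h2, single_vecMul_matA_last, h4, sub_self]
  ext i k
  have h5 : Matrix.vecMul (Pi.single i 1) (Polynomial.aeval (matA s α) (charA s α)) = 0 := by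
    have hc : Commute (matA s α ^ (i : ℕ)) (Polynomial.aeval (matA s α) (charA s α)) := by
      have := Polynomial.aeval_X_pow (R := ℝ) (matA s α) (n := (i : ℕ))
      rw [← this, commute_iff_eq, ← map_mul, ← map_mul, mul_comm (Polynomial.X ^ _)]
    rw [← single_zero_vecMul_matA_pow s α i, Matrix.vecMul_vecMul, hc.eq, ← Matrix.vecMul_vecMul,
      hrow, Matrix.zero_vecMul]
  simpa using congrFun h5 k

/-- Applied with `S` sending a complex amplitude to its mode vector and `μ = i a`: on a mode, p(A)
becomes multiplication by the scalar p(i a). -/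
theorem aeval_mulVec_of_intertwine {n : Type*} [Fintype n] [DecidableEq n] {W : Type*} [CommRing W]
    [Algebra ℝ W] (A : Matrix n n ℝ) (S : W →ₗ[ℝ] (n → ℝ)) (μ : W)
    (h : ∀ w, Matrix.mulVec A (S w) = S (μ * w)) (p : Polynomial ℝ) (w : W) :
    Matrix.mulVec (Polynomial.aeval A p) (S w) = S (Polynomial.aeval μ p * w) := by
  induction p using Polynomial.induction_on generalizing w with
  | C a => simp [Algebra.algebraMap_eq_smul_one, Matrix.smul_mulVec]
  | add p q hp hq => simp [Matrix.add_mulVec, hp, hq, add_mul]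
  | monomial n a ih =>
    rw [pow_succ, ← mul_assoc, map_mul _ _ Polynomial.X, map_mul _ _ Polynomial.X, Polynomial.aeval_X,
      Polynomial.aeval_X,
      ← Matrix.mulVec_mulVec, h, ih, mul_assoc]

end Companion

/-! ### Sinusoids as imaginary parts of complex amplitudes. -/

/-- The real sinusoid `Im (h * exp (i a t))`. -/
def sig (a t : ℝ) : ℂ →ₗ[ℝ] ℝ where
  toFun h := (h * Complex.exp (Complex.I * (a * t : ℝ))).im
  map_add' x y := by simp [add_mul]
  map_smul' c x := by simp [mul_assoc]

theorem sig_apply (a t : ℝ) (h : ℂ) :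
    sig a t h = (h * Complex.exp (Complex.I * (a * t : ℝ))).im := rfl

theorem hasDerivAt_sig (a t : ℝ) (h : ℂ) :
    HasDerivAt (fun t => sig a t h) (sig a t (Complex.I * a * h)) t := by
  have h1 : HasDerivAt (fun t : ℝ => h * Complex.exp (Complex.I * (a * t : ℝ)))
      (h * (Complex.exp (Complex.I * (a * t : ℝ)) * (Complex.I * (a * 1 : ℝ)))) t :=
    ((((hasDerivAt_id t).const_mul a).ofReal_comp.const_mul Complex.I).cexp).const_mul h
  have h2 := Complex.imCLM.hasFDerivAt.comp_hasDerivAt t h1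
  refine h2.congr_deriv ?_
  rw [sig_apply]
  simp only [mul_one, Complex.imCLM_apply]
  congr 1
  ring

theorem abs_sig_le (a t : ℝ) (h : ℂ) : |sig a t h| ≤ ‖h‖ := by
  rw [sig_apply]
  refine (Complex.abs_im_le_norm _).trans ?_
  rw [norm_mul, mul_comm Complex.I, Complex.norm_exp_ofReal_mul_I, mul_one]

theorem contDiff_sig (a : ℝ) (h : ℂ) {n : WithTop ℕ∞} : ContDiff ℝ n (fun t => sig a t h) := by
  have h1 : ContDiff ℝ n (fun t : ℝ => h * Complex.exp (Complex.I * (a * t : ℝ))) := by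
    have : ContDiff ℝ n (fun t : ℝ => ((a * t : ℝ) : ℂ)) :=
      Complex.ofRealCLM.contDiff.comp (contDiff_const.mul contDiff_id)
    exact contDiff_const.mul ((contDiff_const.mul this).cexp)
  exact Complex.imCLM.contDiff.comp h1

/-- Product-to-sum formula in a form where each term can be integrated as soon as its frequency is
nonzero. -/
theorem sig_mul_sig (a b t : ℝ) (h k : ℂ) :
    sig a t h * sig b t k = (sig (a - b) t (Complex.I * (h * (starRingEnd ℂ) k))
      - sig (a + b) t (Complex.I * (h * k))) / 2 := by
  simp only [sig_apply]
  have e1 : Complex.exp (Complex.I * ((a - b) * t : ℝ)) =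
      Complex.exp (Complex.I * (a * t : ℝ)) *
        (starRingEnd ℂ) (Complex.exp (Complex.I * (b * t : ℝ))) := by
    rw [← Complex.exp_conj, ← Complex.exp_add]
    congr 1
    simp
    ring
  have e2 : Complex.exp (Complex.I * ((a + b) * t : ℝ)) =
      Complex.exp (Complex.I * (a * t : ℝ)) * Complex.exp (Complex.I * (b * t : ℝ)) := by
    rw [← Complex.exp_add]
    congr 1
    push_cast
    ring
  rw [e1, e2]
  generalize Complex.exp (Complex.I * (a * t : ℝ)) = x
  generalize Complex.exp (Complex.I * (b * t : ℝ)) = y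
  simp
  ring

/-- The vector of successive derivatives of a sinusoid. -/
def sigVec (n : ℕ) (a t : ℝ) : ℂ →ₗ[ℝ] (Fin n → ℝ) :=
  LinearMap.pi fun m => sig a t ∘ₗ LinearMap.mulLeft ℝ ((Complex.I * a) ^ (m : ℕ))

theorem sigVec_apply (n : ℕ) (a t : ℝ) (h : ℂ) (m : Fin n) :
    sigVec n a t h m = sig a t ((Complex.I * a) ^ (m : ℕ) * h) := rfl

/-- The shift rows multiply a mode by i a trivially; in the last row this is exactly the
characteristic equation at i a. -/
theorem matA_mulVec_sigVec (s : ℕ) (α : Fin s → ℝ) (a t : ℝ)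
    (hχ : Polynomial.aeval (Complex.I * a) (charA s α) = 0) (h : ℂ) :
    Matrix.mulVec (matA s α) (sigVec (2 * s + 1) a t h) =
      sigVec (2 * s + 1) a t (Complex.I * a * h) := by
  ext i
  refine Fin.lastCases ?_ (fun k => ?_) i
  · rw [matA_mulVec_last, sigVec_apply]
    have h1 : (Complex.I * a) ^ (2 * s + 1) =
        ∑ m : Fin s, (α m : ℂ) * (Complex.I * a) ^ (2 * (m : ℕ) + 1) := by
      have := hχ
      simp only [charA, map_mul, map_sub, map_sum, Polynomial.aeval_X, map_pow,
        Polynomial.aeval_C, mul_sub, Finset.mul_sum, ← pow_succ'] at this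
      rw [sub_eq_zero.1 this]
      refine Finset.sum_congr rfl fun m _ => ?_
      rw [pow_succ]
      simp
      ring
    rw [Fin.val_last, ← mul_assoc, ← pow_succ, h1, Finset.sum_mul, map_sum]
    refine Finset.sum_congr rfl fun m _ => ?_
    have : vecΛ s (sigVec (2 * s + 1) a t h) m =
      sig a t ((Complex.I * a) ^ (2 * (m : ℕ) + 1) * h) := rfl
    rw [this, mul_assoc, ← Complex.real_smul, map_smul, smul_eq_mul]
  · rw [matA_mulVec_castSucc, sigVec_apply, sigVec_apply, Fin.val_succ, Fin.val_castSucc]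
    congr 1
    ring

/-! ### Spectrum of `A(α_j)`, invertibility of `O_j`, modes of the steady state. -/

namespace Network

variable {N : Type*} [Fintype N] [DecidableEq N] (P : Network N)

/-- Vieta's formulas for ∏ (X + a_k²), followed by the substitution X ↦ X². -/
theorem charA_α (j : N) : charA (P.s j) (P.α j) =
    Polynomial.X * ∏ k, (Polynomial.X ^ 2 + Polynomial.C (P.freq j k ^ 2)) := by
  have h1 : ∏ k, (Polynomial.X + Polynomial.C (P.freq j k ^ 2)) =
      Polynomial.X ^ (P.s j) - ∑ m : Fin (P.s j),
        Polynomial.C (P.α j m) * Polynomial.X ^ (m : ℕ) := by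
    set p : Polynomial ℝ := ∏ k, (Polynomial.X + Polynomial.C (P.freq j k ^ 2)) with hp
    have hdeg : p.natDegree = P.s j := by
      rw [hp, Polynomial.natDegree_prod_of_monic _ _ fun k _ => Polynomial.monic_X_add_C _]
      simp only [Polynomial.natDegree_X_add_C, Finset.sum_const, Finset.card_univ,
        Fintype.card_fin, smul_eq_mul, mul_one]
    have hm : p.Monic := Polynomial.monic_prod_of_monic _ _ fun k _ => Polynomial.monic_X_add_C _
    conv_lhs => rw [hm.as_sum, hdeg, Finset.sum_range]
    rw [sub_eq_add_neg, ← Finset.sum_neg_distrib]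
    congr 1
    refine Finset.sum_congr rfl fun m _ => ?_
    rw [hp, Finset.prod_X_add_C_coeff _ _ (by simp), Finset.card_univ,
      Fintype.card_fin, ← neg_mul, ← Polynomial.C_neg, α, neg_neg]
  have h2 := congrArg (fun q : Polynomial ℝ => q.comp (Polynomial.X ^ 2)) h1
  simp only [Polynomial.prod_comp, Polynomial.sub_comp, Polynomial.sum_comp,
    Polynomial.add_comp, Polynomial.X_comp, Polynomial.C_comp, Polynomial.mul_comp,
    Polynomial.pow_comp, ← pow_mul] at h2
  rw [h2, charA]

theorem aeval_charA_freq (j : N) (k : Fin (P.s j)) :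
    Polynomial.aeval (Complex.I * P.freq j k) (charA (P.s j) (P.α j)) = 0 := by
  rw [charA_α, map_mul, map_prod, Finset.prod_eq_zero (Finset.mem_univ k), mul_zero]
  simp [mul_pow]

theorem aeval_charA_zero (j : N) :
    Polynomial.aeval (Complex.I * (0 : ℝ)) (charA (P.s j) (P.α j)) = 0 := by
  rw [charA_α, map_mul]
  simp

/-- If μ² = -a_k² and Re μ ≠ 0, then μ would be real, which a_k > 0 excludes. -/
theorem charA_root_re (j : N) (μ : ℂ)
    (h : Polynomial.aeval μ (charA (P.s j) (P.α j)) = 0) : μ.re = 0 := by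
  rw [charA_α, map_mul, map_prod, mul_eq_zero, Polynomial.aeval_X, Finset.prod_eq_zero_iff] at h
  rcases h with h | ⟨k, -, h⟩
  · simp [h]
  · have ha := P.freq_pos j k
    simp at h
    have h1 := congrArg Complex.re h
    have h2 := congrArg Complex.im h
    simp [pow_two] at h1 h2
    by_contra hne
    have : μ.im = 0 := by
      have : μ.re * μ.im = 0 := by linarith
      exact (mul_eq_zero.1 this).resolve_left hne
    rw [this] at h1
    nlinarith [mul_pos ha ha, sq_nonneg μ.re]

/-- The polynomial `(1 + τ) (τ ^ (2 s) + ∑ i, r i * τ ^ i)`. -/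
def outPoly (j : N) : Polynomial ℝ :=
  (Polynomial.X ^ (2 * P.s j) + ∑ i, Polynomial.C (P.r j i) * Polynomial.X ^ (i : ℕ))
    * (1 + Polynomial.X)

/-- One factor is Hurwitz and the other has the single root -1, so neither vanishes on the imaginary
axis. -/
theorem outPoly_aeval_ne_zero (j : N) (μ : ℂ) (h : μ.re = 0) :
    Polynomial.aeval μ (P.outPoly j) ≠ 0 := by
  rw [outPoly, map_mul, mul_ne_zero_iff]
  constructor
  · intro h0
    have := P.r_hurwitz j μ (by simpa using h0)
    exact absurd h this.ne
  · intro h0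
    have := congrArg Complex.re h0
    simp [h] at this

theorem R_vecMul (j : N) (α : Fin (P.s j) → ℝ) : P.R j = Matrix.vecMul (Pi.single 0 1)
    (Polynomial.aeval (matA (P.s j) α) (Polynomial.X ^ (2 * P.s j) +
      ∑ i, Polynomial.C (P.r j i) * Polynomial.X ^ (i : ℕ))) := by
  have h2 := single_zero_vecMul_matA_pow (P.s j) α (Fin.last _)
  rw [Fin.val_last] at h2
  have h3 : ∀ i : Fin (2 * P.s j), Matrix.vecMul (Pi.single 0 1) (matA (P.s j) α ^ (i : ℕ)) =
      Pi.single i.castSucc 1 := fun i => by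
    rw [← single_zero_vecMul_matA_pow (P.s j) α i.castSucc, Fin.val_castSucc]
  simp only [map_add, map_sum, map_mul, map_pow, Polynomial.aeval_X, Polynomial.aeval_C,
    ← Algebra.smul_def, Matrix.vecMul_add, Matrix.vecMul_sum, Matrix.vecMul_smul, h2, h3]
  ext i
  refine Fin.lastCases ?_ (fun k => ?_) i
  · simp [R, Finset.sum_apply, (Fin.castSucc_lt_last _).ne']
  · simp [R, Finset.sum_apply, Pi.single_apply, (Fin.castSucc_lt_last _).ne]

/-- The row vector Ã equals e₀ p(A), and p(A) commutes with A, so row `i` of `O_j` is e₀ Aⁱ p(A) =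
e_i p(A). -/
theorem matO_eq_aeval (j : N) :
    P.matO j = Polynomial.aeval (matA (P.s j) (P.α j)) (P.outPoly j) := by
  set A := matA (P.s j) (P.α j) with hA
  have h1 : P.Atilde j (P.α j) =
      Matrix.vecMul (Pi.single 0 1) (Polynomial.aeval A (P.outPoly j)) := by
    rw [Atilde, R_vecMul P j (P.α j), Matrix.vecMul_vecMul, outPoly, map_mul]
    simp [hA]
  ext i k
  have hc : Commute (A ^ (i : ℕ)) (Polynomial.aeval A (P.outPoly j)) := by
    have := Polynomial.aeval_X_pow (R := ℝ) A (n := (i : ℕ))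
    rw [← this, commute_iff_eq, ← map_mul, ← map_mul, mul_comm (Polynomial.X ^ _)]
  have h2 : Matrix.vecMul (P.Atilde j (P.α j)) (A ^ (i : ℕ)) =
      Matrix.vecMul (Pi.single i 1) (Polynomial.aeval A (P.outPoly j)) := by
    rw [h1, Matrix.vecMul_vecMul, ← hc.eq, ← Matrix.vecMul_vecMul, hA,
      single_zero_vecMul_matA_pow]
  have h3 := congrFun h2 k
  simp only [Matrix.single_one_vecMul] at h3
  exact h3

/-- The two polynomials have no common complex root; evaluating a Bézout identity at A, where the
characteristic polynomial vanishes, gives an inverse of p(A). -/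
theorem isUnit_matO (j : N) : IsUnit (P.matO j) := by
  have hcop : IsCoprime (P.outPoly j) (charA (P.s j) (P.α j)) := by
    rw [Polynomial.isCoprime_iff_aeval_ne_zero_of_isAlgClosed ℝ ℂ]
    intro μ
    by_cases h : Polynomial.aeval μ (charA (P.s j) (P.α j)) = 0
    · exact Or.inl (P.outPoly_aeval_ne_zero j μ (P.charA_root_re j μ h))
    · exact Or.inr h
  obtain ⟨u, v, huv⟩ := hcop
  have := congrArg (Polynomial.aeval (matA (P.s j) (P.α j))) huv
  rw [map_add, map_mul, map_mul, aeval_matA_charA, mul_zero, add_zero, map_one,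
    ← matO_eq_aeval] at this
  exact (Matrix.isUnit_iff_isUnit_det _).2 (Matrix.isUnit_det_of_left_inverse this)

theorem q_eq_sig (j : N) (t : ℝ) : P.q j t = sig 0 t (Complex.I * P.q0 j) +
    ∑ k, sig (P.freq j k) t (P.amp j k * Complex.exp (Complex.I * P.phase j k)) := by
  rw [q]
  congr 1
  · simp [sig_apply]
  · refine Finset.sum_congr rfl fun k _ => ?_
    rw [sig_apply, mul_assoc, ← Complex.exp_add, ← mul_add, ← Complex.ofReal_add,
      mul_comm Complex.I, Complex.im_ofReal_mul, Complex.exp_ofReal_mul_I_im, add_comm]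

theorem iteratedDeriv_sig (a : ℝ) (h : ℂ) (m : ℕ) : iteratedDeriv m (fun t => sig a t h) =
    fun t => sig a t ((Complex.I * a) ^ m * h) := by
  induction m with
  | zero => simp
  | succ m ih =>
    rw [iteratedDeriv_succ, ih]
    ext t
    rw [(hasDerivAt_sig a t _).deriv]
    congr 1
    ring

theorem lam_eq (j : N) (t : ℝ) : P.lam j t = sigVec _ 0 t (Complex.I * P.q0 j) +
    ∑ k, sigVec _ (P.freq j k) t (P.amp j k * Complex.exp (Complex.I * P.phase j k)) := by
  ext m
  have hq : P.q j = (fun t => sig 0 t (Complex.I * P.q0 j)) +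
      ∑ k, fun t => sig (P.freq j k) t (P.amp j k * Complex.exp (Complex.I * P.phase j k)) := by
    ext t
    simp [q_eq_sig, Finset.sum_apply]
  rw [lam, hq, iteratedDeriv_add (contDiff_sig _ _).contDiffAt
    (by rw [Finset.sum_fn]; exact ContDiff.contDiffAt (ContDiff.sum fun k _ => contDiff_sig _ _)),
    iteratedDeriv_sum]
  · simp only [iteratedDeriv_sig, Pi.add_apply, Finset.sum_apply, sigVec_apply]
  · exact fun k _ => (contDiff_sig _ _).contDiffAt

/-- The complex amplitudes of the steady state `φ_j`. -/
def steadyAmp (j : N) (k : Fin (P.s j)) : ℂ :=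
  (Polynomial.aeval (Complex.I * P.freq j k) (P.outPoly j))⁻¹
    * (P.amp j k * Complex.exp (Complex.I * P.phase j k))

theorem steadyAmp_ne_zero (j : N) (k : Fin (P.s j)) : P.steadyAmp j k ≠ 0 := by
  refine mul_ne_zero (inv_ne_zero (P.outPoly_aeval_ne_zero j _ (by simp))) (mul_ne_zero ?_ ?_)
  · exact_mod_cast P.amp_ne j k
  · exact Complex.exp_ne_zero _

/-- `O_j φ_j = λ_j` is solved mode by mode: `O_j` acts on the mode of frequency a as the nonzero
scalar p(i a). -/
theorem exists_varphi_eq (j : N) : ∃ h0 : ℂ, ∀ t, P.varphi j t = sigVec _ 0 t h0 +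
    ∑ k, sigVec _ (P.freq j k) t (P.steadyAmp j k) := by
  refine ⟨(Polynomial.aeval (Complex.I * (0 : ℝ)) (P.outPoly j))⁻¹ * (Complex.I * P.q0 j),
    fun t => ?_⟩
  have hO := (Matrix.isUnit_iff_isUnit_det _).1 (P.isUnit_matO j)
  have key : Matrix.mulVec (P.matO j) (sigVec _ 0 t
      ((Polynomial.aeval (Complex.I * (0 : ℝ)) (P.outPoly j))⁻¹ * (Complex.I * P.q0 j)) +
    ∑ k, sigVec _ (P.freq j k) t (P.steadyAmp j k)) = P.lam j t := by
    rw [lam_eq, matO_eq_aeval, Matrix.mulVec_add, Matrix.mulVec_sum,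
      aeval_mulVec_of_intertwine _ _ _ (matA_mulVec_sigVec _ _ 0 t (P.aeval_charA_zero j)),
      mul_inv_cancel_left₀ (P.outPoly_aeval_ne_zero j _ (by simp))]
    congr 1
    refine Finset.sum_congr rfl fun k _ => ?_
    rw [aeval_mulVec_of_intertwine _ _ _ (matA_mulVec_sigVec _ _ _ t (P.aeval_charA_freq j k)),
      steadyAmp, mul_inv_cancel_left₀ (P.outPoly_aeval_ne_zero j _ (by simp))]
  rw [varphi, ← key, Matrix.mulVec_mulVec, Matrix.nonsing_inv_mul _ hO, Matrix.one_mulVec]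

end Network

/-! ### Persistent excitation. -/

theorem exists_antideriv_sig_mul_sig_of_ne {a b : ℝ} (hab : a ≠ b) (hab' : a + b ≠ 0) (h k : ℂ) :
    ∃ (f : ℝ → ℝ) (C : ℝ), ContDiff ℝ 1 f ∧ (∀ t, |f t| ≤ C) ∧
      ∀ t, HasDerivAt f (-(sig a t h * sig b t k)) t := by
  have h1 : ((a : ℂ) - b) ≠ 0 := sub_ne_zero.2 (by exact_mod_cast hab)
  have h2 : ((a : ℂ) + b) ≠ 0 := by exact_mod_cast hab'
  refine ⟨fun t => -(1 / 2) * (sig (a - b) t (h * (starRingEnd ℂ) k / ((a : ℂ) - b))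
      - sig (a + b) t (h * k / ((a : ℂ) + b))), 1 / 2 * (‖h * (starRingEnd ℂ) k / ((a : ℂ) - b)‖
      + ‖h * k / ((a : ℂ) + b)‖), ?_, fun t => ?_, fun t => ?_⟩
  · exact contDiff_const.mul ((contDiff_sig _ _).sub (contDiff_sig _ _))
  · rw [abs_mul, abs_neg, abs_of_pos (by norm_num : (0 : ℝ) < 1 / 2)]
    gcongr
    exact (abs_sub _ _).trans (add_le_add (abs_sig_le _ _ _) (abs_sig_le _ _ _))
  · refine (((hasDerivAt_sig (a - b) t _).sub (hasDerivAt_sig (a + b) t _)).const_mul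
      (-(1 / 2))).congr_deriv ?_
    rw [sig_mul_sig]
    have e1 : Complex.I * ((a - b : ℝ) : ℂ) * (h * (starRingEnd ℂ) k / ((a : ℂ) - b)) =
        Complex.I * (h * (starRingEnd ℂ) k) := by
      push_cast
      field_simp
    have e2 : Complex.I * ((a + b : ℝ) : ℂ) * (h * k / ((a : ℂ) + b)) =
        Complex.I * (h * k) := by
      push_cast
      field_simp
    rw [e1, e2]
    ring

/-- The difference frequency is 0 and contributes the mean ‖h‖²/2; only the doubled frequency is
integrated. -/
theorem exists_antideriv_sig_sq {a : ℝ} (ha : a ≠ 0) (h : ℂ) :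
    ∃ (f : ℝ → ℝ) (C : ℝ), ContDiff ℝ 1 f ∧ (∀ t, |f t| ≤ C) ∧
      ∀ t, HasDerivAt f (‖h‖ ^ 2 / 2 - sig a t h * sig a t h) t := by
  have h2 : ((a : ℂ) + a) ≠ 0 := by
    rw [← two_mul]
    exact mul_ne_zero two_ne_zero (by exact_mod_cast ha)
  refine ⟨fun t => 1 / 2 * sig (a + a) t (h * h / ((a : ℂ) + a)),
    1 / 2 * ‖h * h / ((a : ℂ) + a)‖, ?_, fun t => ?_, fun t => ?_⟩
  · exact contDiff_const.mul (contDiff_sig _ _)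
  · rw [abs_mul, abs_of_pos (by norm_num : (0 : ℝ) < 1 / 2)]
    gcongr
    exact abs_sig_le _ _ _
  · refine ((hasDerivAt_sig (a + a) t _).const_mul (1 / 2)).congr_deriv ?_
    rw [sig_mul_sig]
    have e2 : Complex.I * ((a + a : ℝ) : ℂ) * (h * h / ((a : ℂ) + a)) = Complex.I * (h * h) := by
      rw [Complex.ofReal_add, mul_assoc, mul_div_cancel₀ _ h2]
    have e1 : sig (a - a) t (Complex.I * (h * (starRingEnd ℂ) h)) = ‖h‖ ^ 2 := by
      rw [Complex.mul_conj, Complex.normSq_eq_norm_sq, sub_self, sig_apply]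
      rw [zero_mul, Complex.ofReal_zero, mul_zero, Complex.exp_zero, mul_one, Complex.I_mul_im,
        Complex.ofReal_re]
    rw [e1, e2]
    ring

/-- A sum of sinusoids with distinct frequencies excites all of its modes: the matrix of products
of the modes is its positive definite mean up to the derivative of a bounded matrix. -/
theorem exists_antideriv_modes {s : ℕ} (a : Fin s → ℝ) (ha : ∀ k, 0 < a k)
    (hinj : Function.Injective a) (g : Fin s → ℂ) :
    ∃ (f : Fin s → Fin s → ℝ → ℝ) (C : ℝ), (∀ k l, ContDiff ℝ 1 (f k l)) ∧
      (∀ k l t, |f k l t| ≤ C) ∧ ∀ k l t, HasDerivAt (f k l)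
        ((if k = l then ‖g k‖ ^ 2 / 2 else 0) - sig (a k) t (g k) * sig (a l) t (g l)) t := by
  have H : ∀ k l, ∃ (f : ℝ → ℝ) (C : ℝ), ContDiff ℝ 1 f ∧ (∀ t, |f t| ≤ C) ∧
      ∀ t, HasDerivAt f ((if k = l then ‖g k‖ ^ 2 / 2 else 0)
        - sig (a k) t (g k) * sig (a l) t (g l)) t := by
    intro k l
    by_cases hkl : k = l
    · subst hkl
      simpa using exists_antideriv_sig_sq (ha k).ne' (g k)
    · simpa [hkl] using exists_antideriv_sig_mul_sig_of_ne (hinj.ne hkl)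
        (add_pos (ha k) (ha l)).ne' (g k) (g l)
  choose f C h1 h2 h3 using H
  refine ⟨f, ∑ k, ∑ l, |C k l|, h1, fun k l t => (h2 k l t).trans ((le_abs_self _).trans ?_), h3⟩
  refine (Finset.single_le_sum (f := fun l => |C k l|) (fun _ _ => abs_nonneg _)
    (Finset.mem_univ l)).trans ?_
  exact Finset.single_le_sum (f := fun k => ∑ l, |C k l|)
    (fun _ _ => Finset.sum_nonneg fun _ _ => abs_nonneg _) (Finset.mem_univ k)

/-- Makes injectivity quantitative; used for the mode amplitudes, both sets of cascade coordinates
and the final residual. -/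
theorem LinearMap.exists_pos_mul_norm_le {E F : Type*} [NormedAddCommGroup E] [NormedSpace ℝ E]
    [NormedAddCommGroup F] [NormedSpace ℝ F] [FiniteDimensional ℝ E] (f : E →ₗ[ℝ] F)
    (hf : LinearMap.ker f = ⊥) : ∃ c : ℝ, 0 < c ∧ ∀ x, c * ‖x‖ ≤ ‖f x‖ := by
  obtain ⟨K, hK, h⟩ := f.exists_antilipschitzWith hf
  have hK' : (0 : ℝ) < K := hK
  refine ⟨(K : ℝ)⁻¹, by positivity, fun x => ?_⟩
  have := h.le_mul_dist x 0
  rw [dist_zero_right, map_zero, dist_zero_right] at this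
  rw [inv_mul_le_iff₀ hK']
  exact this

theorem sum_comm_four {ι κ : Type*} [Fintype ι] [Fintype κ] (F : ι → ι → κ → κ → ℝ) :
    ∑ m, ∑ l, ∑ k, ∑ k', F m l k k' = ∑ k, ∑ k', ∑ m, ∑ l, F m l k k' := by
  calc _ = ∑ m, ∑ k, ∑ l, ∑ k', F m l k k' := Finset.sum_congr rfl fun m _ => Finset.sum_comm
    _ = ∑ k, ∑ m, ∑ l, ∑ k', F m l k k' := Finset.sum_comm
    _ = ∑ k, ∑ m, ∑ k', ∑ l, F m l k k' := Finset.sum_congr rfl fun k _ =>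
      Finset.sum_congr rfl fun m _ => Finset.sum_comm
    _ = _ := Finset.sum_congr rfl fun k _ => Finset.sum_comm

namespace Network

variable {N : Type*} [Fintype N] [DecidableEq N] (P : Network N)

theorem contDiff_varphi (j : N) (m : Fin (2 * P.s j + 1)) {n : WithTop ℕ∞} :
    ContDiff ℝ n (fun t => P.varphi j t m) := by
  obtain ⟨h0, h⟩ := P.exists_varphi_eq j
  simp only [h, Pi.add_apply, Finset.sum_apply, sigVec_apply]
  exact (contDiff_sig _ _).add (ContDiff.sum fun k _ => contDiff_sig _ _)

theorem hasDerivAt_varphi (j : N) (m : Fin (2 * P.s j)) (t : ℝ) :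
    HasDerivAt (fun t => P.varphi j t m.castSucc) (P.varphi j t m.succ) t := by
  obtain ⟨h0, h⟩ := P.exists_varphi_eq j
  simp only [h, Pi.add_apply, Finset.sum_apply, sigVec_apply]
  refine ((hasDerivAt_sig _ _ _).add (HasDerivAt.fun_sum fun k _ =>
    hasDerivAt_sig _ _ _)).congr_deriv ?_
  simp only [Fin.val_succ, Fin.val_castSucc, pow_succ']
  simp only [mul_assoc]

theorem exists_varphi_bound (j : N) : ∃ C, ∀ t m, |P.varphi j t m| ≤ C := by
  obtain ⟨h0, h⟩ := P.exists_varphi_eq j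
  have H : ∀ m : Fin (2 * P.s j + 1), ∃ C, ∀ t, |P.varphi j t m| ≤ C := by
    intro m
    refine ⟨‖(Complex.I * (0 : ℝ)) ^ (m : ℕ) * h0‖ +
      ∑ k, ‖(Complex.I * P.freq j k) ^ (m : ℕ) * P.steadyAmp j k‖, fun t => ?_⟩
    simp only [h, Pi.add_apply, Finset.sum_apply, sigVec_apply]
    refine (abs_add_le _ _).trans (add_le_add (abs_sig_le _ _ _) ?_)
    exact (Finset.abs_sum_le_sum_abs _ _).trans (Finset.sum_le_sum fun k _ => abs_sig_le _ _ _)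
  choose C hC using H
  exact ⟨∑ m, |C m|, fun t m => (hC m t).trans ((le_abs_self _).trans
    (Finset.single_le_sum (f := fun m => |C m|) (fun _ _ => abs_nonneg _) (Finset.mem_univ m)))⟩

/-- The coefficients of the regressor `Λ(φ_j)` in the modes of `φ_j`. -/
def modeCoeff (j : N) (m k : Fin (P.s j)) : ℝ := P.freq j k * (-(P.freq j k ^ 2)) ^ (m : ℕ)

/-- `Λ` picks derivatives of odd order 2m + 1. These kill the constant mode and multiply a mode by
(i a)^{2m+1} = i a (-a²)^m; the factor i is put into the amplitude. -/
theorem vecΛ_varphi (j : N) (t : ℝ) (m : Fin (P.s j)) : vecΛ (P.s j) (P.varphi j t) m =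
    ∑ k, P.modeCoeff j m k * sig (P.freq j k) t (Complex.I * P.steadyAmp j k) := by
  obtain ⟨h0, h⟩ := P.exists_varphi_eq j
  simp only [vecΛ, h, Pi.add_apply, Finset.sum_apply, sigVec_apply]
  rw [Complex.ofReal_zero, mul_zero, zero_pow (by omega), zero_mul, map_zero, zero_add]
  refine Finset.sum_congr rfl fun k _ => ?_
  rw [← smul_eq_mul (P.modeCoeff j m k), ← map_smul, Complex.real_smul, modeCoeff]
  congr 1
  rw [pow_succ, pow_mul, mul_pow, Complex.I_sq]
  push_cast
  ring

/-- The linear map from parameter errors to mode amplitudes of the regression error. -/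
def modeMap (j : N) : (Fin (P.s j) → ℝ) →ₗ[ℝ] (Fin (P.s j) → ℝ) :=
  LinearMap.pi fun k => ∑ m, P.modeCoeff j m k • LinearMap.proj m

theorem modeMap_apply (j : N) (α : Fin (P.s j) → ℝ) (k : Fin (P.s j)) :
    P.modeMap j α k = ∑ m, P.modeCoeff j m k * α m := by
  simp [modeMap]

/-- The coefficients form a positive diagonal matrix times the Vandermonde matrix of the distinct
nodes -a_k². -/
theorem ker_modeMap (j : N) : LinearMap.ker (P.modeMap j) = ⊥ := by
  rw [LinearMap.ker_eq_bot']
  intro α hα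
  have hdet : (Matrix.vandermonde fun k => -(P.freq j k ^ 2)).det ≠ 0 := by
    rw [Matrix.det_vandermonde_ne_zero_iff]
    intro k l hkl
    refine P.freq_inj j ?_
    have := P.freq_pos j k
    have := P.freq_pos j l
    exact (pow_left_inj₀ (by positivity) (by positivity) two_ne_zero).1 (neg_injective hkl)
  refine Matrix.eq_zero_of_mulVec_eq_zero hdet ?_
  ext k
  have h1 := congrFun hα k
  rw [modeMap_apply, Pi.zero_apply] at h1
  have h2 : P.freq j k * Matrix.mulVec (Matrix.vandermonde fun k => -(P.freq j k ^ 2)) α k = 0 := by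
    rw [← h1, Matrix.mulVec, dotProduct, Finset.mul_sum]
    refine Finset.sum_congr rfl fun m _ => ?_
    rw [Matrix.vandermonde_apply, modeCoeff]
    ring
  exact (mul_eq_zero.1 h2).resolve_left (P.freq_pos j k).ne'

theorem dotProduct_vecΛ_varphi (j : N) (t : ℝ) (α : Fin (P.s j) → ℝ) :
    α ⬝ᵥ vecΛ (P.s j) (P.varphi j t) =
      ∑ k, P.modeMap j α k * sig (P.freq j k) t (Complex.I * P.steadyAmp j k) := by
  simp only [dotProduct, vecΛ_varphi, modeMap_apply, Finset.mul_sum, Finset.sum_mul]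
  rw [Finset.sum_comm]
  exact Finset.sum_congr rfl fun k _ => Finset.sum_congr rfl fun m _ => by ring

/-- Persistent excitation of the regressor `Λ(φ_j)`. -/
theorem exists_excitation (j : N) :
    ∃ (S : Fin (P.s j) → Fin (P.s j) → ℝ → ℝ) (C κ : ℝ), 0 < κ ∧
      (∀ m l, ContDiff ℝ 1 (S m l)) ∧ (∀ m l t, |S m l t| ≤ C) ∧
      ∀ t (α : Fin (P.s j) → ℝ), κ * ‖α‖ ^ 2 - (α ⬝ᵥ vecΛ (P.s j) (P.varphi j t)) ^ 2 ≤
        ∑ m, ∑ l, α m * α l * deriv (S m l) t := by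
  obtain ⟨f, C, hf, hfC, hf'⟩ := exists_antideriv_modes (P.freq j) (P.freq_pos j) (P.freq_inj j)
    (fun k => Complex.I * P.steadyAmp j k)
  obtain ⟨c, hc, hcα⟩ := LinearMap.exists_pos_mul_norm_le (P.modeMap j) (P.ker_modeMap j)
  have : Nonempty (Fin (P.s j)) := ⟨⟨0, P.s_pos j⟩⟩
  obtain ⟨k0, hk0⟩ := Finite.exists_min fun k => ‖Complex.I * P.steadyAmp j k‖ ^ 2 / 2
  set κ0 := ‖Complex.I * P.steadyAmp j k0‖ ^ 2 / 2 with hκ0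
  have hκ0pos : 0 < κ0 := by
    have : 0 < ‖Complex.I * P.steadyAmp j k0‖ :=
      norm_pos_iff.2 (mul_ne_zero Complex.I_ne_zero (P.steadyAmp_ne_zero j k0))
    positivity
  -- `S` is the matrix of antiderivatives `f` expressed in regressor coordinates; the rate is the
  -- least mean `κ0` times the squared lower bound `c` of `modeMap`.
  refine ⟨fun m l t => ∑ k, ∑ k', P.modeCoeff j m k * P.modeCoeff j l k' * f k k' t,
    ∑ m, ∑ l, ∑ k, ∑ k', |P.modeCoeff j m k * P.modeCoeff j l k'| * C, κ0 * c ^ 2, by positivity,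
    fun m l => ?_, fun m l t => ?_, fun t α => ?_⟩
  · exact ContDiff.sum fun k _ => ContDiff.sum fun k' _ => contDiff_const.mul (hf k k')
  · have hC : 0 ≤ C := (abs_nonneg _).trans (hfC k0 k0 0)
    have h1 : |∑ k, ∑ k', P.modeCoeff j m k * P.modeCoeff j l k' * f k k' t| ≤
        ∑ k, ∑ k', |P.modeCoeff j m k * P.modeCoeff j l k'| * C := by
      refine (Finset.abs_sum_le_sum_abs _ _).trans (Finset.sum_le_sum fun k _ => ?_)
      refine (Finset.abs_sum_le_sum_abs _ _).trans (Finset.sum_le_sum fun k' _ => ?_)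
      rw [abs_mul]
      gcongr
      exact hfC k k' t
    refine h1.trans ?_
    refine (Finset.single_le_sum
      (f := fun l => ∑ k, ∑ k', |P.modeCoeff j m k * P.modeCoeff j l k'| * C)
      (fun _ _ => by positivity) (Finset.mem_univ l)).trans ?_
    exact Finset.single_le_sum
      (f := fun m => ∑ l, ∑ k, ∑ k', |P.modeCoeff j m k * P.modeCoeff j l k'| * C)
      (fun _ _ => by positivity) (Finset.mem_univ m)
  · set β := P.modeMap j α with hβ
    have hd : ∀ m l, deriv (fun t => ∑ k, ∑ k', P.modeCoeff j m k * P.modeCoeff j l k' * f k k' t) t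
        = ∑ k, ∑ k', P.modeCoeff j m k * P.modeCoeff j l k' *
          ((if k = k' then ‖Complex.I * P.steadyAmp j k‖ ^ 2 / 2 else 0) -
            sig (P.freq j k) t (Complex.I * P.steadyAmp j k) *
            sig (P.freq j k') t (Complex.I * P.steadyAmp j k')) := fun m l =>
      (HasDerivAt.fun_sum fun k _ => HasDerivAt.fun_sum fun k' _ =>
        (hf' k k' t).const_mul _).deriv
    have h1 : ∑ m, ∑ l, α m * α l *
        deriv (fun t => ∑ k, ∑ k', P.modeCoeff j m k * P.modeCoeff j l k' * f k k' t) t =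
        ∑ k, ∑ k', β k * β k' *
          ((if k = k' then ‖Complex.I * P.steadyAmp j k‖ ^ 2 / 2 else 0) -
            sig (P.freq j k) t (Complex.I * P.steadyAmp j k) *
            sig (P.freq j k') t (Complex.I * P.steadyAmp j k')) := by
      simp only [hd, hβ, modeMap_apply, Finset.sum_mul_sum]
      simp only [Finset.mul_sum, Finset.sum_mul]
      rw [sum_comm_four]
      refine Finset.sum_congr rfl fun k _ => Finset.sum_congr rfl fun k' _ =>
        Finset.sum_congr rfl fun m _ => Finset.sum_congr rfl fun l _ => ?_
      ring
    have h2 : ∑ k, ∑ k', β k * β k' *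
          ((if k = k' then ‖Complex.I * P.steadyAmp j k‖ ^ 2 / 2 else 0) -
            sig (P.freq j k) t (Complex.I * P.steadyAmp j k) *
            sig (P.freq j k') t (Complex.I * P.steadyAmp j k')) =
        ∑ k, β k ^ 2 * (‖Complex.I * P.steadyAmp j k‖ ^ 2 / 2) -
          (α ⬝ᵥ vecΛ (P.s j) (P.varphi j t)) ^ 2 := by
      rw [dotProduct_vecΛ_varphi, pow_two, Finset.sum_mul_sum, ← Finset.sum_sub_distrib]
      refine Finset.sum_congr rfl fun k _ => ?_
      simp only [mul_sub, Finset.sum_sub_distrib]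
      congr 1
      · simp [pow_two]
      · exact Finset.sum_congr rfl fun k' _ => by ring
    rw [h1, h2]
    gcongr
    obtain ⟨k1, hk1⟩ : ∃ k, ‖β‖ = |β k| := by
      obtain ⟨k, hk⟩ := Finite.exists_max fun k => ‖β k‖
      exact ⟨k, le_antisymm ((pi_norm_le_iff_of_nonneg (norm_nonneg _)).2 hk) (norm_le_pi_norm β k)⟩
    have h3 : (c * ‖α‖) ^ 2 ≤ β k1 ^ 2 := by
      rw [← sq_abs (β k1), ← hk1]
      gcongr
      exact hcα α
    calc κ0 * c ^ 2 * ‖α‖ ^ 2 = (c * ‖α‖) ^ 2 * κ0 := by ring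
      _ ≤ β k1 ^ 2 * (‖Complex.I * P.steadyAmp j k1‖ ^ 2 / 2) := by
        gcongr
        exact hk0 k1
      _ ≤ _ := Finset.single_le_sum
        (f := fun k => β k ^ 2 * (‖Complex.I * P.steadyAmp j k‖ ^ 2 / 2))
        (fun _ _ => by positivity) (Finset.mem_univ k1)

end Network

/-! ### A Lyapunov form for Hurwitz companion systems. -/

/-- Stable scalar equations a_k' = τ_k a_k + a_{k+1} in series: the weight of each new stage is
taken large enough to pay for its input to the previous ones, at the price of a multiple of the next
input. -/
theorem exists_cascade_weights (τ : ℕ → ℂ) (n : ℕ) (hτ : ∀ k < n, (τ k).re < 0) :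
    ∃ κ : ℕ → ℝ, (∀ k, 0 < κ k) ∧ ∃ C : ℝ, 0 ≤ C ∧ ∀ a : ℕ → ℂ,
      ∑ k ∈ Finset.range n, κ k * ((starRingEnd ℂ) (a k) * (τ k * a k + a (k + 1))).re ≤
        -∑ k ∈ Finset.range n, ‖a k‖ ^ 2 + C * ‖a n‖ ^ 2 := by
  induction n with
  | zero => exact ⟨fun _ => 1, fun _ => one_pos, 0, le_rfl, fun a => by simp⟩
  | succ n ih =>
    obtain ⟨κ, hκ, C, hC, h⟩ := ih fun k hk => hτ k (by omega)
    set σ := -(τ n).re with hσ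
    have hσ0 : 0 < σ := neg_pos.2 (hτ n (by omega))
    -- Young's inequality keeps half of w σ ‖a n‖², which must equal (C + 1) ‖a n‖²: C for the
    -- earlier stages, 1 for the claim.
    set w := 2 * (C + 1) / σ with hw
    have hw0 : 0 < w := by positivity
    refine ⟨Function.update κ n w, fun k => ?_, w / (2 * σ), by positivity, fun a => ?_⟩
    · by_cases hk : k = n
      · subst hk; simpa using hw0
      · simpa [hk] using hκ k
    · rw [Finset.sum_range_succ, Finset.sum_range_succ, Function.update_self]
      have h1 : ∑ k ∈ Finset.range n, Function.update κ n w k *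
          ((starRingEnd ℂ) (a k) * (τ k * a k + a (k + 1))).re =
          ∑ k ∈ Finset.range n, κ k * ((starRingEnd ℂ) (a k) * (τ k * a k + a (k + 1))).re := by
        refine Finset.sum_congr rfl fun k hk => ?_
        rw [Function.update_of_ne (Finset.mem_range.1 hk).ne]
      have h2 : ((starRingEnd ℂ) (a n) * (τ n * a n + a (n + 1))).re ≤
          -σ * ‖a n‖ ^ 2 + ‖a n‖ * ‖a (n + 1)‖ := by
        have e1 : (starRingEnd ℂ) (a n) * (τ n * a n + a (n + 1)) =
            (‖a n‖ ^ 2 : ℝ) * τ n + (starRingEnd ℂ) (a n) * a (n + 1) := by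
          rw [← Complex.normSq_eq_norm_sq, ← Complex.mul_conj]
          ring
        rw [e1, Complex.add_re, Complex.re_ofReal_mul]
        have e2 := Complex.re_le_norm ((starRingEnd ℂ) (a n) * a (n + 1))
        rw [norm_mul, Complex.norm_conj] at e2
        rw [hσ]
        linarith
      have h3 : w * (-σ * ‖a n‖ ^ 2 + ‖a n‖ * ‖a (n + 1)‖) ≤
          -(C + 1) * ‖a n‖ ^ 2 + w / (2 * σ) * ‖a (n + 1)‖ ^ 2 := by
        have e : w / (2 * σ) * (σ * ‖a n‖ - ‖a (n + 1)‖) ^ 2 =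
          w * σ / 2 * ‖a n‖ ^ 2 - w * (‖a n‖ * ‖a (n + 1)‖) + w / (2 * σ) * ‖a (n + 1)‖ ^ 2 := by
          field_simp
          ring
        have e' : 0 ≤ w / (2 * σ) * (σ * ‖a n‖ - ‖a (n + 1)‖) ^ 2 := by positivity
        have e2 : w * σ / 2 = C + 1 := by
          rw [hw]
          field_simp
        rw [e, e2] at e'
        have e3 : w * σ = 2 * (C + 1) := by linarith
        nlinarith
      rw [h1]
      have h4 := mul_le_mul_of_nonneg_left h2 hw0.le
      have h5 := h a
      linarith

/-- The companion endomorphism of the monic polynomial with lower coefficients `r`. -/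
def companionEnd {n : ℕ} (r : Fin n → ℂ) : Module.End ℂ (Fin n → ℂ) :=
  LinearMap.pi fun k => if h : (k : ℕ) + 1 < n then LinearMap.proj ⟨k + 1, h⟩
    else -∑ i, r i • LinearMap.proj i

theorem companionEnd_apply_of_lt {n : ℕ} (r z : Fin n → ℂ) (k : Fin n) (h : (k : ℕ) + 1 < n) :
    companionEnd r z k = z ⟨k + 1, h⟩ := by
  simp [companionEnd, h]

theorem companionEnd_apply_of_not_lt {n : ℕ} (r z : Fin n → ℂ) (k : Fin n)
    (h : ¬ (k : ℕ) + 1 < n) : companionEnd r z k = -∑ i, r i * z i := by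
  simp [companionEnd, h]

theorem companionEnd_pow_apply_zero {n : ℕ} (hn : 0 < n) (r : Fin n → ℂ) (i : ℕ) (hi : i < n)
    (z : Fin n → ℂ) : (companionEnd r ^ i) z ⟨0, hn⟩ = z ⟨i, hi⟩ := by
  induction i generalizing z with
  | zero => rfl
  | succ i ih =>
    rw [pow_succ, Module.End.mul_apply, ih (by omega), companionEnd_apply_of_lt _ _ _ hi]

/-- Cayley–Hamilton read off at the first coordinate, which is all that the end of the cascade
requires. -/
theorem aeval_companionEnd_apply_zero {n : ℕ} (hn : 0 < n) (r z : Fin n → ℂ) :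
    Polynomial.aeval (companionEnd r)
      (Polynomial.X ^ n + ∑ i, Polynomial.C (r i) * Polynomial.X ^ (i : ℕ)) z ⟨0, hn⟩ = 0 := by
  have h1 : (companionEnd r ^ n) z ⟨0, hn⟩ = -∑ i, r i * z i := by
    have hpow : companionEnd r ^ n = companionEnd r ^ (n - 1) * companionEnd r := by
      rw [← pow_succ, Nat.sub_add_cancel hn]
    rw [hpow, Module.End.mul_apply, companionEnd_pow_apply_zero hn r (n - 1) (by omega),
      companionEnd_apply_of_not_lt _ _ _ (by simp; omega)]
  simp only [map_add, map_sum, map_mul, map_pow, Polynomial.aeval_X, Polynomial.aeval_C,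
    ← Algebra.smul_def, LinearMap.add_apply, LinearMap.sum_apply, LinearMap.smul_apply,
    Pi.add_apply, Finset.sum_apply, Pi.smul_apply, h1, smul_eq_mul]
  rw [neg_add_eq_zero]
  exact Finset.sum_congr rfl fun i _ => by rw [companionEnd_pow_apply_zero hn r i i.2]

/-- Indexing the roots by `ℕ`, with value 0 past the degree, gives meaning to the partial products
over `Finset.range k` that define the cascade. -/
theorem exists_eq_prod_range_X_sub_C {f : Polynomial ℂ} (hf : f.Monic) :
    ∃ τ : ℕ → ℂ, f = ∏ k ∈ Finset.range f.natDegree, (Polynomial.X - Polynomial.C (τ k)) := by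
  set l := f.roots.toList with hl
  have hlen : l.length = f.natDegree := by
    rw [hl, Multiset.length_toList, IsAlgClosed.card_roots_eq_natDegree]
  have h1 : f = (l.map fun a => Polynomial.X - Polynomial.C a).prod := by
    conv_lhs => rw [(IsAlgClosed.splits f).eq_prod_roots_of_monic hf]
    rw [← Multiset.prod_coe, ← Multiset.map_coe, hl, Multiset.coe_toList]
  refine ⟨fun k => l.getD k 0, ?_⟩
  rw [← hlen, Finset.prod_range]
  conv_lhs => rw [h1]
  rw [← Fin.prod_univ_fun_getElem]
  exact Finset.prod_congr rfl fun k _ => by simp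

/-- The form `Re (conj (x z) * x h)` of a complex functional `x`. -/
def hermForm {E : Type*} [NormedAddCommGroup E] [NormedSpace ℝ E] (x : E →L[ℝ] ℂ) :
    E →L[ℝ] E →L[ℝ] ℝ :=
  (Complex.reCLM.comp x).smulRight (Complex.reCLM.comp x)
    + (Complex.imCLM.comp x).smulRight (Complex.imCLM.comp x)

theorem hermForm_apply {E : Type*} [NormedAddCommGroup E] [NormedSpace ℝ E] (x : E →L[ℝ] ℂ)
    (z h : E) : hermForm x z h = ((starRingEnd ℂ) (x z) * x h).re := by
  simp [hermForm]

/-- Let y_k be the first coordinate of ∏_{i<k} (F - τ_i) z, with τ_i the roots. Then y_k' = τ_k y_k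
+ y_{k+1} and y_n = 0, whatever the multiplicities, so a weighted sum of the |y_k|² is a Lyapunov
form. -/
theorem exists_lyapunov_companion {n : ℕ} (hn : 0 < n) (r : Fin n → ℝ)
    (hr : ∀ τ : ℂ, τ ^ n + ∑ i, (r i : ℂ) * τ ^ (i : ℕ) = 0 → τ.re < 0) :
    ∃ (Q : (Fin n → ℝ) →L[ℝ] (Fin n → ℝ) →L[ℝ] ℝ) (c : ℝ), 0 < c ∧ (∀ z h, Q z h = Q h z) ∧
      (∀ z, c * ‖z‖ ^ 2 ≤ Q z z) ∧
      ∀ z h : Fin n → ℝ, (∀ (k : Fin n) (hk : (k : ℕ) + 1 < n), h k = z ⟨k + 1, hk⟩) →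
        h ⟨n - 1, by omega⟩ = -∑ i, r i * z i → Q z h ≤ -‖z‖ ^ 2 := by
  set rc : Fin n → ℂ := fun i => r i with hrc
  set F := companionEnd rc with hF
  set f : Polynomial ℂ :=
    Polynomial.X ^ n + ∑ i, Polynomial.C (rc i) * Polynomial.X ^ (i : ℕ) with hf
  have hdeg : (∑ i, Polynomial.C (rc i) * Polynomial.X ^ (i : ℕ)).degree < (n : WithBot ℕ) := by
    refine (Polynomial.degree_sum_le _ _).trans_lt ?_
    refine (Finset.sup_lt_iff (WithBot.bot_lt_coe n)).2 fun i _ => ?_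
    refine (Polynomial.degree_C_mul_X_pow_le _ _).trans_lt ?_
    exact WithBot.coe_lt_coe.2 (Nat.cast_lt.2 i.2)
  have hmonic : f.Monic := Polynomial.monic_X_pow_add hdeg
  have hnat : f.natDegree = n := Polynomial.natDegree_eq_of_degree_eq_some (by
    rw [hf, Polynomial.degree_add_eq_left_of_degree_lt, Polynomial.degree_X_pow]
    rwa [Polynomial.degree_X_pow])
  obtain ⟨τ, hτ⟩ := exists_eq_prod_range_X_sub_C hmonic
  rw [hnat] at hτ
  have hτre : ∀ k < n, (τ k).re < 0 := by
    intro k hk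
    refine hr (τ k) ?_
    have h1 : f.eval (τ k) = 0 := by
      rw [hτ, Polynomial.eval_prod]
      exact Finset.prod_eq_zero (Finset.mem_range.2 hk) (by simp)
    simpa [hf, Polynomial.eval_finsetSum] using h1
  obtain ⟨κ, hκ, C, -, hcas⟩ := exists_cascade_weights τ n hτre
  -- the cascade coordinates
  set y : ℕ → (Fin n → ℂ) →ₗ[ℂ] ℂ := fun k => LinearMap.proj ⟨0, hn⟩ ∘ₗ
    Polynomial.aeval F (∏ i ∈ Finset.range k, (Polynomial.X - Polynomial.C (τ i))) with hy
  have hy0 : ∀ z, y 0 z = z ⟨0, hn⟩ := fun z => by simp [hy]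
  have hyn : ∀ z, y n z = 0 := fun z => by
    simp only [hy, ← hτ]
    exact aeval_companionEnd_apply_zero hn rc z
  have hyF : ∀ k z, y k (F z) = τ k * y k z + y (k + 1) z := by
    intro k z
    simp only [hy, Finset.prod_range_succ, LinearMap.comp_apply, LinearMap.proj_apply]
    have : ∀ p : Polynomial ℂ, Polynomial.aeval F (p * (Polynomial.X - Polynomial.C (τ k))) z =
        Polynomial.aeval F p (F z) - τ k • Polynomial.aeval F p z := fun p => by
      simp [Module.End.mul_apply, Algebra.algebraMap_eq_smul_one]
    rw [this]
    simp
  -- The common kernel of the cascade coordinates is invariant under `F`, and the first coordinate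
  -- of Fⁱ z is z_i.
  have hyinj : ∀ z, (∀ k < n, y k z = 0) → z = 0 := by
    intro z hz
    have hz' : ∀ i : ℕ, ∀ k ≤ n, y k ((F ^ i) z) = 0 := by
      intro i
      induction i with
      | zero =>
        intro k hk
        rcases hk.lt_or_eq with hk | rfl
        · exact hz k hk
        · exact hyn _
      | succ i ih =>
        intro k hk
        rcases hk.lt_or_eq with hk | rfl
        · rw [pow_succ', Module.End.mul_apply, hyF, ih k hk.le, ih (k + 1) hk, mul_zero, add_zero]
        · exact hyn _
    ext i
    rw [← companionEnd_pow_apply_zero hn rc i i.2 z, ← hF, ← hy0 ((F ^ (i : ℕ)) z), hz' i 0 (Nat.zero_le _)]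
    rfl
  -- restriction to real vectors
  set ι : (Fin n → ℝ) →ₗ[ℝ] (Fin n → ℂ) :=
    LinearMap.pi fun k => Complex.ofRealCLM.toLinearMap ∘ₗ LinearMap.proj k with hι
  set x : ℕ → (Fin n → ℝ) →L[ℝ] ℂ := fun k =>
    LinearMap.toContinuousLinearMap ((y k).restrictScalars ℝ ∘ₗ ι) with hx
  have hxy : ∀ k z, x k z = y k (ι z) := fun k z => rfl
  set X : (Fin n → ℝ) →ₗ[ℝ] (Fin n → ℂ) := LinearMap.pi fun k => (x k).toLinearMap with hX
  have hker : LinearMap.ker X = ⊥ := by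
    rw [LinearMap.ker_eq_bot']
    intro z hz
    have h1 : ι z = 0 := hyinj _ fun k hk => congrFun hz ⟨k, hk⟩
    ext i
    have := congrFun h1 i
    simpa [hι] using this
  obtain ⟨m, hm, hmX⟩ := LinearMap.exists_pos_mul_norm_le X hker
  have hlow : ∀ z, m ^ 2 * ‖z‖ ^ 2 ≤ ∑ k ∈ Finset.range n, ‖x k z‖ ^ 2 := by
    intro z
    rw [← mul_pow]
    have : Nonempty (Fin n) := ⟨⟨0, hn⟩⟩
    obtain ⟨k, hk⟩ := Finite.exists_max fun k => ‖X z k‖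
    have h1 : ‖X z‖ ≤ ‖X z k‖ := (pi_norm_le_iff_of_nonneg (norm_nonneg _)).2 hk
    calc (m * ‖z‖) ^ 2 ≤ ‖x k z‖ ^ 2 := by
          gcongr
          exact (hmX z).trans h1
      _ ≤ _ := Finset.single_le_sum (f := fun k => ‖x k z‖ ^ 2) (fun _ _ => by positivity)
        (Finset.mem_range.2 k.2)
  obtain ⟨k0, hk0, hκmin⟩ := Finset.exists_min_image (Finset.range n) κ ⟨0, Finset.mem_range.2 hn⟩
  -- The factor (m²)⁻¹ normalises the decay rate to 1; the lower bound is then the least weight.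
  refine ⟨(m ^ 2)⁻¹ • ∑ k ∈ Finset.range n, κ k • hermForm (x k), κ k0, hκ k0, fun z h => ?_,
    fun z => ?_, fun z h hz hlast => ?_⟩
  · simp only [smul_apply, sum_apply, hermForm_apply]
    congr 1
    refine Finset.sum_congr rfl fun k _ => ?_
    congr 1
    simp
    ring
  · simp only [smul_apply, sum_apply, hermForm_apply,
      smul_eq_mul]
    rw [le_inv_mul_iff₀ (by positivity)]
    calc m ^ 2 * (κ k0 * ‖z‖ ^ 2) = κ k0 * (m ^ 2 * ‖z‖ ^ 2) := by ring
      _ ≤ κ k0 * ∑ k ∈ Finset.range n, ‖x k z‖ ^ 2 :=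
        mul_le_mul_of_nonneg_left (hlow z) (hκ k0).le
      _ ≤ _ := by
        rw [Finset.mul_sum]
        refine Finset.sum_le_sum fun k hk => ?_
        rw [mul_comm ((starRingEnd ℂ) _), Complex.mul_conj, Complex.ofReal_re,
          Complex.normSq_eq_norm_sq]
        exact mul_le_mul_of_nonneg_right (hκmin k hk) (by positivity)
  · have hFz : F (ι z) = ι h := by
      ext k
      by_cases hk : (k : ℕ) + 1 < n
      · rw [hF, companionEnd_apply_of_lt _ _ _ hk]
        simp [hι, hz k hk]
      · rw [hF, companionEnd_apply_of_not_lt _ _ _ hk]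
        have : k = ⟨n - 1, by omega⟩ := Fin.ext (by have := k.2; simp; omega)
        rw [this]
        simp [hι, hlast, hrc]
    have h1 := hcas fun k => x k z
    have h2 : ∀ k, τ k * x k z + x (k + 1) z = x k h := fun k => by
      rw [hxy, hxy, hxy, ← hFz, hyF]
    simp only [h2] at h1
    have h3 : x n z = 0 := hyn _
    rw [h3, norm_zero] at h1
    simp only [smul_apply, sum_apply, hermForm_apply,
      smul_eq_mul]
    rw [inv_mul_le_iff₀ (by positivity)]
    have := hlow z
    linarith

/-! ### Quadratic forms and the construction of strict Lyapunov functions. -/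

theorem hasFDerivAt_bilin_self {E : Type*} [NormedAddCommGroup E] [NormedSpace ℝ E]
    (B : E →L[ℝ] E →L[ℝ] ℝ) (x : E) : HasFDerivAt (fun x => B x x) (B x + B.flip x) x := by
  refine (B.hasFDerivAt.clm_apply (hasFDerivAt_id x)).congr_fderiv ?_
  ext h
  simp

theorem norm_bilin_add_flip_le {E : Type*} [NormedAddCommGroup E] [NormedSpace ℝ E]
    (B : E →L[ℝ] E →L[ℝ] ℝ) (x : E) : ‖B x + B.flip x‖ ≤ 2 * ‖B‖ * ‖x‖ := by
  have h1 := B.le_opNorm x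
  have h2 := B.flip.le_opNorm x
  rw [ContinuousLinearMap.opNorm_flip] at h2
  exact (norm_add_le _ _).trans (by linarith)

theorem abs_bilin_self_le {E : Type*} [NormedAddCommGroup E] [NormedSpace ℝ E]
    (B : E →L[ℝ] E →L[ℝ] ℝ) (x : E) : |B x x| ≤ ‖B‖ * ‖x‖ ^ 2 := by
  have := B.le_opNorm₂ x x
  rw [Real.norm_eq_abs] at this
  linarith

theorem posDefRadial_of_sq_norm {E : Type*} [NormedAddCommGroup E] {a b : ℝ}
    (ha : 0 < a) (hb : 0 ≤ b) : PosDefRadial (0 : E) fun x => a * ‖x‖ ^ 2 + b * ‖x‖ ^ 4 := by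
  refine ⟨by fun_prop, by simp, fun x hx => ?_, ?_⟩
  · have := norm_pos_iff.2 hx
    positivity
  · have h1 : Tendsto (fun x : E => a * ‖x‖ ^ 2) (Bornology.cobounded E) atTop :=
      ((tendsto_pow_atTop two_ne_zero).comp tendsto_norm_cobounded_atTop).const_mul_atTop ha
    exact tendsto_atTop_mono (fun x => by have := norm_nonneg x; simp; positivity) h1

theorem abs_dotProduct_le {ι : Type*} [Fintype ι] (a b : ι → ℝ) :
    |a ⬝ᵥ b| ≤ Fintype.card ι * (‖a‖ * ‖b‖) := by
  refine (Finset.abs_sum_le_sum_abs _ _).trans ?_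
  refine (Finset.sum_le_card_nsmul _ _ (‖a‖ * ‖b‖) fun i _ => ?_).trans (by simp)
  rw [abs_mul]
  exact mul_le_mul (norm_le_pi_norm a i) (norm_le_pi_norm b i) (abs_nonneg _) (norm_nonneg _)

theorem abs_bilin_sum_le {ι : Type*} [Fintype ι] (S : ι → ι → ℝ) {C : ℝ}
    (hS : ∀ m l, |S m l| ≤ C) (a b : ι → ℝ) :
    |∑ m, ∑ l, S m l * (a m * b l)| ≤ (Fintype.card ι) ^ 2 * C * (‖a‖ * ‖b‖) := by
  have h1 : ∀ m l, |S m l * (a m * b l)| ≤ C * (‖a‖ * ‖b‖) := fun m l => by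
    rw [abs_mul, abs_mul]
    exact mul_le_mul (hS m l) (mul_le_mul (norm_le_pi_norm a m) (norm_le_pi_norm b l)
      (abs_nonneg _) (norm_nonneg _)) (by positivity) ((abs_nonneg _).trans (hS m l))
  calc _ ≤ ∑ m, |∑ l, S m l * (a m * b l)| := Finset.abs_sum_le_sum_abs _ _
    _ ≤ ∑ m : ι, ∑ l : ι, C * (‖a‖ * ‖b‖) := Finset.sum_le_sum fun m _ =>
      (Finset.abs_sum_le_sum_abs _ _).trans (Finset.sum_le_sum fun l _ => h1 m l)
    _ = _ := by simp; ring

/-- Every monomial contains y. Those with a single factor y borrow κ/8 · A² each by Young's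
inequality; the rest is at least quadratic in y. -/
theorem exists_absorb_cross {κ K : ℝ} (hκ : 0 < κ) (hK : 0 ≤ K) : ∃ C : ℝ, 0 ≤ C ∧
    ∀ y A : ℝ, 0 ≤ y → 0 ≤ A →
      -κ * A ^ 2 + K * (y * A + y ^ 2 + y ^ 3 + A ^ 2 * y + A * y ^ 2) ≤
        -(κ / 2) * A ^ 2 + C * (y ^ 2 * (1 + A ^ 2 + y ^ 2)) := by
  refine ⟨2 * K ^ 2 / κ + 2 * K, by positivity, fun y A hy hA => ?_⟩
  have h1 : K * (y * A) ≤ κ / 8 * A ^ 2 + 2 * K ^ 2 / κ * y ^ 2 := by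
    have e : κ / 8 * A ^ 2 + 2 * K ^ 2 / κ * y ^ 2 - K * (y * A) =
        κ / 8 * (A - 4 * K / κ * y) ^ 2 := by
      field_simp
      ring
    have : 0 ≤ κ / 8 * (A - 4 * K / κ * y) ^ 2 := by positivity
    linarith
  have h2 : K * (A ^ 2 * y) ≤ κ / 8 * A ^ 2 + 2 * K ^ 2 / κ * (A ^ 2 * y ^ 2) := by
    have e : κ / 8 * A ^ 2 + 2 * K ^ 2 / κ * (A ^ 2 * y ^ 2) - K * (A ^ 2 * y) =
        κ / 8 * A ^ 2 * (1 - 4 * K / κ * y) ^ 2 := by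
      field_simp
      ring
    have : 0 ≤ κ / 8 * A ^ 2 * (1 - 4 * K / κ * y) ^ 2 := by positivity
    linarith
  have h3 : K * (A * y ^ 2) ≤ K * (1 / 2 * (y ^ 2 + A ^ 2 * y ^ 2)) := by
    refine mul_le_mul_of_nonneg_left ?_ hK
    nlinarith [mul_nonneg (sq_nonneg y) (sq_nonneg (A - 1))]
  have h4 : K * y ^ 3 ≤ K * (1 / 2 * (y ^ 2 + y ^ 4)) := by
    refine mul_le_mul_of_nonneg_left ?_ hK
    nlinarith [mul_nonneg (sq_nonneg y) (sq_nonneg (y - 1))]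
  have h5 : 0 ≤ 2 * K ^ 2 / κ * y ^ 4 := by positivity
  have h6 : 0 ≤ K * (A ^ 2 * y ^ 2) := by positivity
  have h7 : 0 ≤ K * y ^ 4 := by positivity
  have h8 : 0 ≤ κ / 4 * A ^ 2 := by positivity
  nlinarith

/-- A quadratic form `B` that decays along the subsystem, together with a bounded time-varying
quadratic form whose derivative is strictly negative up to the decay of `B + B²`, yields a strict
Lyapunov function. -/
theorem exists_strictLyapunov_of_forms {E : Type*} [NormedAddCommGroup E] [NormedSpace ℝ E]
    (F : ℝ → E → E) (B : E →L[ℝ] E →L[ℝ] ℝ)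
    (hsymm : ∀ x y, B x y = B y x) {m : ℝ} (hm : 0 < m) (hBm : ∀ x, m * ‖x‖ ^ 2 ≤ B x x)
    {ι : Type*} [Fintype ι] (f : ι → ℝ → ℝ)
    (T : ι → E →L[ℝ] E →L[ℝ] ℝ) (hf : ∀ i, ContDiff ℝ 1 (f i))
    {C : ℝ} (hC : ∀ i t, |f i t| ≤ C) (D : E → ℝ) (hD : ∀ x, 0 ≤ D x)
    (hBD : ∀ t x, B x (F t x) ≤ -D x) {κ C' : ℝ} (hκ : 0 < κ) (hC' : 0 ≤ C')
    (hTD : ∀ t x, ∑ i, (deriv (f i) t * T i x x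
      + f i t * (T i x (F t x) + T i (F t x) x)) ≤
        -κ * ‖x‖ ^ 2 + C' * (D x * (1 + ‖x‖ ^ 2))) :
    ∃ (U : ℝ → E → ℝ) (Ulow Uup : E → ℝ) (b : ℝ),
      ContDiff ℝ 1 (fun p : ℝ × E => U p.1 p.2) ∧ PosDefRadial 0 Ulow ∧ PosDefRadial 0 Uup ∧
      (∀ t x, Ulow x ≤ U t x) ∧ (∀ t x, U t x ≤ Uup x) ∧
      (∀ t x, deriv (fun τ => U τ x) t + fderiv ℝ (U t) x (F t x) ≤ -‖x‖ ^ 2) ∧ 0 < b ∧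
      ∀ t x, ‖fderiv ℝ (U t) x‖ ≤ b * (‖x‖ + ‖x‖ ^ 3) := by
  set c := ∑ i, |C| * ‖T i‖ with hc
  have hc0 : 0 ≤ c := by positivity
  -- The three summands give K ≥ C' and K m ≥ C', so that the decay of B + B² beats the remainder,
  -- and K m ≥ c + 1, so that U stays positive definite.
  set K := C' + C' / m + (c + 1) / m with hK
  have hK0 : 0 < K := by positivity
  have hK1 : C' ≤ K := by
    have : 0 ≤ C' / m + (c + 1) / m := by positivity
    linarith
  have hK2 : C' ≤ K * m := by
    have : K * m = C' * m + C' + (c + 1) := by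
      rw [hK]
      field_simp
    have : 0 ≤ C' * m := by positivity
    linarith
  have hK3 : c + 1 ≤ K * m := by
    have : K * m = C' * m + C' + (c + 1) := by
      rw [hK]
      field_simp
    have : 0 ≤ C' * m := by positivity
    linarith
  set X : ℝ → E →L[ℝ] E →L[ℝ] ℝ := fun t => ∑ i, f i t • T i with hX
  have hXapp : ∀ t x y, X t x y = ∑ i, f i t * T i x y := fun t x y => by
    simp [hX]
  have hXnorm : ∀ t, ‖X t‖ ≤ c := fun t => by
    refine ContinuousLinearMap.opNorm_le_bound₂ _ hc0 fun x y => ?_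
    rw [hXapp, hc, Finset.sum_mul, Finset.sum_mul]
    refine (norm_sum_le _ _).trans (Finset.sum_le_sum fun i _ => ?_)
    rw [norm_mul, Real.norm_eq_abs, mul_assoc, mul_assoc, ← mul_assoc ‖T i‖]
    exact mul_le_mul ((hC i t).trans (le_abs_self _)) ((T i).le_opNorm₂ x y) (norm_nonneg _)
      (abs_nonneg _)
  have hXabs : ∀ t x, |X t x x| ≤ c * ‖x‖ ^ 2 := fun t x =>
    (abs_bilin_self_le _ _).trans (by gcongr; exact hXnorm t)
  have hBpos : ∀ x, 0 ≤ B x x := fun x => le_trans (by positivity) (hBm x)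
  -- The square of B supplies the decay D ‖x‖² demanded by the cubic remainders; κ⁻¹ normalises the
  -- final rate to 1.
  set U : ℝ → E → ℝ := fun t x => κ⁻¹ * (K * (B x x + B x x ^ 2) + X t x x) with hU
  have hUf : ∀ t x, HasFDerivAt (U t) (κ⁻¹ • (K • ((1 + 2 * B x x) • (B x + B.flip x))
      + (X t x + (X t).flip x))) x := by
    intro t x
    have h1 := hasFDerivAt_bilin_self B x
    have h2 := hasFDerivAt_bilin_self (X t) x
    refine ((((h1.add (h1.pow 2)).const_mul K).add h2).const_mul κ⁻¹).congr_fderiv ?_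
    ext h
    simp
    ring
  refine ⟨U, fun x => (κ⁻¹ * (K * m - c)) * ‖x‖ ^ 2 + 0 * ‖x‖ ^ 4,
    fun x => (κ⁻¹ * (K * ‖B‖ + c + 1)) * ‖x‖ ^ 2 + (κ⁻¹ * (K * ‖B‖ ^ 2)) * ‖x‖ ^ 4,
    κ⁻¹ * (2 * K * ‖B‖ + 4 * K * ‖B‖ ^ 2 + 2 * c) + 1, ?_, ?_, ?_, ?_, ?_, ?_, by positivity, ?_⟩
  · have hXc : ContDiff ℝ 1 fun p : ℝ × E => X p.1 p.2 p.2 := by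
      simp only [hXapp]
      refine ContDiff.sum fun i _ => ((hf i).comp contDiff_fst).mul ?_
      exact ((T i).contDiff.comp contDiff_snd).clm_apply contDiff_snd
    have hBc : ContDiff ℝ 1 fun p : ℝ × E => B p.2 p.2 :=
      (B.contDiff.comp contDiff_snd).clm_apply contDiff_snd
    exact contDiff_const.mul ((contDiff_const.mul (hBc.add (hBc.pow 2))).add hXc)
  · refine posDefRadial_of_sq_norm ?_ le_rfl
    have : 0 < K * m - c := by linarith
    positivity
  · exact posDefRadial_of_sq_norm (by positivity) (by positivity)
  · intro t x
    have h1 := neg_le_of_abs_le (hXabs t x)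
    have h2 := mul_le_mul_of_nonneg_left (hBm x) hK0.le
    have h3 : 0 ≤ K * B x x ^ 2 := by positivity
    simp only [zero_mul, add_zero, mul_assoc κ⁻¹, hU]
    refine mul_le_mul_of_nonneg_left ?_ (inv_pos.2 hκ).le
    linarith
  · intro t x
    have h1 := le_of_abs_le (hXabs t x)
    have h0 := le_of_abs_le (abs_bilin_self_le B x)
    have h2 := mul_le_mul_of_nonneg_left h0 hK0.le
    have h3 : K * B x x ^ 2 ≤ K * (‖B‖ * ‖x‖ ^ 2) ^ 2 := by
      have := hBpos x
      gcongr
    have h4 : 0 ≤ ‖x‖ ^ 2 := by positivity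
    have h5 : κ⁻¹ * (K * ‖B‖ + c + 1) * ‖x‖ ^ 2 + κ⁻¹ * (K * ‖B‖ ^ 2) * ‖x‖ ^ 4 =
      κ⁻¹ * ((K * ‖B‖ + c + 1) * ‖x‖ ^ 2 + K * ‖B‖ ^ 2 * ‖x‖ ^ 4) := by ring
    simp only [h5, hU]
    refine mul_le_mul_of_nonneg_left ?_ (inv_pos.2 hκ).le
    nlinarith
  · intro t x
    have hd : HasDerivAt (fun τ => U τ x) (κ⁻¹ * ∑ i, deriv (f i) t * T i x x) t := by
      have h1 : HasDerivAt (fun τ => X τ x x) (∑ i, deriv (f i) t * T i x x) t := by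
        simp only [hXapp]
        exact HasDerivAt.fun_sum fun i _ =>
          (((hf i).differentiable one_ne_zero).differentiableAt.hasDerivAt).mul_const _
      exact (h1.const_add _).const_mul _
    rw [hd.deriv, (hUf t x).fderiv]
    set g := F t x with hg
    have hs := hTD t x
    rw [← hg, Finset.sum_add_distrib] at hs
    have e1 : (κ⁻¹ • (K • ((1 + 2 * B x x) • (B x + B.flip x)) + (X t x + (X t).flip x))) g =
        κ⁻¹ * (K * ((1 + 2 * B x x) * (2 * B x g))
          + ∑ i, f i t * (T i x g + T i g x)) := by
      simp only [smul_apply, add_apply, ContinuousLinearMap.flip_apply, smul_eq_mul, hXapp,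
        hsymm g x, mul_add, Finset.sum_add_distrib]
      ring
    rw [e1]
    -- The derivative of K (B + B²) is at most -2 K (1 + 2 B) D, and B ≥ m ‖x‖² turns this into the
    -- weight 1 + ‖x‖².
    have h1 : K * ((1 + 2 * B x x) * (2 * B x g)) ≤ -(C' * (D x * (1 + ‖x‖ ^ 2))) := by
      have h2 : K * ((1 + 2 * B x x) * (2 * B x g)) ≤
          K * ((1 + 2 * B x x) * (2 * -D x)) := by
        have := hBpos x
        have := hBD t x
        gcongr
      have h3 : C' * (1 + ‖x‖ ^ 2) ≤ K * (1 + 2 * B x x) * 2 := by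
        have h4 := mul_le_mul_of_nonneg_left (hBm x) hK0.le
        have h5 : C' * ‖x‖ ^ 2 ≤ K * m * ‖x‖ ^ 2 := by gcongr
        have h6 : 0 ≤ K * B x x := mul_nonneg hK0.le (hBpos x)
        linarith
      linarith [mul_le_mul_of_nonneg_right h3 (hD x)]
    rw [← mul_add, inv_mul_le_iff₀ hκ]
    linarith
  · intro t x
    rw [(hUf t x).fderiv, norm_smul, Real.norm_of_nonneg (inv_pos.2 hκ).le]
    have h1 : ‖K • ((1 + 2 * B x x) • (B x + B.flip x)) + (X t x + (X t).flip x)‖ ≤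
        K * ((1 + 2 * (‖B‖ * ‖x‖ ^ 2)) * (2 * ‖B‖ * ‖x‖)) + 2 * c * ‖x‖ := by
      refine (norm_add_le _ _).trans (add_le_add ?_ ?_)
      · have := hBpos x
        have h2 := le_of_abs_le (abs_bilin_self_le B x)
        have h3 := norm_bilin_add_flip_le B x
        rw [norm_smul, norm_smul, Real.norm_of_nonneg hK0.le, Real.norm_of_nonneg (by positivity)]
        gcongr
      · refine (norm_bilin_add_flip_le _ _).trans ?_
        gcongr
        exact hXnorm t
    refine (mul_le_mul_of_nonneg_left h1 (inv_pos.2 hκ).le).trans ?_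
    have h2 : K * ((1 + 2 * (‖B‖ * ‖x‖ ^ 2)) * (2 * ‖B‖ * ‖x‖)) + 2 * c * ‖x‖ ≤
        (2 * K * ‖B‖ + 4 * K * ‖B‖ ^ 2 + 2 * c) * (‖x‖ + ‖x‖ ^ 3) := by
      have a1 : 0 ≤ K * ‖B‖ * ‖x‖ ^ 3 := by positivity
      have a2 : 0 ≤ K * ‖B‖ ^ 2 * ‖x‖ := by positivity
      have a3 : 0 ≤ c * ‖x‖ ^ 3 := by positivity
      linarith
    refine (mul_le_mul_of_nonneg_left h2 (inv_pos.2 hκ).le).trans ?_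
    have h3 : 0 ≤ ‖x‖ + ‖x‖ ^ 3 := by positivity
    linarith

/-! ### The adaptive internal model in cascade coordinates. -/

theorem vecΛ_add (s : ℕ) (x y : Fin (2 * s + 1) → ℝ) : vecΛ s (x + y) = vecΛ s x + vecΛ s y := rfl

/-- The coordinates of `NuSpace s` as functionals. -/
def etaL (s : ℕ) : NuSpace s →L[ℝ] ℝ := EuclideanSpace.proj (Sum.inl ())

def zetaL (s : ℕ) (i : Fin (2 * s + 1)) : NuSpace s →L[ℝ] ℝ :=
  EuclideanSpace.proj (Sum.inr (Sum.inl i))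

def alphaL (s : ℕ) (m : Fin s) : NuSpace s →L[ℝ] ℝ :=
  EuclideanSpace.proj (Sum.inr (Sum.inr m))

/-- All coordinates of `ζ̃` but the last one. -/
def zL (s : ℕ) : NuSpace s →L[ℝ] (Fin (2 * s) → ℝ) :=
  ContinuousLinearMap.pi fun k => zetaL s k.castSucc

theorem zL_apply {s : ℕ} (ν : NuSpace s) (k : Fin (2 * s)) : zL s ν k = zetaPart ν k.castSucc := rfl

/-- The indices 2m + 1 stay below 2s, so `Λ` never reads the last coordinate. -/
theorem norm_vecΛ_zetaPart_le {s : ℕ} (ν : NuSpace s) : ‖vecΛ s (zetaPart ν)‖ ≤ ‖zL s ν‖ := by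
  refine (pi_norm_le_iff_of_nonneg (norm_nonneg _)).2 fun m => ?_
  exact norm_le_pi_norm (zL s ν) ⟨2 * (m : ℕ) + 1, by have := m.isLt; omega⟩

namespace Network

variable {N : Type*} [Fintype N] [DecidableEq N] (P : Network N)

/-- The output `η̂ + R ζ̃` of the adaptive internal model. -/
def vL (j : N) : NuSpace (P.s j) →L[ℝ] ℝ := etaL _ + ∑ i, P.R j i • zetaL _ i

theorem vL_apply (j : N) (ν : NuSpace (P.s j)) :
    P.vL j ν = etaPart ν + P.R j ⬝ᵥ zetaPart ν := by
  simp [vL, dotProduct, etaL, zetaL, etaPart, zetaPart]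

theorem etaPart_nuField (j : N) (t : ℝ) (ν : NuSpace (P.s j)) (ω : ℝ) :
    etaPart (P.nuField j t ν ω) = -etaPart ν - P.M j * ω := rfl

theorem alphaPart_nuField (j : N) (t : ℝ) (ν : NuSpace (P.s j)) (ω : ℝ) :
    alphaPart (P.nuField j t ν ω) =
      -(P.kα * (P.vL j ν + P.M j * ω)) • vecΛ (P.s j) (P.zeta j t ν) := by
  have : alphaPart (P.nuField j t ν ω) = -(P.kα * (etaPart ν + P.M j * ω
    + P.R j ⬝ᵥ zetaPart ν)) • vecΛ (P.s j) (P.zeta j t ν) := rfl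
  rw [this, vL_apply]
  congr 3
  ring

theorem zetaPart_nuField (j : N) (t : ℝ) (ν : NuSpace (P.s j)) (ω : ℝ) :
    zetaPart (P.nuField j t ν ω) =
      Matrix.mulVec (matA (P.s j) (P.alphaHat j ν)) (P.zeta j t ν)
      - Matrix.mulVec (matA (P.s j) (P.α j)) (P.zeta j t ν)
      + Matrix.mulVec (matA (P.s j) (P.α j)) (zetaPart ν)
      - (P.vL j ν + P.M j * ω) • vecG (P.s j) P.γ := by
  have : zetaPart (P.nuField j t ν ω) =
    Matrix.mulVec (matA (P.s j) (P.alphaHat j ν) - matA (P.s j) (P.α j)) (P.zeta j t ν)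
      - (etaPart ν + P.M j * ω) • vecG (P.s j) P.γ
      + Matrix.mulVec
          (matA (P.s j) (P.α j) - Matrix.vecMulVec (vecG (P.s j) P.γ) (P.R j)) (zetaPart ν) := rfl
  rw [this, vL_apply, Matrix.sub_mulVec, Matrix.sub_mulVec, Matrix.vecMulVec_mulVec]
  ext i
  simp
  ring

theorem zetaPart_nuField_castSucc (j : N) (t : ℝ) (ν : NuSpace (P.s j)) (ω : ℝ)
    (k : Fin (2 * P.s j)) : zetaPart (P.nuField j t ν ω) k.castSucc =
      zetaPart ν k.succ - (P.vL j ν + P.M j * ω) * vecG (P.s j) P.γ k.castSucc := by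
  simp [zetaPart_nuField, matA_mulVec_castSucc]

theorem zetaPart_nuField_last (j : N) (t : ℝ) (ν : NuSpace (P.s j)) (ω : ℝ) :
    zetaPart (P.nuField j t ν ω) (Fin.last _) =
      alphaPart ν ⬝ᵥ vecΛ (P.s j) (P.zeta j t ν) + P.α j ⬝ᵥ vecΛ (P.s j) (zetaPart ν)
        - P.γ * (P.vL j ν + P.M j * ω) := by
  simp only [zetaPart_nuField, Pi.sub_apply, Pi.add_apply, matA_mulVec_last, alphaHat,
    add_dotProduct, Pi.smul_apply, smul_eq_mul]
  simp [vecG]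
  ring

theorem vL_eq (j : N) (ν : NuSpace (P.s j)) :
    P.vL j ν = etaPart ν + ∑ k, P.r j k * zL _ ν k + zetaPart ν (Fin.last _) := by
  rw [vL_apply, dotProduct, Fin.sum_univ_castSucc]
  simp [R, zL_apply, add_assoc]

/-- The first coordinates of `ζ̃` follow the Hurwitz companion dynamics driven by `η̂`. -/
theorem zL_nuField (j : N) (t : ℝ) (ν : NuSpace (P.s j)) (k : Fin (2 * P.s j)) :
    zL _ (P.nuField j t ν 0) k = if h : (k : ℕ) + 1 < 2 * P.s j then zL _ ν ⟨k + 1, h⟩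
      else -∑ i, P.r j i * zL _ ν i - etaPart ν := by
  rw [zL_apply, zetaPart_nuField_castSucc]
  split_ifs with h
  · have h1 : vecG (P.s j) P.γ k.castSucc = 0 := by
      simp [vecG, h.ne, k.2.ne]
    rw [h1, mul_zero, sub_zero]
    rfl
  · have hk : (k : ℕ) + 1 = 2 * P.s j := by have := k.2; omega
    have h1 : vecG (P.s j) P.γ k.castSucc = 1 := by
      simp [vecG, hk, k.2.ne]
    have h2 : k.succ = Fin.last _ := Fin.ext (by simp [hk])
    -- The penultimate entry 1 of `G` replaces the last coordinate of ζ̃ by -Σ r_i z_i - η̂, closing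
    -- the companion system.
    rw [h1, h2, vL_eq]
    ring

theorem abs_sum_r_mul_le (j : N) (z : Fin (2 * P.s j) → ℝ) :
    |∑ k, P.r j k * z k| ≤ Fintype.card (Fin (2 * P.s j)) * (‖P.r j‖ * ‖z‖) :=
  abs_dotProduct_le (P.r j) z

/-- The output of the internal model obeys a first-order equation driven by the regression error. -/
theorem exists_vL_nuField_bound (j : N) : ∃ L : ℝ, 0 ≤ L ∧ ∀ t (ν : NuSpace (P.s j)),
    |P.vL j (P.nuField j t ν 0) + P.γ * P.vL j ν
      - alphaPart ν ⬝ᵥ vecΛ (P.s j) (P.zeta j t ν)| ≤ L * (‖zL _ ν‖ + |etaPart ν|) := by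
  set a := (Fintype.card (Fin (2 * P.s j)) : ℝ) * ‖P.r j‖ with ha
  have ha0 : 0 ≤ a := by positivity
  set b := (Fintype.card (Fin (P.s j)) : ℝ) * ‖P.α j‖ with hb
  have hb0 : 0 ≤ b := by positivity
  refine ⟨1 + a * (1 + a) + b, by positivity, fun t ν => ?_⟩
  have hz : ‖zL _ (P.nuField j t ν 0)‖ ≤ (1 + a) * (‖zL _ ν‖ + |etaPart ν|) := by
    refine (pi_norm_le_iff_of_nonneg (by positivity)).2 fun k => ?_
    have h0 := norm_nonneg (zL _ ν)
    have h0' := abs_nonneg (etaPart ν)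
    have h0'' := mul_nonneg ha0 h0
    have h0''' := mul_nonneg ha0 h0'
    rw [zL_nuField, Real.norm_eq_abs]
    split_ifs with h
    · refine (norm_le_pi_norm (zL _ ν) ⟨k + 1, h⟩).trans ?_
      linarith
    · have h1 := P.abs_sum_r_mul_le j (zL _ ν)
      rw [← mul_assoc, ← ha] at h1
      refine (abs_sub _ _).trans ?_
      rw [abs_neg]
      linarith
  have h1 := (P.abs_sum_r_mul_le j (zL _ (P.nuField j t ν 0)))
  rw [← mul_assoc, ← ha] at h1
  have h2 := abs_dotProduct_le (P.α j) (vecΛ (P.s j) (zetaPart ν))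
  rw [← mul_assoc, ← hb] at h2
  -- The derivative of the last coordinate of ζ̃ supplies both -γ v and the regression term; what is
  -- left is linear in z, its derivative and η̂.
  have h3 : P.vL j (P.nuField j t ν 0) + P.γ * P.vL j ν
      - alphaPart ν ⬝ᵥ vecΛ (P.s j) (P.zeta j t ν) = -etaPart ν
      + ∑ k, P.r j k * zL _ (P.nuField j t ν 0) k + P.α j ⬝ᵥ vecΛ (P.s j) (zetaPart ν) := by
    rw [P.vL_eq j (P.nuField j t ν 0), zetaPart_nuField_last, etaPart_nuField]
    ring
  rw [h3]
  refine (abs_add_three _ _ _).trans ?_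
  rw [abs_neg]
  have h4 := mul_le_mul_of_nonneg_left hz ha0
  have h5 := mul_le_mul_of_nonneg_left (norm_vecΛ_zetaPart_le ν) hb0
  have h6 := norm_nonneg (zL _ ν)
  have h7 := mul_nonneg hb0 (abs_nonneg (etaPart ν))
  linarith

/-- The coordinates `(v, η̂, z, α̃)` in which the subsystem is a cascade. -/
def cascadeCoord (j : N) : NuSpace (P.s j) →L[ℝ]
    ℝ × ℝ × (Fin (2 * P.s j) → ℝ) × (Fin (P.s j) → ℝ) :=
  (P.vL j).prod ((etaL _).prod ((zL _).prod (ContinuousLinearMap.pi (alphaL _))))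

/-- The last entry of `R` is 1, so v, η̂ and z determine the last coordinate of ζ̃. -/
theorem ker_cascadeCoord (j : N) : LinearMap.ker (P.cascadeCoord j).toLinearMap = ⊥ := by
  rw [LinearMap.ker_eq_bot']
  intro ν hν
  have h : (P.vL j ν, etaPart ν, zL _ ν, alphaPart ν) = 0 := hν
  simp only [Prod.mk_eq_zero] at h
  obtain ⟨h1, h2, h3, h4⟩ := h
  have h5 : zetaPart ν (Fin.last _) = 0 := by
    rw [vL_eq, h2, h3] at h1
    simpa using h1
  ext i
  rcases i with u | i | m
  · exact h2
  · refine Fin.lastCases ?_ (fun k => ?_) i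
    · exact h5
    · exact congrFun h3 k
  · exact congrFun h4 m

theorem exists_cascadeCoord_bounds (j : N) : ∃ c C : ℝ, 0 < c ∧ 0 ≤ C ∧ ∀ ν : NuSpace (P.s j),
    c * ‖ν‖ ^ 2 ≤ P.vL j ν ^ 2 + etaPart ν ^ 2 + ‖zL _ ν‖ ^ 2 + ‖alphaPart ν‖ ^ 2 ∧
    |P.vL j ν| ≤ C * ‖ν‖ ∧ |etaPart ν| ≤ C * ‖ν‖ ∧ ‖zL _ ν‖ ≤ C * ‖ν‖ ∧
      ‖alphaPart ν‖ ≤ C * ‖ν‖ := by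
  obtain ⟨c, hc, h⟩ := LinearMap.exists_pos_mul_norm_le (P.cascadeCoord j).toLinearMap
    (P.ker_cascadeCoord j)
  refine ⟨c ^ 2, ‖P.cascadeCoord j‖, by positivity, norm_nonneg _, fun ν => ?_⟩
  have h1 : c * ‖ν‖ ≤ max |P.vL j ν| (max |etaPart ν| (max ‖zL _ ν‖ ‖alphaPart ν‖)) := h ν
  have h2 : max |P.vL j ν| (max |etaPart ν| (max ‖zL _ ν‖ ‖alphaPart ν‖)) ≤
    ‖P.cascadeCoord j‖ * ‖ν‖ := (P.cascadeCoord j).le_opNorm ν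
  simp only [max_le_iff] at h2
  refine ⟨?_, h2.1, h2.2.1, h2.2.2.1, h2.2.2.2⟩
  rw [← mul_pow]
  have h3 : 0 ≤ c * ‖ν‖ := by positivity
  simp only [le_max_iff] at h1
  rw [← sq_abs (P.vL j ν), ← sq_abs (etaPart ν)]
  have := sq_nonneg |P.vL j ν|
  have := sq_nonneg |etaPart ν|
  have := sq_nonneg ‖zL _ ν‖
  have := sq_nonneg ‖alphaPart ν‖
  rcases h1 with h1 | h1 | h1 | h1
  all_goals
    have := pow_le_pow_left₀ h3 h1 2
    linarith

/-- The squared size of the part of `ν` that decays without excitation. -/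
def cascadeSq (j : N) (ν : NuSpace (P.s j)) : ℝ := P.vL j ν ^ 2 + ‖zL _ ν‖ ^ 2 + etaPart ν ^ 2

/-- By Young's inequality v e costs γ/4 · v² and g (Z² + η²), and the input η̂ to the companion
costs half of k₂ Z² and k₂ q²/2 · η². The weights leave γ/4, 1 and 1 on the three squares. -/
theorem cascade_decay {γ L q v Z η e Qz g k₂ k₃ : ℝ} (hγ : 0 < γ)
    (hv' : |e| ≤ L * (Z + |η|)) (h1 : Qz ≤ -Z ^ 2 + |η| * (q * Z)) (hg : g = L ^ 2 / (2 * γ))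
    (hk2 : k₂ = 2 * (g + 1)) (hk3 : k₃ = k₂ * q ^ 2 / 2 + g + 1) :
    1 / 2 * (v * (-γ * v + e)) + k₂ * Qz - k₃ * η ^ 2 ≤
      -(min (γ / 4) 1 * (v ^ 2 + Z ^ 2 + η ^ 2)) := by
  have hg0 : 0 ≤ g := by rw [hg]; positivity
  have hk2pos : 0 < k₂ := by rw [hk2]; positivity
  have h2 : 1 / 2 * (v * e) ≤ γ / 4 * v ^ 2 + g * (Z ^ 2 + η ^ 2) := by
    have h3 : v * e ≤ |v| * (L * (Z + |η|)) := by
      refine (le_abs_self _).trans ?_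
      rw [abs_mul]
      gcongr
    have h4 : 1 / 2 * (|v| * (L * (Z + |η|))) ≤
        γ / 4 * |v| ^ 2 + L ^ 2 / (4 * γ) * (Z + |η|) ^ 2 := by
      have e2 : γ / 4 * |v| ^ 2 + L ^ 2 / (4 * γ) * (Z + |η|) ^ 2
        - 1 / 2 * (|v| * (L * (Z + |η|))) = γ / 4 * (|v| - L / γ * (Z + |η|)) ^ 2 := by
        field_simp
        ring
      have : 0 ≤ γ / 4 * (|v| - L / γ * (Z + |η|)) ^ 2 := by positivity
      linarith
    have h5 : L ^ 2 / (4 * γ) * (Z + |η|) ^ 2 ≤ g * (Z ^ 2 + |η| ^ 2) := by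
      have e2 : L ^ 2 / (4 * γ) = g / 2 := by
        rw [hg]
        field_simp
        ring
      rw [e2]
      nlinarith [mul_nonneg hg0 (sq_nonneg (Z - |η|))]
    rw [sq_abs] at h4 h5
    linarith
  have h3 : k₂ * (|η| * (q * Z)) ≤ k₂ / 2 * Z ^ 2 + k₂ * q ^ 2 / 2 * η ^ 2 := by
    rw [← sq_abs η]
    nlinarith [mul_nonneg hk2pos.le (sq_nonneg (Z - q * |η|))]
  have h4 := mul_le_mul_of_nonneg_left h1 hk2pos.le
  have h5 : min (γ / 4) 1 * (v ^ 2 + Z ^ 2 + η ^ 2) ≤ γ / 4 * v ^ 2 + Z ^ 2 + η ^ 2 := by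
    have m1 := mul_le_mul_of_nonneg_right (min_le_left (γ / 4) 1) (sq_nonneg v)
    have m2 := mul_le_mul_of_nonneg_right (min_le_right (γ / 4) 1) (sq_nonneg Z)
    have m3 := mul_le_mul_of_nonneg_right (min_le_right (γ / 4) 1) (sq_nonneg η)
    linarith
  have h8 : k₂ * -Z ^ 2 = -(k₂ / 2 * Z ^ 2) - (g + 1) * Z ^ 2 := by rw [hk2]; ring
  have h9 : k₃ * η ^ 2 = k₂ * q ^ 2 / 2 * η ^ 2 + (g + 1) * η ^ 2 := by rw [hk3]; ring
  linarith

/-- A quadratic form that decays along the subsystem, not strictly. -/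
theorem exists_weak_form (j : N) :
    ∃ (B : NuSpace (P.s j) →L[ℝ] NuSpace (P.s j) →L[ℝ] ℝ) (m c : ℝ), (∀ x y, B x y = B y x) ∧
      0 < m ∧ (∀ x, m * ‖x‖ ^ 2 ≤ B x x) ∧ 0 < c ∧
      ∀ t x, B x (P.nuField j t x 0) ≤ -(c * P.cascadeSq j x) := by
  have hn : 0 < 2 * P.s j := by have := P.s_pos j; omega
  obtain ⟨Q, cQ, hcQ, hQs, hQp, hQ⟩ := exists_lyapunov_companion hn (P.r j) (P.r_hurwitz j)
  obtain ⟨L, hL, hLv⟩ := P.exists_vL_nuField_bound j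
  obtain ⟨c, C, hc, -, hcoord⟩ := P.exists_cascadeCoord_bounds j
  have hγ := P.γ_pos
  have hk := P.kα_pos
  set g := L ^ 2 / (2 * P.γ) with hg
  have hg0 : 0 ≤ g := by positivity
  set k2 := 2 * (g + 1) with hk2
  set k3 := k2 * ‖Q‖ ^ 2 / 2 + g + 1 with hk3
  have hk2pos : 0 < k2 := by positivity
  have hk3pos : 0 < k3 := by positivity
  -- The weight 1/(2 kα) is the one for which the adaptation law cancels the regression term in v
  -- v'/2.
  set B : NuSpace (P.s j) →L[ℝ] NuSpace (P.s j) →L[ℝ] ℝ :=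
    (1 / 2 : ℝ) • (P.vL j).smulRight (P.vL j)
    + (1 / (2 * P.kα)) • ∑ m, (alphaL _ m).smulRight (alphaL (P.s j) m)
    + k2 • Q.bilinearComp (zL _) (zL _) + k3 • (etaL _).smulRight (etaL (P.s j)) with hB
  have hBapp : ∀ x y, B x y = 1 / 2 * (P.vL j x * P.vL j y)
      + 1 / (2 * P.kα) * (alphaPart x ⬝ᵥ alphaPart y) + k2 * Q (zL _ x) (zL _ y)
      + k3 * (etaPart x * etaPart y) := fun x y => by
    simp [hB, dotProduct, alphaL, etaL, alphaPart, etaPart]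
  set w := min (min (1 / 2) (1 / (2 * P.kα))) (min (k2 * cQ) k3) with hw
  have hw0 : 0 < w := by positivity
  have hw1 : w ≤ 1 / 2 := (min_le_left _ _).trans (min_le_left _ _)
  have hw2 : w ≤ 1 / (2 * P.kα) := (min_le_left _ _).trans (min_le_right _ _)
  have hw3 : w ≤ k2 * cQ := (min_le_right _ _).trans (min_le_left _ _)
  have hw4 : w ≤ k3 := (min_le_right _ _).trans (min_le_right _ _)
  refine ⟨B, w * c, min (P.γ / 4) 1, fun x y => ?_, by positivity, fun x => ?_, by positivity,
    fun t x => ?_⟩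
  · rw [hBapp, hBapp, hQs, dotProduct_comm]
    ring
  · rw [hBapp]
    have h1 := mul_le_mul_of_nonneg_left (hcoord x).1 hw0.le
    have h2 : ‖alphaPart x‖ ^ 2 ≤ alphaPart x ⬝ᵥ alphaPart x := by
      have : Nonempty (Fin (P.s j)) := ⟨⟨0, P.s_pos j⟩⟩
      obtain ⟨k, hk⟩ := Finite.exists_max fun k => ‖alphaPart x k‖
      have h1 : ‖alphaPart x‖ ≤ ‖alphaPart x k‖ := (pi_norm_le_iff_of_nonneg (norm_nonneg _)).2 hk
      calc ‖alphaPart x‖ ^ 2 ≤ ‖alphaPart x k‖ ^ 2 := by gcongr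
        _ = alphaPart x k * alphaPart x k := by rw [Real.norm_eq_abs, sq_abs, pow_two]
        _ ≤ _ := Finset.single_le_sum (f := fun k => alphaPart x k * alphaPart x k)
          (fun _ _ => mul_self_nonneg _) (Finset.mem_univ k)
    have h3 : w * P.vL j x ^ 2 ≤ 1 / 2 * (P.vL j x * P.vL j x) := by
      rw [pow_two]
      exact mul_le_mul_of_nonneg_right hw1 (mul_self_nonneg _)
    have h4 : w * ‖alphaPart x‖ ^ 2 ≤ 1 / (2 * P.kα) * (alphaPart x ⬝ᵥ alphaPart x) := by
      gcongr
    have h5 : w * ‖zL _ x‖ ^ 2 ≤ k2 * Q (zL _ x) (zL _ x) := by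
      calc w * ‖zL _ x‖ ^ 2 ≤ k2 * cQ * ‖zL _ x‖ ^ 2 := by gcongr
        _ = k2 * (cQ * ‖zL _ x‖ ^ 2) := by ring
        _ ≤ _ := by gcongr; exact hQp _
    have h6 : w * etaPart x ^ 2 ≤ k3 * (etaPart x * etaPart x) := by
      rw [pow_two]
      exact mul_le_mul_of_nonneg_right hw4 (mul_self_nonneg _)
    linarith
  · rw [hBapp, alphaPart_nuField, etaPart_nuField, cascadeSq]
    set v := P.vL j x with hv
    set η := etaPart x with hη
    set Z := ‖zL _ x‖ with hZ
    have hZ0 : 0 ≤ Z := norm_nonneg _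
    have hv' := hLv t x
    set e := P.vL j (P.nuField j t x 0) + P.γ * P.vL j x
      - alphaPart x ⬝ᵥ vecΛ (P.s j) (P.zeta j t x) with he
    have e1 : P.vL j (P.nuField j t x 0) =
      -P.γ * v + alphaPart x ⬝ᵥ vecΛ (P.s j) (P.zeta j t x) + e := by rw [he]; ring
    have h1 : Q (zL _ x) (zL _ (P.nuField j t x 0)) ≤ -Z ^ 2 + |η| * (‖Q‖ * Z) := by
      -- Adding η̂ times the last unit vector restores the exact companion field, for which `Q`
      -- decays; the correction is a cross term.
      set u : Fin (2 * P.s j) → ℝ := Pi.single ⟨2 * P.s j - 1, by omega⟩ 1 with hu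
      have hu1 : ‖u‖ ≤ 1 := by
        rw [hu, Pi.norm_single]
        simp
      have h2 := hQ (zL _ x) (zL _ (P.nuField j t x 0) + η • u) (fun k hk => by
        have hne : k ≠ ⟨2 * P.s j - 1, by omega⟩ := fun h => by
          rw [h] at hk
          simp at hk
          omega
        simp [zL_nuField, hk, hu, hne]) (by
        have : ¬ (2 * P.s j - 1 + 1 < 2 * P.s j) := by omega
        simp [zL_nuField, hu, this, hη])
      rw [map_add, map_smul, smul_eq_mul] at h2
      have h3 : |Q (zL _ x) u| ≤ ‖Q‖ * Z := by
        refine (Q.le_opNorm₂ (zL _ x) u).trans ?_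
        exact mul_le_of_le_one_right (by positivity) hu1
      have h4 : -(η * Q (zL _ x) u) ≤ |η| * (‖Q‖ * Z) := by
        refine (neg_le_abs _).trans ?_
        rw [abs_mul]
        gcongr
      linarith
    -- The cancellation that leaves no sign condition on α̃.
    have h6 : 1 / (2 * P.kα) * (alphaPart x ⬝ᵥ (-(P.kα * (v + P.M j * 0)) •
        vecΛ (P.s j) (P.zeta j t x))) =
        -(1 / 2 * (v * (alphaPart x ⬝ᵥ vecΛ (P.s j) (P.zeta j t x)))) := by
      rw [dotProduct_smul, smul_eq_mul]
      field_simp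
      ring
    rw [e1, h6]
    have h2 := cascade_decay (v := v) hγ hv' h1 hg hk2 hk3
    have h3 : 1 / 2 * (v * (-P.γ * v + alphaPart x ⬝ᵥ vecΛ (P.s j) (P.zeta j t x) + e)) =
      1 / 2 * (v * (-P.γ * v + e)) +
        1 / 2 * (v * (alphaPart x ⬝ᵥ vecΛ (P.s j) (P.zeta j t x))) := by ring
    have h4 : k3 * (η * (-η - P.M j * 0)) = -(k3 * η ^ 2) := by ring
    rw [h3, h4]
    linarith

end Network

/-! ### The strict Lyapunov function of the subsystem. -/

/-- The left side is the derivative of -2 v (a·w) - aᵀ S a, with w = Λ(φ), l = Λ(ζ̃), v' = -γ v +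
a·(w + l) + e and a' = -k v (w + l). Apart from -κ ‖a‖², each remaining term contains one of v, e,
l, all controlled by y. -/
theorem exists_cross_terms_bound (ι : Type*) [Fintype ι] {W C L γ k : ℝ} (hW : 0 ≤ W) (hC : 0 ≤ C)
    (hL : 0 ≤ L) (hγ : 0 ≤ γ) (hk : 0 ≤ k) (κ : ℝ) : ∃ K : ℝ, 0 ≤ K ∧
    ∀ (S S' : ι → ι → ℝ) (a w w' l : ι → ℝ) (v e y : ℝ), (∀ m n, |S m n| ≤ C) → ‖w‖ ≤ W →
      ‖w'‖ ≤ W → ‖l‖ ≤ y → |v| ≤ y → |e| ≤ L * y →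
      κ * ‖a‖ ^ 2 - (a ⬝ᵥ w) ^ 2 ≤ ∑ m, ∑ n, a m * a n * S' m n →
      -2 * v * (a ⬝ᵥ w') + 2 * k * v ^ 2 * ((w + l) ⬝ᵥ w)
        - 2 * (-γ * v + a ⬝ᵥ (w + l) + e) * (a ⬝ᵥ w) - ∑ m, ∑ n, a m * a n * S' m n
        + k * v * (∑ m, ∑ n, S m n * (a m * (w + l) n) + ∑ m, ∑ n, S m n * ((w + l) m * a n)) ≤
      -κ * ‖a‖ ^ 2 + K * (y * ‖a‖ + y ^ 2 + y ^ 3 + ‖a‖ ^ 2 * y + ‖a‖ * y ^ 2) := by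
  set σ : ℝ := (Fintype.card ι : ℝ) with hσ
  have hσ0 : 0 ≤ σ := by positivity
  set k1 := 2 * (σ * W) + 2 * (γ * (σ * W)) + 2 * (L * (σ * W)) + 2 * (k * (σ ^ 2 * C * W)) with hk1
  set k2 := 2 * (k * (σ * (W * W))) with hk2
  set k3 := 2 * (k * (σ * W)) with hk3
  set k4 := 2 * (σ ^ 2 * W) with hk4
  set k5 := 2 * (k * (σ ^ 2 * C)) with hk5
  have h1 : 0 ≤ k1 := by positivity
  have h2 : 0 ≤ k2 := by positivity
  have h3 : 0 ≤ k3 := by positivity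
  have h4 : 0 ≤ k4 := by positivity
  have h5 : 0 ≤ k5 := by positivity
  refine ⟨k1 + k2 + k3 + k4 + k5, by positivity, ?_⟩
  intro S S' a w w' l v e y hS hw hw' hl hv he hSS
  have hy : 0 ≤ y := (abs_nonneg v).trans hv
  set A := ‖a‖ with hA
  have hA0 : 0 ≤ A := norm_nonneg _
  have hwl : ‖w + l‖ ≤ W + y := (norm_add_le _ _).trans (add_le_add hw hl)
  have b1 : |a ⬝ᵥ w'| ≤ σ * (A * W) := (abs_dotProduct_le _ _).trans (by gcongr)
  have b2 : |a ⬝ᵥ w| ≤ σ * (A * W) := (abs_dotProduct_le _ _).trans (by gcongr)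
  have b3 : |a ⬝ᵥ l| ≤ σ * (A * y) := (abs_dotProduct_le _ _).trans (by gcongr)
  have b4 : |(w + l) ⬝ᵥ w| ≤ σ * ((W + y) * W) := (abs_dotProduct_le _ _).trans (by gcongr)
  have b5 : |∑ m, ∑ n, S m n * (a m * (w + l) n)| ≤ σ ^ 2 * C * (A * (W + y)) :=
    (abs_bilin_sum_le S hS _ _).trans (by gcongr)
  have b6 : |∑ m, ∑ n, S m n * ((w + l) m * a n)| ≤ σ ^ 2 * C * ((W + y) * A) :=
    (abs_bilin_sum_le S hS _ _).trans (by gcongr)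
  generalize ∑ m, ∑ n, S m n * (a m * (w + l) n) = s5 at b5 ⊢
  generalize ∑ m, ∑ n, S m n * ((w + l) m * a n) = s6 at b6 ⊢
  generalize ∑ m, ∑ n, a m * a n * S' m n = s7 at hSS ⊢
  rw [dotProduct_add a]
  generalize (w + l) ⬝ᵥ w = p4 at b4 ⊢
  generalize a ⬝ᵥ l = p3 at b3 ⊢
  generalize a ⬝ᵥ w = p2 at b2 hSS ⊢
  generalize a ⬝ᵥ w' = p1 at b1 ⊢
  have mulle : ∀ {p q P Q : ℝ}, |p| ≤ P → |q| ≤ Q → |p * q| ≤ P * Q := fun {p q P Q} hp hq => by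
    rw [abs_mul]
    exact mul_le_mul hp hq (abs_nonneg _) ((abs_nonneg _).trans hp)
  have c1 := neg_le_of_abs_le (mulle hv b1)
  have c2 : v ^ 2 * p4 ≤ y ^ 2 * (σ * ((W + y) * W)) := by
    refine le_of_abs_le (mulle ?_ b4)
    rw [abs_pow]
    gcongr
  have c3 := le_of_abs_le (mulle hv b2)
  have c4 := neg_le_of_abs_le (mulle b3 b2)
  have c5 := neg_le_of_abs_le (mulle he b2)
  have c6 := le_of_abs_le (mulle hv b5)
  have c7 := le_of_abs_le (mulle hv b6)
  have d2 := mul_le_mul_of_nonneg_left c2 hk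
  have d3 := mul_le_mul_of_nonneg_left c3 hγ
  have d6 := mul_le_mul_of_nonneg_left c6 hk
  have d7 := mul_le_mul_of_nonneg_left c7 hk
  have key : -2 * v * p1 + 2 * k * v ^ 2 * p4 - 2 * (-γ * v + (p2 + p3) + e) * p2 - s7
      + k * v * (s5 + s6) ≤
      -κ * A ^ 2 + (k1 * (y * A) + k2 * y ^ 2 + k3 * y ^ 3 + k4 * (A ^ 2 * y)
        + k5 * (A * y ^ 2)) := by
    -- The square (a·w)² enters with -2 from v' and +1 from the excitation bound; the net -1 is
    -- dropped.
    have : 0 ≤ p2 ^ 2 := sq_nonneg _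
    rw [hk1, hk2, hk3, hk4, hk5]
    linarith
  refine key.trans ?_
  have f1 : 0 ≤ y * A := by positivity
  have f2 : 0 ≤ y ^ 2 := by positivity
  have f3 : 0 ≤ y ^ 3 := by positivity
  have f4 : 0 ≤ A ^ 2 * y := by positivity
  have f5 : 0 ≤ A * y ^ 2 := by positivity
  have g1 : k1 * (y * A) ≤ (k1 + k2 + k3 + k4 + k5) * (y * A) := by gcongr; linarith
  have g2 : k2 * y ^ 2 ≤ (k1 + k2 + k3 + k4 + k5) * y ^ 2 := by gcongr; linarith
  have g3 : k3 * y ^ 3 ≤ (k1 + k2 + k3 + k4 + k5) * y ^ 3 := by gcongr; linarith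
  have g4 : k4 * (A ^ 2 * y) ≤ (k1 + k2 + k3 + k4 + k5) * (A ^ 2 * y) := by gcongr; linarith
  have g5 : k5 * (A * y ^ 2) ≤ (k1 + k2 + k3 + k4 + k5) * (A * y ^ 2) := by gcongr; linarith
  linarith

/-- Here y² ≤ 3 q, with q the sum of the three squares, and 10 = 1 + 9 comes from A² ≤ C² n² and y²
≤ 9 C² n². Passing from A² to the full norm n² costs another κ/2 · q. -/
theorem absorb_arith {κ c C₁ C b A y n v Z η : ℝ} (hκ : 0 ≤ κ) (hC₁ : 0 ≤ C₁) (hb : 0 < b)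
    (hZ : 0 ≤ Z) (hy : |v| + Z + |η| ≤ y) (hy' : y ≤ |v| + Z + |η|) (hA : 0 ≤ A)
    (hn : c * n ^ 2 ≤ v ^ 2 + η ^ 2 + Z ^ 2 + A ^ 2) (hvn : |v| ≤ C * n) (hηn : |η| ≤ C * n)
    (hZn : Z ≤ C * n) (hAn : A ≤ C * n) :
    -(κ / 2) * A ^ 2 + C₁ * (y ^ 2 * (1 + A ^ 2 + y ^ 2)) ≤
      -(κ / 2 * c) * n ^ 2 + (3 * C₁ * (1 + 10 * C ^ 2) + κ / 2) / b
          * (b * (v ^ 2 + Z ^ 2 + η ^ 2) * (1 + n ^ 2)) := by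
  obtain rfl : |v| + Z + |η| = y := le_antisymm hy hy'
  have n1 := abs_nonneg v
  have n3 := abs_nonneg η
  set q := v ^ 2 + Z ^ 2 + η ^ 2 with hq
  have hq0 : 0 ≤ q := by positivity
  have h2 : (|v| + Z + |η|) ^ 2 ≤ 3 * q := by
    rw [hq, ← sq_abs v, ← sq_abs η]
    nlinarith [sq_nonneg (|v| - Z), sq_nonneg (|v| - |η|), sq_nonneg (Z - |η|)]
  have p1 : A ^ 2 ≤ (C * n) ^ 2 := by gcongr
  have p2 : (|v| + Z + |η|) ^ 2 ≤ (3 * (C * n)) ^ 2 := by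
    gcongr
    linarith
  generalize |v| + Z + |η| = y at *
  have h4 : y ^ 2 * (1 + A ^ 2 + y ^ 2) ≤ 3 * q * ((1 + 10 * C ^ 2) * (1 + n ^ 2)) := by
    refine mul_le_mul h2 ?_ (by positivity) (by positivity)
    have a1 : 0 ≤ C ^ 2 := by positivity
    have a2 : 0 ≤ n ^ 2 := by positivity
    linarith
  have h5 := mul_le_mul_of_nonneg_left h4 hC₁
  have h6 : κ / 2 * (c * n ^ 2) ≤ κ / 2 * (q + A ^ 2) := by
    refine mul_le_mul_of_nonneg_left ?_ (by positivity)
    linarith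
  have h7 : 0 ≤ κ / 2 * (q * n ^ 2) := by positivity
  have h8 : (3 * C₁ * (1 + 10 * C ^ 2) + κ / 2) / b * (b * q * (1 + n ^ 2)) =
      (3 * C₁ * (1 + 10 * C ^ 2) + κ / 2) * (q * (1 + n ^ 2)) := by
    field_simp
  rw [h8]
  linarith

namespace Network

variable {N : Type*} [Fintype N] [DecidableEq N] (P : Network N)

theorem vecΛ_zeta (j : N) (t : ℝ) (ν : NuSpace (P.s j)) : vecΛ (P.s j) (P.zeta j t ν) =
    vecΛ (P.s j) (P.varphi j t) + vecΛ (P.s j) (zetaPart ν) := by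
  rw [zeta, vecΛ_add, add_comm]

theorem exists_regressor_bound (j : N) : ∃ W : ℝ, 0 ≤ W ∧
    ∀ t, ‖vecΛ (P.s j) (P.varphi j t)‖ ≤ W ∧
      ‖fun m => deriv (fun τ => vecΛ (P.s j) (P.varphi j τ) m) t‖ ≤ W := by
  obtain ⟨W, hW⟩ := P.exists_varphi_bound j
  have hW0 : 0 ≤ W := (abs_nonneg _).trans (hW 0 0)
  refine ⟨W, hW0, fun t => ⟨(pi_norm_le_iff_of_nonneg hW0).2 fun m => hW t _,
    (pi_norm_le_iff_of_nonneg hW0).2 fun m => ?_⟩⟩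
  have h := (P.hasDerivAt_varphi j ⟨2 * (m : ℕ) + 1, by have := m.2; omega⟩ t).deriv
  have h' : deriv (fun τ => vecΛ (P.s j) (P.varphi j τ) m) t =
    P.varphi j t (Fin.succ ⟨2 * (m : ℕ) + 1, by have := m.2; omega⟩) := h
  rw [h']
  exact hW t _

/-- The subsystem with zero input has a strict Lyapunov function of at most quartic growth. -/
theorem exists_isSubLyapunov (j : N) : ∃ U Ulow Uup b, P.IsSubLyapunov j U Ulow Uup b := by
  obtain ⟨B, m, cB, hBs, hm, hBm, hcB, hBD⟩ := P.exists_weak_form j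
  obtain ⟨S, CS, κ, hκ, hSc, hSb, hSe⟩ := P.exists_excitation j
  obtain ⟨W, hW, hWb⟩ := P.exists_regressor_bound j
  obtain ⟨L, hL, hLv⟩ := P.exists_vL_nuField_bound j
  obtain ⟨c, C, hc, hC, hcoord⟩ := P.exists_cascadeCoord_bounds j
  have hCS : 0 ≤ CS := (abs_nonneg _).trans (hSb ⟨0, P.s_pos j⟩ ⟨0, P.s_pos j⟩ 0)
  obtain ⟨K, hK, hcross⟩ := exists_cross_terms_bound (Fin (P.s j)) hW hCS hL P.γ_pos.le
    P.kα_pos.le κ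
  obtain ⟨C1, hC1, habs⟩ := exists_absorb_cross hκ hK
  -- Together these encode -2 v (α̃·w) - α̃ᵀ S α̃ as scalar functions of time multiplying constant
  -- bilinear forms: the left summand for the cross term, the right one for `S`.
  set f : Fin (P.s j) ⊕ (Fin (P.s j) × Fin (P.s j)) → ℝ → ℝ :=
    Sum.elim (fun m t => vecΛ (P.s j) (P.varphi j t) m) (fun p => S p.1 p.2) with hf
  set T : Fin (P.s j) ⊕ (Fin (P.s j) × Fin (P.s j)) →
      NuSpace (P.s j) →L[ℝ] NuSpace (P.s j) →L[ℝ] ℝ :=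
    Sum.elim (fun m => -((P.vL j).smulRight (alphaL _ m) + (alphaL _ m).smulRight (P.vL j)))
      (fun p => -(alphaL _ p.1).smulRight (alphaL _ p.2)) with hT
  have hmain : ∀ t x, ∑ i, (deriv (f i) t * T i x x
      + f i t * (T i x (P.nuField j t x 0) + T i (P.nuField j t x 0) x)) ≤
        -(κ / 2 * c) * ‖x‖ ^ 2 + (3 * C1 * (1 + 10 * C ^ 2) + κ / 2) / cB
          * (cB * P.cascadeSq j x * (1 + ‖x‖ ^ 2)) := by
    intro t x
    set g := P.nuField j t x 0 with hg
    set a := alphaPart x with ha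
    set w := vecΛ (P.s j) (P.varphi j t) with hw
    set w' : Fin (P.s j) → ℝ := fun m => deriv (fun τ => vecΛ (P.s j) (P.varphi j τ) m) t with hw'
    set l := vecΛ (P.s j) (zetaPart x) with hl
    set v := P.vL j x with hv
    set y := |v| + ‖zL _ x‖ + |etaPart x| with hy
    set e := P.vL j g + P.γ * v - a ⬝ᵥ vecΛ (P.s j) (P.zeta j t x) with he
    have hαg : ∀ m, alphaL _ m g = -(P.kα * v) * (w + l) m := fun m => by
      have := congrFun (P.alphaPart_nuField j t x 0) m
      rw [mul_zero, add_zero, vecΛ_zeta] at this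
      exact this
    have hvg : P.vL j g = -P.γ * v + a ⬝ᵥ (w + l) + e := by
      rw [he, vecΛ_zeta]
      ring
    have hsum : ∑ i, (deriv (f i) t * T i x x + f i t * (T i x g + T i g x)) =
        -2 * v * (a ⬝ᵥ w') + 2 * P.kα * v ^ 2 * ((w + l) ⬝ᵥ w)
        - 2 * (-P.γ * v + a ⬝ᵥ (w + l) + e) * (a ⬝ᵥ w)
        - ∑ m, ∑ n, a m * a n * deriv (S m n) t
        + P.kα * v * (∑ m, ∑ n, S m n t * (a m * (w + l) n)
          + ∑ m, ∑ n, S m n t * ((w + l) m * a n)) := by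
      rw [Fintype.sum_sum_type, Fintype.sum_prod_type, ← hvg]
      have s1 : ∀ m, deriv (f (Sum.inl m)) t * T (Sum.inl m) x x
          + f (Sum.inl m) t * (T (Sum.inl m) x g + T (Sum.inl m) g x) =
          -2 * v * (a m * w' m) + 2 * P.kα * v ^ 2 * ((w + l) m * w m)
            - 2 * P.vL j g * (a m * w m) := fun m => by
        have e1 : T (Sum.inl m) x x = -2 * (v * a m) := by
          simp [hT, ← hv]
          have : alphaL _ m x = a m := rfl
          rw [this]
          ring
        have e2 : T (Sum.inl m) x g + T (Sum.inl m) g x =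
            -2 * (v * alphaL _ m g + P.vL j g * a m) := by
          simp [hT, ← hv]
          have : alphaL _ m x = a m := rfl
          rw [this]
          ring
        have e3 : deriv (f (Sum.inl m)) t = w' m := rfl
        have e4 : f (Sum.inl m) t = w m := rfl
        rw [e1, e2, e3, e4, hαg]
        ring
      have s2 : ∀ m n, deriv (f (Sum.inr (m, n))) t * T (Sum.inr (m, n)) x x
          + f (Sum.inr (m, n)) t * (T (Sum.inr (m, n)) x g + T (Sum.inr (m, n)) g x) =
          -(a m * a n * deriv (S m n) t) + P.kα * v * (S m n t * (a m * (w + l) n)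
            + S m n t * ((w + l) m * a n)) := fun m n => by
        have e1 : T (Sum.inr (m, n)) x x = -(a m * a n) := by
          simp [hT]
          rfl
        have e2 : T (Sum.inr (m, n)) x g + T (Sum.inr (m, n)) g x =
            -(a m * alphaL _ n g + alphaL _ m g * a n) := by
          have h1 : alphaL _ m x = a m := rfl
          have h2 : alphaL _ n x = a n := rfl
          simp [hT, h1, h2]
          ring
        have e3 : f (Sum.inr (m, n)) = S m n := rfl
        rw [e1, e2, e3, hαg, hαg]
        ring
      simp only [s1, s2, Finset.sum_add_distrib, Finset.sum_sub_distrib, ← Finset.mul_sum,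
        Finset.sum_neg_distrib, dotProduct]
      ring
    have hx := hcoord x
    have n1 := abs_nonneg v
    have n2 := norm_nonneg (zL _ x)
    have n3 := abs_nonneg (etaPart x)
    have hy0 : 0 ≤ y := by positivity
    have hA0 := norm_nonneg a
    have h1 := hcross (fun m n => S m n t) (fun m n => deriv (S m n) t) a w w' l v e y
      (fun m n => hSb m n t) (hWb t).1 (hWb t).2
      ((norm_vecΛ_zetaPart_le x).trans (by linarith)) (by linarith)
      ((hLv t x).trans (mul_le_mul_of_nonneg_left (by linarith) hL)) (hSe t a)
    rw [hsum]
    refine h1.trans ((habs y ‖a‖ hy0 hA0).trans ?_)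
    set q := P.cascadeSq j x with hq
    have hq' : q = v ^ 2 + ‖zL _ x‖ ^ 2 + etaPart x ^ 2 := rfl
    rw [hq']
    exact absorb_arith hκ.le hC1 hcB n2 hy.symm.le hy.le hA0 hx.1 hx.2.1 hx.2.2.1 hx.2.2.2.1 hx.2.2.2.2
  obtain ⟨U, Ulow, Uup, b, h1, h2, h3, h4, h5, h6, h7, h8⟩ := exists_strictLyapunov_of_forms
    (fun t x => P.nuField j t x 0) B hBs hm hBm f T (by
      rintro (m | ⟨m, l⟩)
      · exact P.contDiff_varphi j _
      · exact hSc m l) (C := max W CS) (by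
      rintro (m | ⟨m, l⟩) t
      · exact ((norm_le_pi_norm (vecΛ (P.s j) (P.varphi j t)) m).trans (hWb t).1).trans
          (le_max_left _ _)
      · exact (hSb m l t).trans (le_max_right _ _)) (fun x => cB * P.cascadeSq j x)
    (fun x => by unfold cascadeSq; positivity) hBD (κ := κ / 2 * c) (by positivity)
    (C' := (3 * C1 * (1 + 10 * C ^ 2) + κ / 2) / cB) (by positivity) hmain
  exact ⟨U, Ulow, Uup, b, h1, h2, h3, fun t _ => h4 t, fun t _ => h5 t, fun t _ => h6 t, h7,
    fun t _ => h8 t⟩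

end Network

/-! ### Equilibria of the subsystem. -/

/-- A slope c > 0 over the length (2C + 1)/c would raise g by more than its oscillation 2C. -/
theorem nonpos_of_bounded_of_le_deriv {g g' : ℝ → ℝ} {c C : ℝ}
    (h : ∀ t, 0 ≤ t → HasDerivAt g (g' t) t) (hc : ∀ t, 0 ≤ t → c ≤ g' t)
    (hC : ∀ t, |g t| ≤ C) : c ≤ 0 := by
  by_contra! hpos
  have hC0 : 0 ≤ C := (abs_nonneg _).trans (hC 0)
  set T := (2 * C + 1) / c with hT
  have hT0 : 0 ≤ T := by positivity
  have h1 : c * (T - 0) ≤ g T - g 0 := by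
    refine (convex_Icc 0 T).mul_sub_le_image_sub_of_le_deriv
      (fun t ht => (h t ht.1).continuousAt.continuousWithinAt)
      (fun t ht => ?_) (fun t ht => ?_) 0 (Set.left_mem_Icc.2 hT0) T (Set.right_mem_Icc.2 hT0) hT0
    · exact (h t (interior_subset ht).1).differentiableAt.differentiableWithinAt
    · rw [(h t (interior_subset ht).1).deriv]
      exact hc t (interior_subset ht).1
  have h2 : c * (T - 0) = 2 * C + 1 := by
    rw [hT]
    field_simp
    ring
  have h3 := le_of_abs_le (hC T)
  have h4 := neg_le_of_abs_le (hC 0)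
  linarith

theorem NuSpace.ext_parts {s : ℕ} {x y : NuSpace s} (h1 : etaPart x = etaPart y)
    (h2 : zetaPart x = zetaPart y) (h3 : alphaPart x = alphaPart y) : x = y := by
  ext i
  rcases i with u | i | m
  · exact h1
  · exact congrFun h2 i
  · exact congrFun h3 m

theorem SimpleGraph.Connected.eq_of_forall_adj {V R : Type*} {G : SimpleGraph V} (hG : G.Connected)
    {f : V → R} (hf : ∀ i j, G.Adj i j → f i = f j) (i j : V) : f i = f j := by
  obtain ⟨w⟩ := hG.preconnected i j
  induction w with
  | nil => rfl
  | cons h _ ih => exact (hf _ _ h).trans ih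

namespace Network

variable {N : Type*} [Fintype N] [DecidableEq N] (P : Network N)

/-- Otherwise the bounded function αᵀ S α would have a derivative of at least κ ‖α‖² > 0. -/
theorem eq_zero_of_dotProduct_regressor_eq_zero (j : N) (α : Fin (P.s j) → ℝ)
    (h : ∀ t, 0 ≤ t → α ⬝ᵥ vecΛ (P.s j) (P.varphi j t) = 0) : α = 0 := by
  obtain ⟨S, C, κ, hκ, hS, hSC, hSe⟩ := P.exists_excitation j
  have h1 : κ * ‖α‖ ^ 2 ≤ 0 := by
    refine nonpos_of_bounded_of_le_deriv (g := fun t => ∑ m, ∑ l, α m * α l * S m l t)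
      (g' := fun t => ∑ m, ∑ l, α m * α l * deriv (S m l) t)
      (C := ∑ m, ∑ l, |α m * α l| * C) (fun t _ => ?_) (fun t ht => ?_) (fun t => ?_)
    · exact HasDerivAt.fun_sum fun m _ => HasDerivAt.fun_sum fun l _ =>
        (((hS m l).differentiable one_ne_zero).differentiableAt.hasDerivAt).const_mul _
    · have := hSe t α
      rw [h t ht] at this
      linarith
    · refine (Finset.abs_sum_le_sum_abs _ _).trans (Finset.sum_le_sum fun m _ => ?_)
      refine (Finset.abs_sum_le_sum_abs _ _).trans (Finset.sum_le_sum fun l _ => ?_)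
      rw [abs_mul]
      exact mul_le_mul_of_nonneg_left (hSC m l t) (abs_nonneg _)
  have h2 : ‖α‖ ^ 2 = 0 := by
    have := sq_nonneg ‖α‖
    nlinarith
  exact norm_eq_zero.1 (pow_eq_zero_iff two_ne_zero |>.1 h2)

/-- Otherwise 0 would be a root of the Hurwitz polynomial. -/
theorem r_zero_ne_zero (j : N) : P.r j ⟨0, by have := P.s_pos j; omega⟩ ≠ 0 := by
  intro h
  have hs := P.s_pos j
  have h1 := P.r_hurwitz j 0 (by
    rw [zero_pow (by omega), zero_add]
    refine Finset.sum_eq_zero fun i _ => ?_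
    by_cases hi : (i : ℕ) = 0
    · have : i = ⟨0, by omega⟩ := Fin.ext hi
      rw [this, h]
      simp
    · simp [hi])
  simp at h1

theorem nuField_zero (j : N) (t : ℝ) : P.nuField j t 0 0 = 0 := by
  have hα : P.alphaHat j 0 = P.α j := by
    ext m
    simp [alphaHat, alphaPart]
  have hz : zetaPart (0 : NuSpace (P.s j)) = 0 := rfl
  refine NuSpace.ext_parts ?_ ?_ ?_
  · rw [etaPart_nuField]
    simp [etaPart]
  · rw [zetaPart_nuField, hα, hz]
    simp
  · rw [alphaPart_nuField]
    simp
    rfl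

/-- The subsystem with zero input has no equilibrium other than the origin. -/
theorem eq_zero_of_nuField_eq_zero (j : N) (ν : NuSpace (P.s j))
    (h : ∀ t, 0 ≤ t → P.nuField j t ν 0 = 0) : ν = 0 := by
  have hs := P.s_pos j
  have hη : etaPart ν = 0 := by
    have := congrArg etaPart (h 0 le_rfl)
    rw [etaPart_nuField] at this
    simpa [etaPart] using this
  have hα : ∀ t, 0 ≤ t → P.vL j ν = 0 ∨ vecΛ (P.s j) (P.zeta j t ν) = 0 := by
    intro t ht
    have h1 := congrArg alphaPart (h t ht)
    rw [alphaPart_nuField, mul_zero, add_zero] at h1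
    have h2 : alphaPart (0 : NuSpace (P.s j)) = 0 := rfl
    rw [h2, smul_eq_zero] at h1
    refine h1.imp (fun h3 => ?_) id
    exact (mul_eq_zero.1 (neg_eq_zero.1 h3)).resolve_left P.kα_pos.ne'
  -- If v ≠ 0, then Λ(ζ) vanishes for all t, so the first entry of Λ(φ) is constant. Being the
  -- derivative of a bounded function, it is 0, which contradicts excitation in that direction.
  have hv : P.vL j ν = 0 := by
    by_contra hne
    have hΛ : ∀ t, 0 ≤ t → vecΛ (P.s j) (P.zeta j t ν) = 0 := fun t ht =>
      (hα t ht).resolve_left hne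
    set k0 : Fin (2 * P.s j) := ⟨0, by omega⟩ with hk0
    set m0 : Fin (P.s j) := ⟨0, by omega⟩ with hm0
    have hφ : ∀ t, 0 ≤ t → P.varphi j t k0.succ = -zetaPart ν k0.succ := by
      intro t ht
      have h1 : zetaPart ν k0.succ + P.varphi j t k0.succ = 0 := congrFun (hΛ t ht) m0
      linarith
    obtain ⟨C, hC⟩ := P.exists_varphi_bound j
    have h1 : -zetaPart ν k0.succ ≤ 0 :=
      nonpos_of_bounded_of_le_deriv (fun t _ => P.hasDerivAt_varphi j k0 t)
        (fun t ht => (hφ t ht).ge) (fun t => hC t _)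
    have h2 : zetaPart ν k0.succ ≤ 0 :=
      nonpos_of_bounded_of_le_deriv (fun t _ => (P.hasDerivAt_varphi j k0 t).neg)
        (fun t ht => by rw [hφ t ht, neg_neg]) (C := C) (fun t => by
          rw [Pi.neg_apply, abs_neg]
          exact hC t _)
    have h3 : (Pi.single m0 1 : Fin (P.s j) → ℝ) = 0 :=
      P.eq_zero_of_dotProduct_regressor_eq_zero j _ fun t ht => by
        rw [single_dotProduct, one_mul]
        have : vecΛ (P.s j) (P.varphi j t) m0 = P.varphi j t k0.succ := rfl
        rw [this, hφ t ht]
        linarith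
    have := congrFun h3 m0
    simp at this
  have hsucc : ∀ k : Fin (2 * P.s j), zetaPart ν k.succ = 0 := by
    intro k
    have h1 := congrFun (congrArg zetaPart (h 0 le_rfl)) k.castSucc
    rw [zetaPart_nuField_castSucc, hv] at h1
    simpa [zetaPart] using h1
  -- The shift rows have removed all other coordinates, so v = 0 reduces to r₀ ζ̃₀ = 0.
  have hzero : zetaPart ν 0 = 0 := by
    have h1 := P.vL_apply j ν
    rw [hv, hη, zero_add, dotProduct, Fin.sum_univ_succ] at h1
    simp only [hsucc, mul_zero, Finset.sum_const_zero, add_zero] at h1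
    have h2 : P.R j 0 = P.r j ⟨0, by omega⟩ := by
      have : (0 : Fin (2 * P.s j + 1)) = (⟨0, by omega⟩ : Fin (2 * P.s j)).castSucc := rfl
      rw [R, this, Fin.snoc_castSucc]
    rw [h2] at h1
    exact (mul_eq_zero.1 h1.symm).resolve_left (P.r_zero_ne_zero j)
  have hζ : zetaPart ν = 0 := by
    ext i
    refine Fin.cases hzero hsucc i
  refine NuSpace.ext_parts hη hζ ?_
  -- The last row now reads α̃·Λ(φ(t)) = 0 for all t ≥ 0.
  refine P.eq_zero_of_dotProduct_regressor_eq_zero j _ fun t ht => ?_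
  have h1 := congrFun (congrArg zetaPart (h t ht)) (Fin.last _)
  rw [zetaPart_nuField_last, hv, vecΛ_zeta, hζ] at h1
  have h2 : vecΛ (P.s j) 0 = 0 := rfl
  rw [h2] at h1
  simpa [zetaPart] using h1

/-! ### Power flow, communication Laplacian and the unique equilibrium. -/

/-- The map from angles to angle differences along the oriented edges. -/
def angleDiff : (N → ℝ) →ₗ[ℝ] ({e // e ∈ P.E} → ℝ) :=
  LinearMap.pi fun e => (LinearMap.proj e.1.1 : (N → ℝ) →ₗ[ℝ] ℝ) - LinearMap.proj e.1.2

theorem angleDiff_apply (θ : N → ℝ) (e : {e // e ∈ P.E}) :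
    P.angleDiff θ e = θ e.1.1 - θ e.1.2 := rfl

theorem admissible_iff (x : P.State) : P.Admissible x ↔ ∃ θ, x.1 = P.angleDiff θ :=
  ⟨fun ⟨θ, h⟩ => ⟨θ, funext h⟩, fun ⟨θ, h⟩ => ⟨θ, congrFun h⟩⟩

/-- The net power inflow at the nodes. -/
def flow : ({e // e ∈ P.E} → ℝ) →ₗ[ℝ] (N → ℝ) :=
  LinearMap.pi fun j => (∑ e : {e // e ∈ P.E}, (if e.1.2 = j then P.B e.1 else 0) • LinearMap.proj e)
    - ∑ e : {e // e ∈ P.E}, (if e.1.1 = j then P.B e.1 else 0) • LinearMap.proj e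

theorem flow_apply (θ : {e // e ∈ P.E} → ℝ) (j : N) : P.flow θ j =
    (∑ e : {e // e ∈ P.E}, if e.1.2 = j then P.B e.1 * θ e else 0)
      - ∑ e : {e // e ∈ P.E}, if e.1.1 = j then P.B e.1 * θ e else 0 := by
  simp only [flow, LinearMap.pi_apply, LinearMap.sub_apply, LinearMap.sum_apply,
    LinearMap.smul_apply, LinearMap.proj_apply, smul_eq_mul, ite_mul, zero_mul]

/-- Up to sign, `flow` is the `B`-weighted adjoint of `angleDiff`. This gives conservation of total
flow, the energy argument for uniqueness, and a cancellation in the power balance. -/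
theorem sum_mul_flow (ω : N → ℝ) (θ : {e // e ∈ P.E} → ℝ) :
    ∑ j, ω j * P.flow θ j = -∑ e : {e // e ∈ P.E}, P.B e.1 * θ e * P.angleDiff ω e := by
  simp only [flow_apply, mul_sub, Finset.mul_sum, Finset.sum_sub_distrib]
  rw [Finset.sum_comm, Finset.sum_comm (f := fun j (e : {e // e ∈ P.E}) =>
    ω j * if e.1.1 = j then P.B e.1 * θ e else 0), ← Finset.sum_sub_distrib,
    ← Finset.sum_neg_distrib]
  refine Finset.sum_congr rfl fun e _ => ?_
  simp only [mul_ite, mul_zero, Finset.sum_ite_eq, Finset.mem_univ, if_true, angleDiff_apply]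
  ring

theorem sum_flow (θ : {e // e ∈ P.E} → ℝ) : ∑ j, P.flow θ j = 0 := by
  have := P.sum_mul_flow (fun _ => 1) θ
  simpa [angleDiff_apply] using this

theorem angleDiff_eq_zero_of_flow_eq_zero (θ : N → ℝ) (h : P.flow (P.angleDiff θ) = 0) :
    P.angleDiff θ = 0 := by
  have h1 := P.sum_mul_flow θ (P.angleDiff θ)
  rw [h] at h1
  simp only [Pi.zero_apply, mul_zero, Finset.sum_const_zero] at h1
  have h2 : ∀ e ∈ Finset.univ, P.B e.1 * P.angleDiff θ e * P.angleDiff θ e = 0 := by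
    refine (Finset.sum_eq_zero_iff_of_nonneg fun e _ => ?_).1 (neg_eq_zero.1 h1.symm)
    rw [mul_assoc]
    exact mul_nonneg (P.B_pos _ e.2).le (mul_self_nonneg _)
  ext e
  have := h2 e (Finset.mem_univ e)
  rw [mul_assoc, mul_eq_zero, mul_self_eq_zero] at this
  exact this.resolve_left (P.B_pos _ e.2).ne'

theorem eq_of_angleDiff_eq_zero (ω : N → ℝ) (h : P.angleDiff ω = 0) (i j : N) : ω i = ω j := by
  refine SimpleGraph.Connected.eq_of_forall_adj P.E_connected (fun i j hij => ?_) i j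
  rw [SimpleGraph.fromRel_adj] at hij
  rcases hij.2 with he | he
  · exact sub_eq_zero.1 (congrFun h ⟨(i, j), he⟩)
  · exact (sub_eq_zero.1 (congrFun h ⟨(j, i), he⟩)).symm

open Classical in
/-- The Laplacian of the communication graph. -/
def commLap (μ : N → ℝ) (j : N) : ℝ := ∑ k, if P.H.Adj j k then μ j - μ k else 0

open Classical in
theorem sum_mul_commLap (f μ : N → ℝ) : ∑ j, f j * P.commLap μ j =
    1 / 2 * ∑ j, ∑ k, if P.H.Adj j k then (f j - f k) * (μ j - μ k) else 0 := by
  have h1 : ∑ j, f j * P.commLap μ j =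
      ∑ j, ∑ k, if P.H.Adj j k then f j * (μ j - μ k) else 0 := by
    simp only [commLap, Finset.mul_sum, mul_ite, mul_zero]
  have h2 : ∑ j, ∑ k, (if P.H.Adj j k then f j * (μ j - μ k) else 0) =
      ∑ j, ∑ k, if P.H.Adj j k then f k * (μ k - μ j) else 0 := by
    rw [Finset.sum_comm]
    simp only [P.H.adj_comm]
  have h3 : ∑ j, ∑ k, (if P.H.Adj j k then (f j - f k) * (μ j - μ k) else 0) =
      ∑ j, ∑ k, (if P.H.Adj j k then f j * (μ j - μ k) else 0) +
      ∑ j, ∑ k, (if P.H.Adj j k then f k * (μ k - μ j) else 0) := by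
    simp only [← Finset.sum_add_distrib]
    refine Finset.sum_congr rfl fun j _ => Finset.sum_congr rfl fun k _ => ?_
    split_ifs <;> ring
  rw [h3, ← h2, h1]
  ring

theorem sum_commLap (μ : N → ℝ) : ∑ j, P.commLap μ j = 0 := by
  have := P.sum_mul_commLap (fun _ => 1) μ
  simpa using this

theorem eq_of_commLap_eq_zero (μ : N → ℝ) (h : ∑ j, μ j * P.commLap μ j = 0) (i j : N) :
    μ i = μ j := by
  classical
  refine SimpleGraph.Connected.eq_of_forall_adj P.H_connected (fun i j hij => ?_) i j
  rw [sum_mul_commLap] at h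
  have hnn : ∀ j k, 0 ≤ if P.H.Adj j k then (μ j - μ k) * (μ j - μ k) else 0 := fun j k => by
    split_ifs
    · exact mul_self_nonneg _
    · exact le_rfl
  have h1 := (mul_eq_zero.1 h).resolve_left (by norm_num)
  rw [Finset.sum_eq_zero_iff_of_nonneg fun j _ => Finset.sum_nonneg fun k _ => hnn j k] at h1
  have h2 := h1 i (Finset.mem_univ i)
  rw [Finset.sum_eq_zero_iff_of_nonneg fun k _ => hnn i k] at h2
  have h3 := h2 j (Finset.mem_univ j)
  rw [if_pos hij, mul_self_eq_zero] at h3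
  exact sub_eq_zero.1 h3

theorem sum_inv_β_pos : 0 < ∑ j, 1 / P.β j := by
  have := P.H_connected.nonempty
  exact Finset.sum_pos (fun j _ => one_div_pos.2 (P.β_pos j)) Finset.univ_nonempty

/-- Balanced power flows with equal prices vanish. -/
theorem angleDiff_and_price_eq_zero (θ μ : N → ℝ) (hμ : ∀ i j, μ i = μ j)
    (h : ∀ j, P.flow (P.angleDiff θ) j = μ j / P.β j) : P.angleDiff θ = 0 ∧ μ = 0 := by
  have h1 : μ = 0 := by
    ext i
    have h2 := P.sum_flow (P.angleDiff θ)
    simp only [h, fun j => hμ j i, div_eq_mul_one_div (μ i), ← Finset.mul_sum] at h2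
    exact (mul_eq_zero.1 h2).resolve_right P.sum_inv_β_pos.ne'
  refine ⟨P.angleDiff_eq_zero_of_flow_eq_zero θ ?_, h1⟩
  ext j
  rw [h, h1]
  simp

theorem exists_balance (p : N → ℝ) :
    ∃ (θ : N → ℝ) (c : ℝ), ∀ j, p j + P.flow (P.angleDiff θ) j - c / P.β j = 0 := by
  -- Using Σ θ_i as the price makes the system square and removes the constant angles from the
  -- kernel, so injectivity gives solvability.
  set L : (N → ℝ) →ₗ[ℝ] (N → ℝ) := -(P.flow ∘ₗ P.angleDiff) +
    (∑ i, LinearMap.proj i : (N → ℝ) →ₗ[ℝ] ℝ).smulRight fun j => 1 / P.β j with hL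
  have hLapp : ∀ θ j, L θ j = -P.flow (P.angleDiff θ) j + (∑ i, θ i) / P.β j := fun θ j => by
    simp [hL, div_eq_mul_inv]
  have hinj : Function.Injective L := by
    rw [← LinearMap.ker_eq_bot, LinearMap.ker_eq_bot']
    intro θ hθ
    have h1 : ∀ j, P.flow (P.angleDiff θ) j = (fun _ => ∑ i, θ i) j / P.β j := fun j => by
      have := congrFun hθ j
      rw [hLapp, Pi.zero_apply] at this
      linarith
    obtain ⟨h2, h3⟩ := P.angleDiff_and_price_eq_zero θ (fun _ => ∑ i, θ i) (fun _ _ => rfl) h1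
    have h4 := P.eq_of_angleDiff_eq_zero θ h2
    ext i
    have h5 : ∑ k, θ k = 0 := congrFun h3 i
    simp only [fun k => h4 k i, Finset.sum_const, nsmul_eq_mul] at h5
    refine (mul_eq_zero.1 h5).resolve_left ?_
    have : Nonempty N := ⟨i⟩
    simp
  obtain ⟨θ, hθ⟩ := LinearMap.injective_iff_surjective.1 hinj p
  refine ⟨θ, ∑ i, θ i, fun j => ?_⟩
  rw [← hθ, hLapp]
  ring

theorem field_θ (d : N → ℝ) (t : ℝ) (x : P.State) : (P.field d t x).1 = P.angleDiff x.2.1 := rfl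

theorem field_ω (d : N → ℝ) (t : ℝ) (x : P.State) (j : N) : (P.field d t x).2.1 j =
    1 / P.M j * (P.Pbar j + P.rho j t (x.2.2.2 j) + P.flow x.1 j - x.2.2.1 j / P.β j
      - d j * x.2.1 j - P.D j * x.2.1 j) := by
  rw [flow_apply, ← add_sub_assoc]
  rfl

theorem field_μ (d : N → ℝ) (t : ℝ) (x : P.State) (j : N) : (P.field d t x).2.2.1 j =
    -P.commLap x.2.2.1 j + x.2.1 j / P.β j := rfl

theorem field_ν (d : N → ℝ) (t : ℝ) (x : P.State) (j : N) : (P.field d t x).2.2.2 j =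
    P.nuField j t (x.2.2.2 j) (x.2.1 j) := rfl

theorem rho_zero (j : N) (t : ℝ) : P.rho j t 0 = 0 := by
  have hα : P.alphaHat j 0 = P.α j := by
    ext m
    simp [alphaHat, alphaPart]
  have hz : P.zeta j t 0 = P.varphi j t := by
    ext m
    simp [zeta, zetaPart]
  rw [rho, hα, hz, sub_self]

/-- Constancy of θ̃ makes ω constant; summing the price equations removes the Laplacian and forces ω
= 0. Then ν = 0 by excitation, prices agree, and only the static balance remains. -/
theorem isEquilibrium_iff (d : N → ℝ) (x : P.State) : P.IsEquilibrium d x ↔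
    P.Admissible x ∧ x.2.1 = 0 ∧ x.2.2.2 = 0 ∧ (∀ i j, x.2.2.1 i = x.2.2.1 j) ∧
      ∀ j, P.Pbar j + P.flow x.1 j - x.2.2.1 j / P.β j = 0 := by
  constructor
  · rintro ⟨hadm, h⟩
    have hN := P.H_connected.nonempty
    have hω : x.2.1 = 0 := by
      have h1 := P.eq_of_angleDiff_eq_zero x.2.1 (by rw [← P.field_θ d 0, h 0 le_rfl]; rfl)
      ext i
      have h2 : ∀ j, -P.commLap x.2.2.1 j + x.2.1 j / P.β j = 0 := fun j => by
        rw [← P.field_μ d 0, h 0 le_rfl]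
        rfl
      have h3 := Finset.sum_congr rfl fun j (_ : j ∈ Finset.univ) => h2 j
      simp only [Finset.sum_add_distrib, Finset.sum_neg_distrib, sum_commLap, neg_zero, zero_add,
        Finset.sum_const_zero, fun j => h1 j i, div_eq_mul_one_div (x.2.1 i),
        ← Finset.mul_sum] at h3
      exact (mul_eq_zero.1 h3).resolve_right P.sum_inv_β_pos.ne'
    have hν : x.2.2.2 = 0 := by
      ext1 j
      refine P.eq_zero_of_nuField_eq_zero j _ fun t ht => ?_
      have h1 := P.field_ν d t x j
      rw [h t ht, hω] at h1
      exact h1.symm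
    refine ⟨hadm, hω, hν, P.eq_of_commLap_eq_zero _ ?_, fun j => ?_⟩
    · refine Finset.sum_eq_zero fun j _ => ?_
      have h1 := P.field_μ d 0 x j
      rw [h 0 le_rfl, hω] at h1
      have h2 : P.commLap x.2.2.1 j = 0 := by simpa using h1
      rw [h2, mul_zero]
    · have h1 := P.field_ω d 0 x j
      rw [h 0 le_rfl, hω, hν, Pi.zero_apply, Pi.zero_apply, rho_zero] at h1
      have h2 := (mul_eq_zero.1 h1.symm).resolve_left (one_div_pos.2 (P.M_pos j)).ne'
      linarith
  · rintro ⟨hadm, hω, hν, hμ, hbal⟩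
    refine ⟨hadm, fun t _ => ?_⟩
    refine Prod.ext ?_ (Prod.ext ?_ (Prod.ext ?_ ?_))
    · rw [field_θ, hω, map_zero]
      rfl
    · ext j
      rw [field_ω, hω, hν, Pi.zero_apply, Pi.zero_apply, rho_zero]
      have := hbal j
      have h2 : P.Pbar j + 0 + P.flow x.1 j - x.2.2.1 j / P.β j - d j * 0 - P.D j * 0 = 0 := by
        linarith
      rw [h2, mul_zero]
      rfl
    · ext j
      rw [field_μ, hω]
      have : P.commLap x.2.2.1 j = 0 :=
        Finset.sum_eq_zero fun k _ => by simp [hμ j k]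
      simp [this]
    · ext1 j
      rw [field_ν, hω, hν]
      exact P.nuField_zero j t

theorem existsUnique_isEquilibrium (d : N → ℝ) : ∃! xs : P.State, P.IsEquilibrium d xs := by
  obtain ⟨θ, c, h⟩ := P.exists_balance P.Pbar
  have h0 : P.IsEquilibrium d (P.angleDiff θ, 0, fun _ => c, 0) :=
    (P.isEquilibrium_iff d _).2 ⟨⟨θ, fun _ => rfl⟩, rfl, rfl, fun _ _ => rfl, h⟩
  refine ⟨_, h0, fun y hy => ?_⟩
  obtain ⟨hadm, hω, hν, hμ, hbal⟩ := (P.isEquilibrium_iff d y).1 hy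
  obtain ⟨θ', hθ'⟩ := (P.admissible_iff y).1 hadm
  obtain ⟨h1, h2⟩ := P.angleDiff_and_price_eq_zero (θ' - θ) (fun j => y.2.2.1 j - c)
    (fun i j => by rw [hμ i j]) (fun j => by
      have e1 := h j
      have e2 := hbal j
      rw [hθ'] at e2
      rw [map_sub, map_sub, Pi.sub_apply, sub_div]
      linarith)
  rw [map_sub, sub_eq_zero] at h1
  refine Prod.ext (hθ'.trans h1) (Prod.ext hω (Prod.ext ?_ hν))
  ext j
  exact sub_eq_zero.1 (congrFun h2 j)

end Network

/-! ### Euclidean norms of the blocks and a definiteness criterion. -/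

section EuclideanNorm

variable {ι : Type*} [Fintype ι]

theorem enorm2_nonneg (v : ι → ℝ) : 0 ≤ enorm2 v := norm_nonneg _

theorem enorm2_sq (v : ι → ℝ) : enorm2 v ^ 2 = ∑ i, v i ^ 2 := by
  rw [enorm2, EuclideanSpace.real_norm_sq_eq]

theorem enorm2_add_le (v w : ι → ℝ) : enorm2 (v + w) ≤ enorm2 v + enorm2 w := by
  rw [enorm2, WithLp.toLp_add]
  exact norm_add_le _ _

theorem abs_apply_le_enorm2 (v : ι → ℝ) (i : ι) : |v i| ≤ enorm2 v := by
  rw [← sq_le_sq₀ (abs_nonneg _) (enorm2_nonneg v), sq_abs, enorm2_sq]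
  exact Finset.single_le_sum (f := fun i => v i ^ 2) (fun _ _ => sq_nonneg _) (Finset.mem_univ i)

theorem abs_dotProduct_le_enorm2 (v w : ι → ℝ) : |v ⬝ᵥ w| ≤ enorm2 v * enorm2 w := by
  have h := abs_real_inner_le_norm (WithLp.toLp 2 w) (WithLp.toLp 2 v)
  rw [EuclideanSpace.inner_toLp_toLp, star_trivial] at h
  rw [mul_comm]
  exact h

end EuclideanNorm

theorem norm_sq_parts {s : ℕ} (ν : NuSpace s) :
    ‖ν‖ ^ 2 = etaPart ν ^ 2 + (enorm2 (zetaPart ν) ^ 2 + enorm2 (alphaPart ν) ^ 2) := by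
  rw [EuclideanSpace.real_norm_sq_eq, Fintype.sum_sum_type, Fintype.sum_sum_type, enorm2_sq,
    enorm2_sq]
  simp [etaPart, zetaPart, alphaPart]

theorem enorm2_zetaPart_le {s : ℕ} (ν : NuSpace s) : enorm2 (zetaPart ν) ≤ ‖ν‖ := by
  refine le_of_sq_le_sq ?_ (norm_nonneg _)
  have := norm_sq_parts ν
  nlinarith [sq_nonneg (etaPart ν), sq_nonneg (enorm2 (alphaPart ν))]

theorem enorm2_alphaPart_le {s : ℕ} (ν : NuSpace s) : enorm2 (alphaPart ν) ≤ ‖ν‖ := by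
  refine le_of_sq_le_sq ?_ (norm_nonneg _)
  have := norm_sq_parts ν
  nlinarith [sq_nonneg (etaPart ν), sq_nonneg (enorm2 (zetaPart ν))]

theorem norm_le_sum_parts {s : ℕ} (ν : NuSpace s) :
    ‖ν‖ ≤ |etaPart ν| + enorm2 (zetaPart ν) + enorm2 (alphaPart ν) := by
  have h1 := abs_nonneg (etaPart ν)
  have h2 := enorm2_nonneg (zetaPart ν)
  have h3 := enorm2_nonneg (alphaPart ν)
  refine le_of_sq_le_sq ?_ (by positivity)
  rw [norm_sq_parts, ← sq_abs (etaPart ν)]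
  nlinarith [mul_nonneg h1 h2, mul_nonneg h1 h3, mul_nonneg h2 h3]

theorem enorm2_vecΛ_le (s : ℕ) (ζ : Fin (2 * s + 1) → ℝ) : enorm2 (vecΛ s ζ) ≤ enorm2 ζ := by
  refine le_of_sq_le_sq ?_ (enorm2_nonneg _)
  rw [enorm2_sq, enorm2_sq]
  set f : Fin s → Fin (2 * s + 1) :=
    fun m => ⟨2 * (m : ℕ) + 1, by have := m.isLt; omega⟩ with hf
  have hinj : Function.Injective f := fun a b h => by
    simp only [hf, Fin.mk.injEq] at h
    exact Fin.ext (by omega)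
  have h1 : ∑ m, vecΛ s ζ m ^ 2 = ∑ i ∈ Finset.univ.image f, ζ i ^ 2 := by
    rw [Finset.sum_image fun a _ b _ h => hinj h]
    rfl
  rw [h1]
  exact Finset.sum_le_sum_of_subset_of_nonneg (Finset.subset_univ _) fun _ _ _ => sq_nonneg _

theorem enorm2_smul {ι : Type*} [Fintype ι] (c : ℝ) (v : ι → ℝ) :
    enorm2 (c • v) = |c| * enorm2 v := by
  rw [enorm2, WithLp.toLp_smul, norm_smul, Real.norm_eq_abs]
  rfl

/-- The rate ε is determinant over trace of the symmetric matrix of x² - b x y + a y², a lower bound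
for its least eigenvalue. -/
theorem exists_pos_neg_definite {a b : ℝ} (ha : 0 < a) (h : b ^ 2 < 4 * a) :
    ∃ ε : ℝ, 0 < ε ∧ ∀ x y : ℝ, -x ^ 2 + b * (x * y) - a * y ^ 2 ≤ -(ε * (x ^ 2 + y ^ 2)) := by
  set ε := (4 * a - b ^ 2) / (4 * (1 + a)) with hε
  have hε0 : 0 < ε := div_pos (by linarith) (by linarith)
  have hε1 : ε < 1 := by
    rw [hε, div_lt_one (by linarith)]
    nlinarith [sq_nonneg b]
  have h1 : 4 * ε * (1 + a) = 4 * a - b ^ 2 := by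
    rw [hε]
    field_simp
  refine ⟨ε, hε0, fun x y => ?_⟩
  have h2 : 0 ≤ (1 - ε) * ((1 - ε) * x ^ 2 - b * (x * y) + (a - ε) * y ^ 2) := by
    have e : (1 - ε) * ((1 - ε) * x ^ 2 - b * (x * y) + (a - ε) * y ^ 2) =
        ((1 - ε) * x - b / 2 * y) ^ 2 + ε ^ 2 * y ^ 2 := by
      linear_combination (-(1 / 4) * y ^ 2) * h1
    rw [e]
    positivity
  have h3 := nonneg_of_mul_nonneg_right h2 (by linarith)
  linarith

/-! ### Continuous induction and Barbalat's lemma. -/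

theorem le_of_forall_eventually_le {f : ℝ → ℝ} {c : ℝ} (hf : ContinuousOn f (Set.Ici 0))
    (h0 : f 0 ≤ c) (h : ∀ t, 0 ≤ t → f t ≤ c → ∀ᶠ z in 𝓝[>] t, f z ≤ c) (t : ℝ) (ht : 0 ≤ t) :
    f t ≤ c := by
  have hsub : Set.Icc 0 t ⊆ {z | f z ≤ c} := by
    refine IsClosed.Icc_subset_of_forall_exists_gt ?_ h0 ?_
    · have h1 := (hf.mono fun z (hz : z ∈ Set.Icc 0 t) => hz.1).preimage_isClosed_of_isClosed
        isClosed_Icc (isClosed_Iic (a := c))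
      rwa [Set.inter_comm] at h1
    · rintro x ⟨hx, hx0, -⟩ y hy
      have h1 : ∀ᶠ z in 𝓝[>] x, z ∈ Set.Ioc x y := Ioc_mem_nhdsGT hy
      exact ((h x hx0 hx).and h1).exists
  exact hsub ⟨ht, le_rfl⟩

/-- Barbalat's lemma for a convergent function whose derivative is dominated by `-g + h`, with `g`
Lipschitz and `h` vanishing at infinity. -/
theorem eventually_le_of_deriv_le {F F' g h : ℝ → ℝ} {l L : ℝ}
    (hF : ∀ t, 0 ≤ t → HasDerivWithinAt F (F' t) (Set.Ici 0) t) (hFl : Tendsto F atTop (𝓝 l))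
    (hF' : ∀ t, 0 ≤ t → F' t ≤ -g t + h t) (hh : Tendsto h atTop (𝓝 0))
    (hg : ∀ s t, 0 ≤ s → 0 ≤ t → |g s - g t| ≤ L * |s - t|) {ε : ℝ} (hε : 0 < ε) :
    ∀ᶠ t in atTop, g t ≤ ε := by
  set K := |L| + 1 with hK
  have hK0 : 0 < K := by positivity
  -- If g(t) > ε, then g stays above ε/2 on [t, t + δ], so F drops there by at least ε δ/4.
  -- Convergence of F, at tolerance ε δ/8, forbids this.
  set δ := ε / (2 * K) with hδ
  have hδ0 : 0 < δ := by positivity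
  have hKδ : K * δ = ε / 2 := by
    rw [hδ]
    field_simp
  have h1 : ∀ᶠ t in atTop, |h t| < ε / 4 := by
    have := (Metric.tendsto_nhds.1 hh) (ε / 4) (by positivity)
    simpa [Real.dist_eq] using this
  have h2 : ∀ᶠ t in atTop, |F t - l| < ε * δ / 8 := by
    have := (Metric.tendsto_nhds.1 hFl) (ε * δ / 8) (by positivity)
    simpa [Real.dist_eq] using this
  obtain ⟨T, hT⟩ := eventually_atTop.1 (h1.and h2)
  filter_upwards [eventually_ge_atTop (max T 1)] with t ht
  have htT : T ≤ t := (le_max_left _ _).trans ht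
  have ht1 : 1 ≤ t := (le_max_right _ _).trans ht
  by_contra! hgt
  have h3 : F (t + δ) - F t ≤ -(ε / 4) * (t + δ - t) := by
    have hd : ∀ s ∈ Set.Icc t (t + δ), HasDerivAt F (F' s) s := fun s hs =>
      (hF s (by linarith [hs.1])).hasDerivAt (Ici_mem_nhds (by linarith [hs.1]))
    refine (convex_Icc t (t + δ)).image_sub_le_mul_sub_of_deriv_le
      (fun s hs => (hd s hs).continuousAt.continuousWithinAt)
      (fun s hs => (hd s (interior_subset hs)).differentiableAt.differentiableWithinAt)
      (fun s hs => ?_) t (Set.left_mem_Icc.2 (by linarith)) (t + δ)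
      (Set.right_mem_Icc.2 (by linarith)) (by linarith)
    have hs' := interior_subset hs
    rw [(hd s hs').deriv]
    have h4 := hF' s (by linarith [hs'.1])
    have h5 := (abs_lt.1 (hT s (by linarith [hs'.1])).1).2
    have h6 : |g s - g t| ≤ ε / 2 := by
      rw [← hKδ]
      refine (hg s t (by linarith [hs'.1]) (by linarith)).trans ?_
      have h7 : |s - t| ≤ δ := by
        rw [abs_of_nonneg (by linarith [hs'.1])]
        linarith [hs'.2]
      exact mul_le_mul (by linarith [le_abs_self L]) h7 (abs_nonneg _) hK0.le
    have h8 := (abs_le.1 h6).1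
    linarith
  have h4 := abs_lt.1 (hT t htT).2
  have h5 := abs_lt.1 (hT (t + δ) (by linarith)).2
  have h6 : -(ε / 4) * (t + δ - t) = -(ε * δ / 4) := by ring
  linarith [h4.1, h4.2, h5.1, h5.2]

/-! ### Coupling estimates between network and subsystems. -/

namespace Network

variable {N : Type*} [Fintype N] [DecidableEq N] (P : Network N)

theorem one_le_enorm2_R (j : N) : 1 ≤ enorm2 (P.R j) := by
  have := abs_apply_le_enorm2 (P.R j) (Fin.last _)
  simpa [R] using this

/-- A(α̂) and A(α) differ only in the last row, where `R` has the entry 1. The terms in φ alone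
cancel, so every remaining term contains a block of ν. -/
theorem rho_eq (j : N) (t : ℝ) (ν : NuSpace (P.s j)) : P.rho j t ν =
    -(P.R j ⬝ᵥ zetaPart ν) - Matrix.vecMul (P.R j) (matA (P.s j) (P.α j)) ⬝ᵥ zetaPart ν
      - alphaPart ν ⬝ᵥ vecΛ (P.s j) (P.zeta j t ν) := by
  have hA : ∀ α x, P.Atilde j α ⬝ᵥ x =
      P.R j ⬝ᵥ x + P.R j ⬝ᵥ Matrix.mulVec (matA (P.s j) α) x := fun α x => by
    rw [Atilde, ← Matrix.dotProduct_mulVec, Matrix.add_mulVec, Matrix.one_mulVec, dotProduct_add]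
  have hR : ∀ x, P.R j ⬝ᵥ Matrix.mulVec (matA (P.s j) (P.alphaHat j ν)) x =
      P.R j ⬝ᵥ Matrix.mulVec (matA (P.s j) (P.α j)) x + alphaPart ν ⬝ᵥ vecΛ (P.s j) x := by
    intro x
    rw [dotProduct, dotProduct, Fin.sum_univ_castSucc, Fin.sum_univ_castSucc]
    simp only [matA_mulVec_castSucc, matA_mulVec_last, alphaHat, add_dotProduct]
    have : P.R j (Fin.last _) = 1 := by simp [R]
    rw [this]
    ring
  rw [rho, hA, hA, hR, ← Matrix.dotProduct_mulVec]
  simp only [zeta, Matrix.mulVec_add, dotProduct_add]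
  ring

theorem enorm2_vecΛ_zeta_le (j : N) {t φ c : ℝ} (hφ : enorm2 (P.varphi j t) ≤ φ)
    {ν : NuSpace (P.s j)} (hν : ‖ν‖ ≤ c) : enorm2 (vecΛ (P.s j) (P.zeta j t ν)) ≤ c + φ :=
  (enorm2_vecΛ_le _ _).trans ((enorm2_add_le _ _).trans
    (add_le_add ((enorm2_zetaPart_le ν).trans hν) hφ))

theorem abs_rho_le (j : N) {t φ c c₂ c₃ : ℝ} (hφ : enorm2 (P.varphi j t) ≤ φ)
    (hc₂ : enorm2 (P.R j) * φ + enorm2 (P.R j)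
      + enorm2 (Matrix.vecMul (P.R j) (matA (P.s j) (P.α j))) ≤ c₂) (hc₃ : c₂ * (1 + c) ≤ c₃)
    {ν : NuSpace (P.s j)} (hν : ‖ν‖ ≤ c) : |P.rho j t ν| ≤ c₃ * ‖ν‖ := by
  have hR := P.one_le_enorm2_R j
  have hφ0 : 0 ≤ φ := (enorm2_nonneg _).trans hφ
  have hc0 : 0 ≤ c := (norm_nonneg _).trans hν
  set A := enorm2 (Matrix.vecMul (P.R j) (matA (P.s j) (P.α j))) with hA
  have hA0 : 0 ≤ A := enorm2_nonneg _
  have h1 : |P.R j ⬝ᵥ zetaPart ν| ≤ enorm2 (P.R j) * ‖ν‖ :=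
    (abs_dotProduct_le_enorm2 _ _).trans
      (mul_le_mul_of_nonneg_left (enorm2_zetaPart_le ν) (by linarith))
  have h2 : |Matrix.vecMul (P.R j) (matA (P.s j) (P.α j)) ⬝ᵥ zetaPart ν| ≤ A * ‖ν‖ :=
    (abs_dotProduct_le_enorm2 _ _).trans
      (mul_le_mul_of_nonneg_left (enorm2_zetaPart_le ν) hA0)
  have h3 : |alphaPart ν ⬝ᵥ vecΛ (P.s j) (P.zeta j t ν)| ≤ ‖ν‖ * (c + φ) :=
    (abs_dotProduct_le_enorm2 _ _).trans (mul_le_mul (enorm2_alphaPart_le ν)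
      (P.enorm2_vecΛ_zeta_le j hφ hν) (enorm2_nonneg _) (norm_nonneg _))
  have h4 : |P.rho j t ν| ≤ (enorm2 (P.R j) + A + (c + φ)) * ‖ν‖ := by
    rw [rho_eq]
    refine (abs_sub _ _).trans ((add_le_add_left (abs_sub _ _) _).trans ?_)
    rw [abs_neg]
    linarith
  refine h4.trans (mul_le_mul_of_nonneg_right ?_ (norm_nonneg _))
  -- Since ‖R‖ ≥ 1, the summand φ fits under ‖R‖ φ, and c under c₂ c.
  have h5 : φ ≤ enorm2 (P.R j) * φ := le_mul_of_one_le_left hφ0 hR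
  have h6 : c ≤ c₂ * c := le_mul_of_one_le_left hc0 (by linarith)
  linarith

/-- The input enters affinely, through M, M G and kα M Λ(ζ), the three summands in the bound on c₃.
-/
theorem norm_nuField_sub_le (j : N) {t φ c c₃ : ℝ} (hφ : enorm2 (P.varphi j t) ≤ φ)
    (hc₃ : P.M j + enorm2 (vecG (P.s j) P.γ) * P.M j + P.kα * P.M j * (c + φ) ≤ c₃)
    {ν : NuSpace (P.s j)} (hν : ‖ν‖ ≤ c) (ω : ℝ) :
    ‖P.nuField j t ν ω - P.nuField j t ν 0‖ ≤ c₃ * |ω| := by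
  have hM := P.M_pos j
  have hk := P.kα_pos
  refine (norm_le_sum_parts _).trans ?_
  have h1 : etaPart (P.nuField j t ν ω - P.nuField j t ν 0) = -(P.M j * ω) := by
    have : etaPart (P.nuField j t ν ω - P.nuField j t ν 0) =
      etaPart (P.nuField j t ν ω) - etaPart (P.nuField j t ν 0) := rfl
    rw [this, etaPart_nuField, etaPart_nuField]
    ring
  have h2 : zetaPart (P.nuField j t ν ω - P.nuField j t ν 0) =
      (-(P.M j * ω)) • vecG (P.s j) P.γ := by
    have : zetaPart (P.nuField j t ν ω - P.nuField j t ν 0) =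
      zetaPart (P.nuField j t ν ω) - zetaPart (P.nuField j t ν 0) := rfl
    rw [this, zetaPart_nuField, zetaPart_nuField]
    ext i
    simp
    ring
  have h3 : alphaPart (P.nuField j t ν ω - P.nuField j t ν 0) =
      (-(P.kα * (P.M j * ω))) • vecΛ (P.s j) (P.zeta j t ν) := by
    have : alphaPart (P.nuField j t ν ω - P.nuField j t ν 0) =
      alphaPart (P.nuField j t ν ω) - alphaPart (P.nuField j t ν 0) := rfl
    rw [this, alphaPart_nuField, alphaPart_nuField]
    ext i
    simp
    ring
  rw [h1, h2, h3, enorm2_smul, enorm2_smul, abs_neg, abs_neg, abs_mul, abs_mul P.kα, abs_mul,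
    abs_of_pos hM, abs_of_pos hk]
  have h4 := P.enorm2_vecΛ_zeta_le j hφ hν
  have h5 : P.kα * (P.M j * |ω|) * enorm2 (vecΛ (P.s j) (P.zeta j t ν)) ≤
      P.kα * (P.M j * |ω|) * (c + φ) := by gcongr
  have h6 := mul_le_mul_of_nonneg_right hc₃ (abs_nonneg ω)
  linarith

theorem IsSubLyapunov.nonneg {P : Network N} {j : N} {U : ℝ → NuSpace (P.s j) → ℝ}
    {Ulow Uup : NuSpace (P.s j) → ℝ} {b : ℝ} (h : P.IsSubLyapunov j U Ulow Uup b) {t : ℝ}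
    (ht : 0 ≤ t) (ν : NuSpace (P.s j)) : 0 ≤ U t ν := by
  refine le_trans ?_ (h.low_le t ht ν)
  by_cases hν : ν = 0
  · rw [hν, h.low_posDef.zero_at]
  · exact (h.low_posDef.pos ν hν).le

/-- Decay of a subsystem Lyapunov function under the input `ω`, on a bounded set. -/
theorem IsSubLyapunov.decay_input {P : Network N} {j : N} {U : ℝ → NuSpace (P.s j) → ℝ}
    {Ulow Uup : NuSpace (P.s j) → ℝ} {b : ℝ} (h : P.IsSubLyapunov j U Ulow Uup b) {t φ c c₃ : ℝ}
    (ht : 0 ≤ t) (hφ : enorm2 (P.varphi j t) ≤ φ) (hb : b * (1 + c ^ 2) ≤ c₃)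
    (hc₃ : P.M j + enorm2 (vecG (P.s j) P.γ) * P.M j + P.kα * P.M j * (c + φ) ≤ c₃)
    {ν : NuSpace (P.s j)} (hν : ‖ν‖ ≤ c) (ω : ℝ) :
    deriv (fun τ => U τ ν) t + fderiv ℝ (U t) ν (P.nuField j t ν ω) ≤
      -‖ν‖ ^ 2 + c₃ ^ 2 * (‖ν‖ * |ω|) := by
  have h1 := h.decay t ht ν
  have h2 : fderiv ℝ (U t) ν (P.nuField j t ν ω) = fderiv ℝ (U t) ν (P.nuField j t ν 0) +
      fderiv ℝ (U t) ν (P.nuField j t ν ω - P.nuField j t ν 0) := by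
    rw [← map_add, add_sub_cancel]
  have hb0 := h.b_pos
  have h3 : ‖fderiv ℝ (U t) ν‖ ≤ c₃ * ‖ν‖ := by
    refine (h.grad_le t ht ν).trans ?_
    have h4 : ‖ν‖ ^ 2 ≤ c ^ 2 := by gcongr
    have h5 : b * (1 + ‖ν‖ ^ 2) ≤ c₃ := le_trans (by gcongr) hb
    have h6 := mul_le_mul_of_nonneg_right h5 (norm_nonneg ν)
    linarith
  have h4 := P.norm_nuField_sub_le j hφ hc₃ hν ω
  have h5 : fderiv ℝ (U t) ν (P.nuField j t ν ω - P.nuField j t ν 0) ≤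
      (c₃ * ‖ν‖) * (c₃ * |ω|) := by
    refine (le_abs_self _).trans
      (((fderiv ℝ (U t) ν).le_opNorm (P.nuField j t ν ω - P.nuField j t ν 0)).trans ?_)
    exact mul_le_mul h3 h4 (norm_nonneg _) ((norm_nonneg _).trans h3)
  rw [h2]
  linarith

theorem IsGainConst.one_lt {P : Network N} {b φ : N → ℝ} {c c₂ c₃ : ℝ}
    (h : P.IsGainConst b φ c c₂ c₃) (hc : 0 < c) (j : N) (hφ : 0 ≤ φ j) : 1 < c₃ := by
  have hR := P.one_le_enorm2_R j
  have h1 := h.c2_ge j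
  have h2 : 0 ≤ enorm2 (P.R j) * φ j := mul_nonneg (by linarith) hφ
  have h3 := enorm2_nonneg (Matrix.vecMul (P.R j) (matA (P.s j) (P.α j)))
  have h4 := h.c3_ge_rho
  nlinarith

/-- In (n, w) the form has cross coefficient b = c₃² + 1/(2 c₃) and a = (1 + 2 c₃⁶)/(4 c₃²), and 4a
- b² = ((c₃³ - 1/2)² + 1/2)/c₃² is positive. -/
theorem exists_dissipation_rate {c₃ : ℝ} (hc : 1 < c₃) : ∃ ε : ℝ, 0 < ε ∧
    ∀ δ n w : ℝ, (1 + 2 * c₃ ^ 6) / 2 ≤ δ → 1 / (2 * c₃ ^ 2) * (c₃ * (n * w) - δ * w ^ 2)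
      + (-n ^ 2 + c₃ ^ 2 * (n * w)) ≤ -(ε * (n ^ 2 + w ^ 2)) := by
  have hc0 : 0 < c₃ := by linarith
  obtain ⟨ε, hε, h⟩ := exists_pos_neg_definite
    (a := (1 + 2 * c₃ ^ 6) / 2 / (2 * c₃ ^ 2)) (b := c₃ ^ 2 + 1 / (2 * c₃)) (by positivity) (by
      have e : 4 * ((1 + 2 * c₃ ^ 6) / 2 / (2 * c₃ ^ 2)) - (c₃ ^ 2 + 1 / (2 * c₃)) ^ 2 =
          ((c₃ ^ 3 - 1 / 2) ^ 2 + 1 / 2) / c₃ ^ 2 := by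
        field_simp
        ring
      have : 0 < ((c₃ ^ 3 - 1 / 2) ^ 2 + 1 / 2) / c₃ ^ 2 := by positivity
      linarith)
  refine ⟨ε, hε, fun δ n w hδ => le_trans ?_ (h n w)⟩
  have h1 : 1 / (2 * c₃ ^ 2) * (c₃ * (n * w) - δ * w ^ 2) ≤
      1 / (2 * c₃ ^ 2) * (c₃ * (n * w) - (1 + 2 * c₃ ^ 6) / 2 * w ^ 2) := by
    gcongr
  have h2 : 1 / (2 * c₃ ^ 2) * (c₃ * (n * w) - (1 + 2 * c₃ ^ 6) / 2 * w ^ 2) =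
      1 / (2 * c₃) * (n * w) - (1 + 2 * c₃ ^ 6) / 2 / (2 * c₃ ^ 2) * w ^ 2 := by
    field_simp
  linarith

end Network

/-! ### Bounded functions and bounded functions with bounded derivative. -/

/-- Boundedness on `[0, ∞)`. -/
def BddOn (h : ℝ → ℝ) : Prop := ∃ C, ∀ t, 0 ≤ t → |h t| ≤ C

namespace BddOn

variable {f g : ℝ → ℝ}

theorem const (c : ℝ) : BddOn fun _ => c := ⟨|c|, fun _ _ => le_rfl⟩

theorem add (hf : BddOn f) (hg : BddOn g) : BddOn fun t => f t + g t := by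
  obtain ⟨C, hC⟩ := hf
  obtain ⟨D, hD⟩ := hg
  exact ⟨C + D, fun t ht => (abs_add_le _ _).trans (add_le_add (hC t ht) (hD t ht))⟩

theorem mul (hf : BddOn f) (hg : BddOn g) : BddOn fun t => f t * g t := by
  obtain ⟨C, hC⟩ := hf
  obtain ⟨D, hD⟩ := hg
  refine ⟨C * D, fun t ht => ?_⟩
  rw [abs_mul]
  exact mul_le_mul (hC t ht) (hD t ht) (abs_nonneg _) ((abs_nonneg _).trans (hC t ht))

theorem neg (hf : BddOn f) : BddOn fun t => -f t := by
  simpa using (const (-1)).mul hf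

theorem sub (hf : BddOn f) (hg : BddOn g) : BddOn fun t => f t - g t := by
  simpa [sub_eq_add_neg] using hf.add hg.neg

theorem div_const (hf : BddOn f) (c : ℝ) : BddOn fun t => f t / c := by
  simpa [div_eq_mul_inv] using hf.mul (const c⁻¹)

theorem sum {ι : Type*} {f : ι → ℝ → ℝ} (s : Finset ι) (hf : ∀ i, BddOn (f i)) :
    BddOn fun t => ∑ i ∈ s, f i t := by
  choose C hC using hf
  exact ⟨∑ i ∈ s, C i, fun t ht => (Finset.abs_sum_le_sum_abs _ _).trans
    (Finset.sum_le_sum fun i _ => hC i t ht)⟩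

theorem ite (p : Prop) [Decidable p] (hf : BddOn f) : BddOn fun t => if p then f t else 0 := by
  split_ifs
  · exact hf
  · exact const 0

end BddOn

/-- Bounded functions on `[0, ∞)` with bounded derivative. -/
def TameOn (h : ℝ → ℝ) : Prop :=
  BddOn h ∧ ∃ h' : ℝ → ℝ, BddOn h' ∧ ∀ t, 0 ≤ t → HasDerivWithinAt h (h' t) (Set.Ici 0) t

namespace TameOn

variable {f g : ℝ → ℝ}

theorem const (c : ℝ) : TameOn fun _ => c :=
  ⟨BddOn.const c, fun _ => 0, BddOn.const 0, fun _ _ => hasDerivWithinAt_const _ _ _⟩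

theorem add (hf : TameOn f) (hg : TameOn g) : TameOn fun t => f t + g t := by
  obtain ⟨h1, f', h2, h3⟩ := hf
  obtain ⟨k1, g', k2, k3⟩ := hg
  exact ⟨h1.add k1, _, h2.add k2, fun t ht => (h3 t ht).add (k3 t ht)⟩

theorem mul (hf : TameOn f) (hg : TameOn g) : TameOn fun t => f t * g t := by
  obtain ⟨h1, f', h2, h3⟩ := hf
  obtain ⟨k1, g', k2, k3⟩ := hg
  exact ⟨h1.mul k1, _, (h2.mul k1).add (h1.mul k2), fun t ht => (h3 t ht).mul (k3 t ht)⟩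

theorem neg (hf : TameOn f) : TameOn fun t => -f t := by
  simpa using (const (-1)).mul hf

theorem sub (hf : TameOn f) (hg : TameOn g) : TameOn fun t => f t - g t := by
  simpa [sub_eq_add_neg] using hf.add hg.neg

theorem div_const (hf : TameOn f) (c : ℝ) : TameOn fun t => f t / c := by
  simpa [div_eq_mul_inv] using hf.mul (const c⁻¹)

theorem sum {ι : Type*} {f : ι → ℝ → ℝ} (s : Finset ι) (hf : ∀ i, TameOn (f i)) :
    TameOn fun t => ∑ i ∈ s, f i t := by
  classical
  induction s using Finset.induction_on with
  | empty => simpa using const 0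
  | insert i s hi ih => simpa [Finset.sum_insert hi] using (hf i).add ih

theorem ite (p : Prop) [Decidable p] (hf : TameOn f) : TameOn fun t => if p then f t else 0 := by
  split_ifs
  · exact hf
  · exact const 0

theorem lipschitz (hf : TameOn f) :
    ∃ L : ℝ, ∀ s t, 0 ≤ s → 0 ≤ t → |f s - f t| ≤ L * |s - t| := by
  obtain ⟨-, f', ⟨C, hC⟩, hf'⟩ := hf
  exact ⟨C, fun s t hs ht => (convex_Ici 0).norm_image_sub_le_of_norm_hasDerivWithin_le
    (fun x hx => hf' x hx) (fun x hx => hC x hx) ht hs⟩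

end TameOn

/-! ### The derivative of `V` along the closed loop. -/

namespace Network

variable {N : Type*} [Fintype N] [DecidableEq N] (P : Network N)

section Components

variable {x : ℝ → P.State} {x' : P.State} {s : Set ℝ} {t : ℝ}

theorem hasDerivWithinAt_θ (h : HasDerivWithinAt x x' s t) (e : {e // e ∈ P.E}) :
    HasDerivWithinAt (fun τ => (x τ).1 e) (x'.1 e) s t := by
  have h1 := ((ContinuousLinearMap.proj (R := ℝ) (φ := fun _ : {e // e ∈ P.E} => ℝ) e).comp
    (ContinuousLinearMap.fst ℝ _ _)).hasFDerivAt.comp_hasDerivWithinAt t h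
  exact h1

theorem hasDerivWithinAt_ω (h : HasDerivWithinAt x x' s t) (j : N) :
    HasDerivWithinAt (fun τ => (x τ).2.1 j) (x'.2.1 j) s t := by
  have h1 := ((ContinuousLinearMap.proj (R := ℝ) (φ := fun _ : N => ℝ) j).comp
    ((ContinuousLinearMap.fst ℝ _ _).comp
      (ContinuousLinearMap.snd ℝ _ _))).hasFDerivAt.comp_hasDerivWithinAt t h
  exact h1

theorem hasDerivWithinAt_μ (h : HasDerivWithinAt x x' s t) (j : N) :
    HasDerivWithinAt (fun τ => (x τ).2.2.1 j) (x'.2.2.1 j) s t := by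
  have h1 := ((ContinuousLinearMap.proj (R := ℝ) (φ := fun _ : N => ℝ) j).comp
    ((ContinuousLinearMap.fst ℝ _ _).comp ((ContinuousLinearMap.snd ℝ _ _).comp
      (ContinuousLinearMap.snd ℝ _ _)))).hasFDerivAt.comp_hasDerivWithinAt t h
  exact h1

theorem hasDerivWithinAt_ν (h : HasDerivWithinAt x x' s t) (j : N) :
    HasDerivWithinAt (fun τ => (x τ).2.2.2 j) (x'.2.2.2 j) s t := by
  have h1 := ((ContinuousLinearMap.proj (R := ℝ) (φ := fun j : N => NuSpace (P.s j)) j).comp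
    ((ContinuousLinearMap.snd ℝ _ _).comp ((ContinuousLinearMap.snd ℝ _ _).comp
      (ContinuousLinearMap.snd ℝ _ _)))).hasFDerivAt.comp_hasDerivWithinAt t h
  exact h1

end Components

/-- The chain rule splits the total derivative into the two partial derivatives used by
`IsSubLyapunov`. -/
theorem hasDerivWithinAt_comp_curve {E : Type*} [NormedAddCommGroup E] [NormedSpace ℝ E]
    {U : ℝ → E → ℝ} (hU : ContDiff ℝ 1 fun p : ℝ × E => U p.1 p.2) {ν : ℝ → E} {ν' : E}
    {s : Set ℝ} {t : ℝ} (hν : HasDerivWithinAt ν ν' s t) :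
    HasDerivWithinAt (fun τ => U τ (ν τ))
      (deriv (fun τ => U τ (ν t)) t + fderiv ℝ (U t) (ν t) ν') s t := by
  have hG : HasFDerivAt (fun p : ℝ × E => U p.1 p.2)
      (fderiv ℝ (fun p : ℝ × E => U p.1 p.2) (t, ν t)) (t, ν t) :=
    (hU.differentiable one_ne_zero _).hasFDerivAt
  set G := fderiv ℝ (fun p : ℝ × E => U p.1 p.2) (t, ν t) with hGdef
  have h1 : HasDerivAt (fun τ => U τ (ν t)) (G (1, 0)) t := by
    have := HasFDerivAt.comp_hasDerivAt t (f := fun τ => (τ, ν t)) hG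
      ((hasDerivAt_id' t).prodMk (hasDerivAt_const t (ν t)))
    exact this
  have h2 : HasFDerivAt (U t) (G.comp (ContinuousLinearMap.inr ℝ ℝ E)) (ν t) :=
    hG.comp (ν t) (hasFDerivAt_prodMk_right t (ν t))
  have h3 : HasDerivWithinAt (fun τ => U τ (ν τ)) (G (1, ν')) s t := by
    have := HasFDerivAt.comp_hasDerivWithinAt t (f := fun τ => (τ, ν τ)) hG
      ((hasDerivWithinAt_id t s).prodMk hν)
    exact this
  refine h3.congr_deriv ?_
  rw [h1.deriv, h2.fderiv, ContinuousLinearMap.comp_apply, ContinuousLinearMap.inr_apply, ← map_add]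
  simp

theorem V1_nonneg (xs x : P.State) : 0 ≤ P.V1 xs x := by
  have h1 : 0 ≤ ∑ e : {e // e ∈ P.E}, P.B e.1 * (x.1 e - xs.1 e) ^ 2 :=
    Finset.sum_nonneg fun e _ => mul_nonneg (P.B_pos _ e.2).le (sq_nonneg _)
  have h2 : 0 ≤ ∑ j, P.M j * (x.2.1 j - xs.2.1 j) ^ 2 :=
    Finset.sum_nonneg fun j _ => mul_nonneg (P.M_pos j).le (sq_nonneg _)
  have h3 : 0 ≤ ∑ j, (x.2.2.1 j - xs.2.2.1 j) ^ 2 := Finset.sum_nonneg fun j _ => sq_nonneg _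
  unfold V1
  positivity

/-- The derivative of `V` at `(t, x)` in the direction `(1, x')`. -/
def dV (U : ∀ j, ℝ → NuSpace (P.s j) → ℝ) (c3 : ℝ) (xs : P.State) (t : ℝ) (x x' : P.State) : ℝ :=
  1 / (2 * c3 ^ 2) * ((∑ e : {e // e ∈ P.E}, P.B e.1 * (x.1 e - xs.1 e) * x'.1 e)
    + (∑ j, P.M j * (x.2.1 j - xs.2.1 j) * x'.2.1 j)
    + ∑ j, (x.2.2.1 j - xs.2.2.1 j) * x'.2.2.1 j)
  + ∑ j, (deriv (fun τ => U j τ (x.2.2.2 j)) t + fderiv ℝ (U j t) (x.2.2.2 j) (x'.2.2.2 j))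

theorem hasDerivWithinAt_V {U : ∀ j, ℝ → NuSpace (P.s j) → ℝ}
    (hU : ∀ j, ContDiff ℝ 1 fun p : ℝ × NuSpace (P.s j) => U j p.1 p.2) (c3 : ℝ) (xs : P.State)
    {x : ℝ → P.State} {x' : P.State} {s : Set ℝ} {t : ℝ} (hx : HasDerivWithinAt x x' s t) :
    HasDerivWithinAt (fun τ => P.V U c3 xs τ (x τ)) (P.dV U c3 xs t (x t) x') s t := by
  have h1 : HasDerivWithinAt (fun τ => ∑ e : {e // e ∈ P.E}, P.B e.1 * ((x τ).1 e - xs.1 e) ^ 2)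
      (∑ e : {e // e ∈ P.E}, P.B e.1 * (2 * ((x t).1 e - xs.1 e) * x'.1 e)) s t :=
    HasDerivWithinAt.fun_sum fun e _ => by
      have := ((P.hasDerivWithinAt_θ hx e).sub_const (xs.1 e)).pow 2
      exact (this.const_mul (P.B e.1)).congr_deriv (by simp)
  have h2 : HasDerivWithinAt (fun τ => ∑ j, P.M j * ((x τ).2.1 j - xs.2.1 j) ^ 2)
      (∑ j, P.M j * (2 * ((x t).2.1 j - xs.2.1 j) * x'.2.1 j)) s t :=
    HasDerivWithinAt.fun_sum fun j _ => by
      have := ((P.hasDerivWithinAt_ω hx j).sub_const (xs.2.1 j)).pow 2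
      exact (this.const_mul (P.M j)).congr_deriv (by simp)
  have h3 : HasDerivWithinAt (fun τ => ∑ j, ((x τ).2.2.1 j - xs.2.2.1 j) ^ 2)
      (∑ j, 2 * ((x t).2.2.1 j - xs.2.2.1 j) * x'.2.2.1 j) s t :=
    HasDerivWithinAt.fun_sum fun j _ => by
      have := ((P.hasDerivWithinAt_μ hx j).sub_const (xs.2.2.1 j)).pow 2
      exact this.congr_deriv (by simp)
  have h4 : HasDerivWithinAt (fun τ => ∑ j, U j τ ((x τ).2.2.2 j)) (∑ j,
      (deriv (fun τ => U j τ ((x t).2.2.2 j)) t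
        + fderiv ℝ (U j t) ((x t).2.2.2 j) (x'.2.2.2 j))) s t :=
    HasDerivWithinAt.fun_sum fun j _ =>
      hasDerivWithinAt_comp_curve (hU j) (P.hasDerivWithinAt_ν hx j)
  have h5 := ((((h1.add h2).add h3).const_mul (1 / 2)).const_mul (1 / (2 * c3 ^ 2))).add h4
  refine h5.congr_deriv ?_
  rw [dV]
  congr 2
  simp only [mul_add, Finset.mul_sum]
  congr 1
  · congr 1
    · exact Finset.sum_congr rfl fun e _ => by ring
    · exact Finset.sum_congr rfl fun e _ => by ring
  · exact Finset.sum_congr rfl fun e _ => by ring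

/-- The power balance along the closed loop. -/
theorem power_balance {d : N → ℝ} {xs : P.State} (hxs : P.IsEquilibrium d xs) (t : ℝ)
    (x : P.State) :
    (∑ e : {e // e ∈ P.E}, P.B e.1 * (x.1 e - xs.1 e) * (P.field d t x).1 e)
    + (∑ j, P.M j * (x.2.1 j - xs.2.1 j) * (P.field d t x).2.1 j)
    + ∑ j, (x.2.2.1 j - xs.2.2.1 j) * (P.field d t x).2.2.1 j =
    ∑ j, (x.2.1 j * P.rho j t (x.2.2.2 j) - (d j + P.D j) * x.2.1 j ^ 2)
      - ∑ j, x.2.2.1 j * P.commLap x.2.2.1 j := by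
  obtain ⟨-, hω, -, hμ, hbal⟩ := (P.isEquilibrium_iff d xs).1 hxs
  have h1 : ∑ e : {e // e ∈ P.E}, P.B e.1 * (x.1 e - xs.1 e) * (P.field d t x).1 e =
      -∑ j, x.2.1 j * P.flow (x.1 - xs.1) j := by
    rw [sum_mul_flow, neg_neg]
    rfl
  have h2 : ∀ j, P.M j * (x.2.1 j - xs.2.1 j) * (P.field d t x).2.1 j =
      (x.2.1 j * P.rho j t (x.2.2.2 j) - (d j + P.D j) * x.2.1 j ^ 2)
      + x.2.1 j * P.flow (x.1 - xs.1) j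
      - (x.2.2.1 j - xs.2.2.1 j) * (x.2.1 j / P.β j) := fun j => by
    have hM := (P.M_pos j).ne'
    have h3 : P.Pbar j = xs.2.2.1 j / P.β j - P.flow xs.1 j := by linarith [hbal j]
    rw [field_ω, hω, h3, map_sub, Pi.sub_apply, Pi.zero_apply, sub_zero]
    field_simp
    ring
  -- Equilibrium prices are equal, hence orthogonal to the range of the Laplacian.
  have h4 : ∑ j, xs.2.2.1 j * P.commLap x.2.2.1 j = 0 := by
    rw [sum_mul_commLap]
    have h0 : ∀ i j, xs.2.2.1 i - xs.2.2.1 j = 0 := fun i j => sub_eq_zero.2 (hμ i j)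
    simp [h0]
  have h5 : ∀ j, (x.2.2.1 j - xs.2.2.1 j) * (P.field d t x).2.2.1 j =
      -(x.2.2.1 j * P.commLap x.2.2.1 j) + xs.2.2.1 j * P.commLap x.2.2.1 j
      + (x.2.2.1 j - xs.2.2.1 j) * (x.2.1 j / P.β j) := fun j => by
    rw [field_μ]
    ring
  simp only [h1, h2, h5, Finset.sum_add_distrib, Finset.sum_sub_distrib, Finset.sum_neg_distrib, h4]
  ring

/-- The dissipation of the closed loop. -/
def dissip (ε κ : ℝ) (x : P.State) : ℝ :=
  ε * ∑ j, (‖x.2.2.2 j‖ ^ 2 + x.2.1 j ^ 2) + κ * ∑ j, x.2.2.1 j * P.commLap x.2.2.1 j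

theorem sum_mul_commLap_nonneg (μ : N → ℝ) : 0 ≤ ∑ j, μ j * P.commLap μ j := by
  classical
  rw [sum_mul_commLap]
  refine mul_nonneg (by norm_num) (Finset.sum_nonneg fun j _ => Finset.sum_nonneg fun k _ => ?_)
  split_ifs
  · exact mul_self_nonneg _
  · exact le_rfl

/-- The power balance decouples into the price Laplacian and one quadratic form in (‖ν_j‖, |ω_j|)
per node. -/
theorem exists_dV_le {d : N → ℝ} {xs : P.State} (hxs : P.IsEquilibrium d xs)
    {U : ∀ j, ℝ → NuSpace (P.s j) → ℝ} {Ulow Uup : ∀ j, NuSpace (P.s j) → ℝ} {b : N → ℝ}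
    (hU : ∀ j, P.IsSubLyapunov j (U j) (Ulow j) (Uup j) (b j)) {φ : N → ℝ}
    (hφ : ∀ j t, 0 ≤ t → enorm2 (P.varphi j t) ≤ φ j) {c c₂ c₃ : ℝ} (hc : 0 < c)
    (hgain : P.IsGainConst b φ c c₂ c₃) (hd : P.AssumptionA1 d c₃) :
    ∃ ε : ℝ, 0 < ε ∧ ∀ t x, 0 ≤ t → (∀ j, ‖x.2.2.2 j‖ ≤ c) →
      P.dV U c₃ xs t x (P.field d t x) ≤ -P.dissip ε (1 / (2 * c₃ ^ 2)) x := by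
  obtain ⟨j0⟩ := P.H_connected.nonempty
  have hc1 : 1 < c₃ := hgain.one_lt hc j0 ((enorm2_nonneg _).trans (hφ j0 0 le_rfl))
  obtain ⟨ε, hε, h⟩ := exists_dissipation_rate hc1
  refine ⟨ε, hε, fun t x ht hν => ?_⟩
  rw [dV, P.power_balance hxs, dissip]
  have h1 : ∀ j, 1 / (2 * c₃ ^ 2) *
      (x.2.1 j * P.rho j t (x.2.2.2 j) - (d j + P.D j) * x.2.1 j ^ 2) +
      (deriv (fun τ => U j τ (x.2.2.2 j)) t
        + fderiv ℝ (U j t) (x.2.2.2 j) ((P.field d t x).2.2.2 j)) ≤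
      -(ε * (‖x.2.2.2 j‖ ^ 2 + x.2.1 j ^ 2)) := by
    intro j
    have hδ : (1 + 2 * c₃ ^ 6) / 2 ≤ d j + P.D j := by
      have := (le_max_left _ _).trans (hd j).le
      linarith
    have h2 := (hU j).decay_input ht (hφ j t ht) (hgain.c3_ge_grad j) (hgain.c3_ge_input j)
      (hν j) (x.2.1 j)
    have h3 := P.abs_rho_le j (hφ j t ht) (hgain.c2_ge j) hgain.c3_ge_rho (hν j)
    have h4 : x.2.1 j * P.rho j t (x.2.2.2 j) ≤ c₃ * (‖x.2.2.2 j‖ * |x.2.1 j|) := by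
      refine (le_abs_self _).trans ?_
      rw [abs_mul]
      have := mul_le_mul_of_nonneg_left h3 (abs_nonneg (x.2.1 j))
      linarith
    have h5 := h (d j + P.D j) ‖x.2.2.2 j‖ |x.2.1 j| hδ
    rw [sq_abs] at h5
    rw [field_ν]
    have h6 : 1 / (2 * c₃ ^ 2) *
        (x.2.1 j * P.rho j t (x.2.2.2 j) - (d j + P.D j) * x.2.1 j ^ 2) ≤
        1 / (2 * c₃ ^ 2) * (c₃ * (‖x.2.2.2 j‖ * |x.2.1 j|) - (d j + P.D j) * x.2.1 j ^ 2) := by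
      gcongr
    linarith
  have h2 := Finset.sum_le_sum fun j (_ : j ∈ Finset.univ) => h1 j
  rw [Finset.sum_add_distrib, ← Finset.mul_sum, Finset.sum_neg_distrib, ← Finset.mul_sum] at h2
  linarith

/-- The velocity of θ̃ is always an angle difference. A functional separating θ̃(t) from that
subspace would be constant along the trajectory and zero at time 0. -/
theorem Admissible.of_isTrajectory {P : Network N} {d : N → ℝ} {x : ℝ → P.State}
    (hx : P.IsTrajectory d x) {t : ℝ} (ht : 0 ≤ t) : P.Admissible (x t) := by
  rw [admissible_iff]
  obtain ⟨θ0, hθ0⟩ := (P.admissible_iff _).1 hx.1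
  by_contra hne
  have hmem : (x t).1 ∉ LinearMap.range P.angleDiff := fun ⟨θ, h⟩ => hne ⟨θ, h.symm⟩
  obtain ⟨f, hf, hle⟩ := Submodule.exists_le_ker_of_notMem hmem
  have hker : ∀ θ, f (P.angleDiff θ) = 0 := fun θ => hle ⟨θ, rfl⟩
  set F := (LinearMap.toContinuousLinearMap f).comp (ContinuousLinearMap.fst ℝ _ _ :
    P.State →L[ℝ] ({e // e ∈ P.E} → ℝ)) with hF
  have hd : ∀ τ, 0 ≤ τ → HasDerivWithinAt (fun τ => F (x τ)) 0 (Set.Ici 0) τ := fun τ hτ => by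
    refine (F.hasFDerivAt.comp_hasDerivWithinAt τ (hx.2 τ hτ)).congr_deriv ?_
    exact hker _
  have h1 := constant_of_has_deriv_right_zero (f := fun τ => F (x τ)) (a := 0) (b := t)
    (fun τ hτ => ((hd τ hτ.1).continuousWithinAt).mono Set.Icc_subset_Ici_self)
    (fun τ hτ => (hd τ hτ.1).mono (Set.Ici_subset_Ici.2 hτ.1)) t ⟨ht, le_rfl⟩
  refine hf ?_
  have h2 : F (x t) = f (x t).1 := rfl
  have h3 : F (x 0) = f (x 0).1 := rfl
  rw [← h2, h1, h3, hθ0, hker]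

end Network

/-! ### Forward invariance of the sublevel set and boundedness. -/

theorem le_of_hasDerivWithinAt_nonpos {f f' : ℝ → ℝ} {a b : ℝ} (ha : 0 ≤ a) (hab : a ≤ b)
    (hf : ∀ t, 0 ≤ t → HasDerivWithinAt f (f' t) (Set.Ici 0) t)
    (hf' : ∀ t ∈ Set.Icc a b, f' t ≤ 0) : f b ≤ f a := by
  have h1 := (convex_Icc a b).image_sub_le_mul_sub_of_deriv_le (f := f) (C := 0)
    (fun t ht => ((hf t (ha.trans ht.1)).continuousWithinAt).mono fun z hz => ha.trans hz.1)
    (fun t ht => by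
      rw [interior_Icc] at ht
      exact ((hf t (ha.trans ht.1.le)).hasDerivAt
        (Ici_mem_nhds (ha.trans_lt ht.1))).differentiableAt.differentiableWithinAt)
    (fun t ht => by
      rw [interior_Icc] at ht
      rw [((hf t (ha.trans ht.1.le)).hasDerivAt (Ici_mem_nhds (ha.trans_lt ht.1))).deriv]
      exact hf' t ⟨ht.1.le, ht.2.le⟩)
    a (Set.left_mem_Icc.2 hab) b (Set.right_mem_Icc.2 hab) hab
  linarith

theorem eventually_lt_of_hasDerivWithinAt_neg {f : ℝ → ℝ} {f' t : ℝ} {s : Set ℝ}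
    (hs : Set.Ioi t ⊆ s) (hf : HasDerivWithinAt f f' s t) (hf' : f' < 0) :
    ∀ᶠ z in 𝓝[>] t, f z < f t := by
  have h1 := (hasDerivWithinAt_iff_tendsto_slope' (by simp)).1 (hf.mono hs)
  filter_upwards [h1.eventually (gt_mem_nhds hf'), self_mem_nhdsWithin] with z hz hzt
  rw [slope_def_field, div_neg_iff] at hz
  have : 0 < z - t := sub_pos.2 hzt
  rcases hz with hz | hz
  · linarith [hz.2]
  · linarith [hz.1]

theorem BddOn.of_sq {f : ℝ → ℝ} {C : ℝ} (h : ∀ t, 0 ≤ t → f t ^ 2 ≤ C) : BddOn f := by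
  refine ⟨C + 1, fun t ht => ?_⟩
  have h1 := h t ht
  rw [← sq_abs] at h1
  nlinarith [sq_nonneg (|f t| - 1), abs_nonneg (f t)]

theorem BddOn.of_sub_const {f : ℝ → ℝ} {c : ℝ} (h : BddOn fun t => f t - c) : BddOn f := by
  simpa using h.add (BddOn.const c)

theorem BddOn.dotProduct {ι : Type*} [Fintype ι] {f g : ℝ → ι → ℝ}
    (hf : ∀ i, BddOn fun t => f t i) (hg : ∀ i, BddOn fun t => g t i) :
    BddOn fun t => f t ⬝ᵥ g t := by
  unfold _root_.dotProduct
  exact BddOn.sum _ fun i => (hf i).mul (hg i)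

namespace Network

variable {N : Type*} [Fintype N] [DecidableEq N] (P : Network N)

theorem sum_U_le_V (U : ∀ j, ℝ → NuSpace (P.s j) → ℝ) (c₃ : ℝ) (xs : P.State) (t : ℝ)
    (x : P.State) : ∑ j, U j t (x.2.2.2 j) ≤ P.V U c₃ xs t x := by
  have h1 := P.V1_nonneg xs x
  have h2 : 0 ≤ 1 / (2 * c₃ ^ 2) * P.V1 xs x := by positivity
  rw [V]
  linarith

theorem dissip_nonneg {ε κ : ℝ} (hε : 0 ≤ ε) (hκ : 0 ≤ κ) (x : P.State) : 0 ≤ P.dissip ε κ x :=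
  add_nonneg (mul_nonneg hε (Finset.sum_nonneg fun _ _ => by positivity))
    (mul_nonneg hκ (P.sum_mul_commLap_nonneg _))

theorem le_dissip {ε κ : ℝ} (hε : 0 ≤ ε) (hκ : 0 ≤ κ) (x : P.State) (j : N) :
    ε * (‖x.2.2.2 j‖ ^ 2 + x.2.1 j ^ 2) ≤ P.dissip ε κ x := by
  have h1 := mul_nonneg hκ (P.sum_mul_commLap_nonneg x.2.2.1)
  have h2 : ε * (‖x.2.2.2 j‖ ^ 2 + x.2.1 j ^ 2) ≤
      ε * ∑ j, (‖x.2.2.2 j‖ ^ 2 + x.2.1 j ^ 2) := by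
    refine mul_le_mul_of_nonneg_left ?_ hε
    exact Finset.single_le_sum (f := fun j => ‖x.2.2.2 j‖ ^ 2 + x.2.1 j ^ 2)
      (fun _ _ => by positivity) (Finset.mem_univ j)
  rw [dissip]
  linarith

/-- A sublevel set of `V` on which `V` decays is forward invariant. -/
theorem V_le_of_isTrajectory {d : N → ℝ} {xs : P.State} {U : ∀ j, ℝ → NuSpace (P.s j) → ℝ}
    (hU : ∀ j, ContDiff ℝ 1 fun p : ℝ × NuSpace (P.s j) => U j p.1 p.2) {C c c₃ ε κ : ℝ}
    (hc : 0 < c) (hsub : ∀ t, 0 ≤ t → ∀ ν : ∀ j, NuSpace (P.s j),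
      ∑ j, U j t (ν j) ≤ C → ∀ j, ‖ν j‖ ≤ c) (hε : 0 < ε) (hκ : 0 ≤ κ)
    (hdV : ∀ t x, 0 ≤ t → (∀ j, ‖x.2.2.2 j‖ ≤ c) →
      P.dV U c₃ xs t x (P.field d t x) ≤ -P.dissip ε κ x)
    {x : ℝ → P.State} (hx : P.IsTrajectory d x) (h0 : P.V U c₃ xs 0 (x 0) ≤ C) {t : ℝ}
    (ht : 0 ≤ t) : P.V U c₃ xs t (x t) ≤ C := by
  have hd : ∀ t, 0 ≤ t → HasDerivWithinAt (fun τ => P.V U c₃ xs τ (x τ))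
      (P.dV U c₃ xs t (x t) (P.field d t (x t))) (Set.Ici 0) t := fun t ht =>
    P.hasDerivWithinAt_V hU c₃ xs (hx.2 t ht)
  refine le_of_forall_eventually_le (f := fun τ => P.V U c₃ xs τ (x τ))
    (fun t ht => (hd t ht).continuousWithinAt) h0 (fun t ht hVt => ?_) t ht
  have hν : ∀ j, ‖(x t).2.2.2 j‖ ≤ c :=
    hsub t ht _ ((P.sum_U_le_V U c₃ xs t (x t)).trans hVt)
  -- The decay estimate needs ‖ν_j‖ ≤ c, which V ≤ C gives at time t but not yet afterwards. If all
  -- inequalities are strict they persist briefly, and V does not increase.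
  by_cases hlt : ∀ j, ‖(x t).2.2.2 j‖ < c
  · have h1 : ∀ᶠ z in 𝓝[≥] t, ∀ j, ‖(x z).2.2.2 j‖ < c := by
      rw [eventually_all]
      intro j
      have h2 := ((P.hasDerivWithinAt_ν (hx.2 t ht) j).continuousWithinAt).norm
      exact (h2.mono (Set.Ici_subset_Ici.2 ht)).eventually (gt_mem_nhds (hlt j))
    obtain ⟨u, hu, hsubset⟩ := mem_nhdsGE_iff_exists_Ico_subset.1 h1
    filter_upwards [Ioo_mem_nhdsGT hu] with z hz
    refine (le_of_hasDerivWithinAt_nonpos ht hz.1.le hd fun s hs => ?_).trans hVt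
    have h3 := hdV s (x s) (ht.trans hs.1) fun j => (hsubset ⟨hs.1, hs.2.trans_lt hz.2⟩ j).le
    linarith [P.dissip_nonneg hε.le hκ (x s)]
  -- On the boundary ‖ν_j‖ = c > 0 the derivative of V is strictly negative, so V decreases just
  -- after t.
  · push Not at hlt
    obtain ⟨j, hj⟩ := hlt
    have h1 := hdV t (x t) ht hν
    have h2 := P.le_dissip hε.le hκ (x t) j
    have h3 : 0 < ε * (‖(x t).2.2.2 j‖ ^ 2 + (x t).2.1 j ^ 2) := by
      have : 0 < ‖(x t).2.2.2 j‖ := hc.trans_le hj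
      positivity
    filter_upwards [eventually_lt_of_hasDerivWithinAt_neg
      (fun z (hz : t < z) => ht.trans hz.le) (hd t ht) (by linarith)] with z hz
    exact hz.le.trans hVt

/-- A trajectory all of whose components are bounded. -/
structure BddTrajectory (x : ℝ → P.State) : Prop where
  θ : ∀ e, BddOn fun t => (x t).1 e
  ω : ∀ j, BddOn fun t => (x t).2.1 j
  μ : ∀ j, BddOn fun t => (x t).2.2.1 j
  ν : ∀ j i, BddOn fun t => (x t).2.2.2 j i

section Bounded

variable {P} {x : ℝ → P.State}

theorem BddTrajectory.flow (hb : P.BddTrajectory x) (j : N) :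
    BddOn fun t => P.flow (x t).1 j := by
  simp only [flow_apply]
  exact (BddOn.sum _ fun e => ((BddOn.const _).mul (hb.θ e)).ite _).sub
    (BddOn.sum _ fun e => ((BddOn.const _).mul (hb.θ e)).ite _)

theorem BddTrajectory.vL (hb : P.BddTrajectory x) (j : N) :
    BddOn fun t => P.vL j ((x t).2.2.2 j) := by
  simp only [vL_apply]
  exact (hb.ν j (Sum.inl ())).add
    (BddOn.dotProduct (fun i => BddOn.const _) fun i => hb.ν j (Sum.inr (Sum.inl i)))

theorem BddTrajectory.vecΛ_zeta (hb : P.BddTrajectory x) (j : N) (m : Fin (P.s j)) :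
    BddOn fun t => vecΛ (P.s j) (P.zeta j t ((x t).2.2.2 j)) m := by
  obtain ⟨C, hC⟩ := P.exists_varphi_bound j
  have h1 : BddOn fun t => P.varphi j t ⟨2 * (m : ℕ) + 1, by have := m.isLt; omega⟩ :=
    ⟨C, fun t _ => hC t _⟩
  exact (hb.ν j (Sum.inr (Sum.inl _))).add h1

theorem BddTrajectory.nuField (hb : P.BddTrajectory x) (j : N)
    (i : Unit ⊕ Fin (2 * P.s j + 1) ⊕ Fin (P.s j)) :
    BddOn fun t => P.nuField j t ((x t).2.2.2 j) ((x t).2.1 j) i := by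
  have hω : BddOn fun t => P.M j * (x t).2.1 j := (BddOn.const _).mul (hb.ω j)
  have hv : BddOn fun t => P.vL j ((x t).2.2.2 j) + P.M j * (x t).2.1 j := (hb.vL j).add hω
  rcases i with u | i | m
  · exact (hb.ν j (Sum.inl ())).neg.sub hω
  · have h1 : BddOn fun t => zetaPart (P.nuField j t ((x t).2.2.2 j) ((x t).2.1 j)) i := by
      refine Fin.lastCases ?_ (fun k => ?_) i
      · simp only [zetaPart_nuField_last]
        refine (BddOn.add ?_ ?_).sub ((BddOn.const _).mul hv)
        · exact BddOn.dotProduct (fun m => hb.ν j (Sum.inr (Sum.inr m))) fun m => hb.vecΛ_zeta j m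
        · exact BddOn.dotProduct (fun m => BddOn.const _) fun m =>
            hb.ν j (Sum.inr (Sum.inl ⟨2 * (m : ℕ) + 1, by have := m.isLt; omega⟩))
      · simp only [zetaPart_nuField_castSucc]
        exact (hb.ν j (Sum.inr (Sum.inl k.succ))).sub (hv.mul (BddOn.const _))
    exact h1
  · have h1 : BddOn fun t => alphaPart (P.nuField j t ((x t).2.2.2 j) ((x t).2.1 j)) m := by
      simp only [alphaPart_nuField, Pi.smul_apply, smul_eq_mul]
      exact ((BddOn.const _).mul hv).neg.mul (hb.vecΛ_zeta j m)
    exact h1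

theorem BddTrajectory.rho (hb : P.BddTrajectory x) (j : N) :
    BddOn fun t => P.rho j t ((x t).2.2.2 j) := by
  have hz : ∀ w : Fin (2 * P.s j + 1) → ℝ, BddOn fun t => w ⬝ᵥ zetaPart ((x t).2.2.2 j) :=
    fun w => BddOn.dotProduct (f := fun _ => w) (fun i => BddOn.const _) fun i =>
      hb.ν j (Sum.inr (Sum.inl i))
  have hα : BddOn fun t => alphaPart ((x t).2.2.2 j) ⬝ᵥ
      vecΛ (P.s j) (P.zeta j t ((x t).2.2.2 j)) :=
    BddOn.dotProduct (fun m => hb.ν j (Sum.inr (Sum.inr m))) fun m => hb.vecΛ_zeta j m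
  simp only [rho_eq]
  exact ((hz _).neg.sub (hz _)).sub hα

variable {d : N → ℝ}

theorem BddTrajectory.tame_θ (hb : P.BddTrajectory x) (hx : P.IsTrajectory d x)
    (e : {e // e ∈ P.E}) : TameOn fun t => (x t).1 e :=
  ⟨hb.θ e, _, (hb.ω e.1.1).sub (hb.ω e.1.2), fun t ht => P.hasDerivWithinAt_θ (hx.2 t ht) e⟩

theorem BddTrajectory.tame_ω (hb : P.BddTrajectory x) (hx : P.IsTrajectory d x) (j : N) :
    TameOn fun t => (x t).2.1 j := by
  refine ⟨hb.ω j, fun t => (P.field d t (x t)).2.1 j, ?_,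
    fun t ht => P.hasDerivWithinAt_ω (hx.2 t ht) j⟩
  simp only [field_ω]
  exact (BddOn.const _).mul ((((((BddOn.const _).add (hb.rho j)).add (hb.flow j)).sub
    ((hb.μ j).div_const _)).sub ((BddOn.const _).mul (hb.ω j))).sub
    ((BddOn.const _).mul (hb.ω j)))

theorem BddTrajectory.tame_μ (hb : P.BddTrajectory x) (hx : P.IsTrajectory d x) (j : N) :
    TameOn fun t => (x t).2.2.1 j := by
  classical
  refine ⟨hb.μ j, fun t => (P.field d t (x t)).2.2.1 j, ?_,
    fun t ht => P.hasDerivWithinAt_μ (hx.2 t ht) j⟩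
  simp only [field_μ, commLap]
  exact (BddOn.sum _ fun k => ((hb.μ j).sub (hb.μ k)).ite _).neg.add ((hb.ω j).div_const _)

theorem BddTrajectory.tame_ν (hb : P.BddTrajectory x) (hx : P.IsTrajectory d x) (j : N)
    (i : Unit ⊕ Fin (2 * P.s j + 1) ⊕ Fin (P.s j)) : TameOn fun t => (x t).2.2.2 j i := by
  refine ⟨hb.ν j i, fun t => P.nuField j t ((x t).2.2.2 j) ((x t).2.1 j) i, hb.nuField j i,
    fun t ht => ?_⟩
  have h1 := (EuclideanSpace.proj (𝕜 := ℝ) i).hasFDerivAt.comp_hasDerivWithinAt t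
    (P.hasDerivWithinAt_ν (hx.2 t ht) j)
  exact h1

theorem BddTrajectory.tame_dissip (hb : P.BddTrajectory x) (hx : P.IsTrajectory d x) (ε κ : ℝ) :
    TameOn fun t => P.dissip ε κ (x t) := by
  classical
  have hν : ∀ j, TameOn fun t => ‖(x t).2.2.2 j‖ ^ 2 := fun j => by
    simp only [EuclideanSpace.real_norm_sq_eq, pow_two ((x _).2.2.2 j _)]
    exact TameOn.sum _ fun i => (hb.tame_ν hx j i).mul (hb.tame_ν hx j i)
  have hω : ∀ j, TameOn fun t => (x t).2.1 j ^ 2 := fun j => by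
    simp only [pow_two]
    exact (hb.tame_ω hx j).mul (hb.tame_ω hx j)
  have hL : ∀ j, TameOn fun t => P.commLap (x t).2.2.1 j := fun j => by
    simp only [commLap]
    exact TameOn.sum _ fun k => ((hb.tame_μ hx j).sub (hb.tame_μ hx k)).ite (P.H.Adj j k)
  exact ((TameOn.const _).mul (TameOn.sum _ fun j => (hν j).add (hω j))).add
    ((TameOn.const _).mul (TameOn.sum _ fun j => (hb.tame_μ hx j).mul (hL j)))

theorem BddTrajectory.tame_imbalance (hb : P.BddTrajectory x) (hx : P.IsTrajectory d x) (j : N) :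
    TameOn fun t => P.Pbar j + P.flow (x t).1 j - (x t).2.2.1 j / P.β j := by
  simp only [flow_apply]
  exact ((TameOn.const _).add
    ((TameOn.sum _ fun e => ((TameOn.const _).mul (hb.tame_θ hx e)).ite _).sub
      (TameOn.sum _ fun e => ((TameOn.const _).mul (hb.tame_θ hx e)).ite _))).sub
    ((hb.tame_μ hx j).div_const _)

end Bounded

/-- Since the U_j are nonnegative, V also bounds V₁, which controls θ̃, ω and μ. -/
theorem bddTrajectory_of_V_le {xs : P.State} {U : ∀ j, ℝ → NuSpace (P.s j) → ℝ}
    (hU : ∀ j t, 0 ≤ t → ∀ ν, 0 ≤ U j t ν) {C c c₃ : ℝ} (hc₃ : 0 < c₃) {x : ℝ → P.State}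
    (hV : ∀ t, 0 ≤ t → P.V U c₃ xs t (x t) ≤ C) (hν : ∀ t, 0 ≤ t → ∀ j, ‖(x t).2.2.2 j‖ ≤ c) :
    P.BddTrajectory x := by
  have hV1 : ∀ t, 0 ≤ t → P.V1 xs (x t) ≤ 2 * c₃ ^ 2 * C := fun t ht => by
    have h1 := hV t ht
    have h2 : 0 ≤ ∑ j, U j t ((x t).2.2.2 j) := Finset.sum_nonneg fun j _ => hU j t ht _
    rw [V] at h1
    have h3 : 1 / (2 * c₃ ^ 2) * P.V1 xs (x t) ≤ C := by linarith
    rwa [one_div, inv_mul_le_iff₀ (by positivity)] at h3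
  have n1 : ∀ x : P.State, ∀ e ∈ Finset.univ,
      0 ≤ P.B (e : {e // e ∈ P.E}).1 * (x.1 e - xs.1 e) ^ 2 :=
    fun x e _ => mul_nonneg (P.B_pos _ e.2).le (sq_nonneg _)
  have n2 : ∀ x : P.State, ∀ j ∈ Finset.univ, 0 ≤ P.M j * (x.2.1 j - xs.2.1 j) ^ 2 :=
    fun x j _ => mul_nonneg (P.M_pos j).le (sq_nonneg _)
  have n3 : ∀ x : P.State, ∀ j ∈ Finset.univ, 0 ≤ (x.2.2.1 j - xs.2.2.1 j) ^ 2 :=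
    fun x j _ => sq_nonneg _
  refine ⟨fun e => BddOn.of_sub_const (c := xs.1 e) (BddOn.of_sq
      (C := 2 * (2 * c₃ ^ 2 * C) / P.B e.1) fun t ht => ?_),
    fun j => BddOn.of_sub_const (c := xs.2.1 j) (BddOn.of_sq
      (C := 2 * (2 * c₃ ^ 2 * C) / P.M j) fun t ht => ?_),
    fun j => BddOn.of_sub_const (c := xs.2.2.1 j) (BddOn.of_sq
      (C := 2 * (2 * c₃ ^ 2 * C)) fun t ht => ?_),
    fun j i => ⟨c, fun t ht => ?_⟩⟩
  · have h1 := hV1 t ht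
    rw [V1] at h1
    rw [le_div_iff₀ (P.B_pos _ e.2)]
    have h2 := Finset.single_le_sum (n1 (x t)) (Finset.mem_univ e)
    have h3 := Finset.sum_nonneg (n2 (x t))
    have h4 := Finset.sum_nonneg (n3 (x t))
    linarith
  · have h1 := hV1 t ht
    rw [V1] at h1
    rw [le_div_iff₀ (P.M_pos j)]
    have h2 := Finset.single_le_sum (n2 (x t)) (Finset.mem_univ j)
    have h3 := Finset.sum_nonneg (n1 (x t))
    have h4 := Finset.sum_nonneg (n3 (x t))
    linarith
  · have h1 := hV1 t ht
    rw [V1] at h1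
    have h2 := Finset.single_le_sum (n3 (x t)) (Finset.mem_univ j)
    have h3 := Finset.sum_nonneg (n1 (x t))
    have h4 := Finset.sum_nonneg (n2 (x t))
    linarith
  · exact (PiLp.norm_apply_le ((x t).2.2.2 j) i).trans (hν t ht j)

open Classical in
/-- The residual of the power balance and of the consensus of prices. -/
def residual : LinearMap.range P.angleDiff × (N → ℝ) →ₗ[ℝ] (N → ℝ) × (N → N → ℝ) :=
  LinearMap.prod
    (P.flow ∘ₗ (LinearMap.range P.angleDiff).subtype ∘ₗ LinearMap.fst ℝ _ _
      - (LinearMap.pi fun j => (1 / P.β j) • LinearMap.proj j) ∘ₗ LinearMap.snd ℝ _ _)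
    ((LinearMap.pi fun i => LinearMap.pi fun j => if P.H.Adj i j
      then (LinearMap.proj i : (N → ℝ) →ₗ[ℝ] ℝ) - LinearMap.proj j else 0) ∘ₗ LinearMap.snd ℝ _ _)

theorem residual_fst (u : LinearMap.range P.angleDiff) (μ : N → ℝ) (j : N) :
    (P.residual (u, μ)).1 j = P.flow u.1 j - μ j / P.β j := by
  simp [residual, div_eq_inv_mul]

open Classical in
theorem residual_snd (u : LinearMap.range P.angleDiff) (μ : N → ℝ) (i j : N) :
    (P.residual (u, μ)).2 i j = if P.H.Adj i j then μ i - μ j else 0 := by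
  by_cases h : P.H.Adj i j <;> simp [residual, h]

/-- Flows are restricted to angle differences so that circulating flows are excluded; equal prices
and balance then force both components to vanish. -/
theorem ker_residual : LinearMap.ker P.residual = ⊥ := by
  rw [LinearMap.ker_eq_bot']
  rintro ⟨⟨u, θ, rfl⟩, μ⟩ h
  have h1 : ∀ i j, μ i = μ j := SimpleGraph.Connected.eq_of_forall_adj P.H_connected
    fun i j hij => by
      have h2 := P.residual_snd ⟨_, θ, rfl⟩ μ i j
      rw [h, if_pos hij] at h2
      exact (sub_eq_zero.1 h2.symm)
  obtain ⟨h2, h3⟩ := P.angleDiff_and_price_eq_zero θ μ h1 fun j => by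
    have h4 := P.residual_fst ⟨_, θ, rfl⟩ μ j
    rw [h] at h4
    exact sub_eq_zero.1 h4.symm
  exact Prod.ext (Subtype.ext h2) h3

end Network

/-! ### Convergence to the equilibrium. -/

theorem tendsto_zero_of_sq_le {f g : ℝ → ℝ} {c : ℝ} (hc : 0 < c)
    (h : ∀ᶠ t in atTop, c * f t ^ 2 ≤ g t) (hg : Tendsto g atTop (𝓝 0)) :
    Tendsto f atTop (𝓝 0) := by
  have h1 : Tendsto (fun t => √(g t / c)) atTop (𝓝 0) := by
    have := (Real.continuous_sqrt.tendsto (0 / c)).comp (hg.div_const c)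
    simpa [Function.comp_def] using this
  refine squeeze_zero_norm' ?_ h1
  filter_upwards [h] with t ht
  refine Real.le_sqrt_of_sq_le ?_
  rw [Real.norm_eq_abs, sq_abs, le_div_iff₀ hc]
  linarith

theorem tendsto_zero_of_forall_eventually_abs_le {g : ℝ → ℝ}
    (h1 : ∀ ε, 0 < ε → ∀ᶠ t in atTop, g t ≤ ε) (h2 : ∀ ε, 0 < ε → ∀ᶠ t in atTop, -g t ≤ ε) :
    Tendsto g atTop (𝓝 0) := by
  rw [Metric.tendsto_nhds]
  intro ε hε
  filter_upwards [h1 (ε / 2) (by positivity), h2 (ε / 2) (by positivity)] with t ht1 ht2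
  rw [Real.dist_eq, sub_zero]
  exact (abs_le.2 ⟨by linarith, ht1⟩).trans_lt (by linarith)

/-- Convergence of the dissipation rate of a nonnegative storage function. -/
theorem tendsto_zero_of_hasDerivWithinAt_le_neg {F F' g : ℝ → ℝ}
    (hF : ∀ t, 0 ≤ t → HasDerivWithinAt F (F' t) (Set.Ici 0) t) (hF0 : ∀ t, 0 ≤ t → 0 ≤ F t)
    (hF' : ∀ t, 0 ≤ t → F' t ≤ -g t) (hg0 : ∀ t, 0 ≤ g t) (hg : TameOn g) :
    Tendsto g atTop (𝓝 0) := by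
  -- Freezing F at its value at 0 for negative times gives an antitone function on the whole line,
  -- hence a limit.
  have hanti : Antitone fun t => F (max t 0) := fun a b hab =>
    le_of_hasDerivWithinAt_nonpos (le_max_right _ _) (max_le_max_right 0 hab) hF fun t ht => by
      have := (le_max_right a 0).trans ht.1
      linarith [hF' t this, hg0 t]
  have hbdd : BddBelow (Set.range fun t => F (max t 0)) :=
    ⟨0, by rintro _ ⟨t, rfl⟩; exact hF0 _ (le_max_right _ _)⟩
  have hlim : Tendsto F atTop (𝓝 (⨅ t, F (max t 0))) := by
    refine (tendsto_atTop_ciInf hanti hbdd).congr' ?_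
    filter_upwards [eventually_ge_atTop 0] with t ht
    rw [max_eq_left ht]
  obtain ⟨L, hL⟩ := hg.lipschitz
  refine tendsto_zero_of_forall_eventually_abs_le (fun ε hε => ?_) fun ε hε =>
    Eventually.of_forall fun t => by linarith [hg0 t]
  exact eventually_le_of_deriv_le (h := fun _ => 0) hF hlim (fun t ht => by simpa using hF' t ht)
    tendsto_const_nhds hL hε

/-- If a convergent function has the derivative `g + h` with `g` tame and `h` vanishing at
infinity, then `g` vanishes at infinity. -/
theorem tendsto_zero_of_tendsto_of_hasDerivWithinAt {F g h : ℝ → ℝ} {l : ℝ}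
    (hF : ∀ t, 0 ≤ t → HasDerivWithinAt F (g t + h t) (Set.Ici 0) t)
    (hFl : Tendsto F atTop (𝓝 l)) (hg : TameOn g) (hh : Tendsto h atTop (𝓝 0)) :
    Tendsto g atTop (𝓝 0) := by
  obtain ⟨L, hL⟩ := hg.lipschitz
  obtain ⟨L', hL'⟩ := hg.neg.lipschitz
  refine tendsto_zero_of_forall_eventually_abs_le (fun ε hε => ?_) fun ε hε => ?_
  · exact eventually_le_of_deriv_le (h := fun t => -h t) (fun t ht => (hF t ht).neg) hFl.neg
      (fun t _ => by linarith) (by simpa using hh.neg) hL hε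
  · exact eventually_le_of_deriv_le (h := h) hF hFl (fun t _ => by linarith) hh hL' hε

namespace Network

variable {N : Type*} [Fintype N] [DecidableEq N] {P : Network N} {d : N → ℝ} {x : ℝ → P.State}

theorem sq_sub_le_dissip {ε κ : ℝ} (hε : 0 ≤ ε) (hκ : 0 ≤ κ) (y : P.State) {i j : N}
    (h : P.H.Adj i j) : κ / 2 * (y.2.2.1 i - y.2.2.1 j) ^ 2 ≤ P.dissip ε κ y := by
  classical
  have h0 : 0 ≤ ε * ∑ j, (‖y.2.2.2 j‖ ^ 2 + y.2.1 j ^ 2) :=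
    mul_nonneg hε (Finset.sum_nonneg fun _ _ => by positivity)
  set a : N → N → ℝ := fun i j => if P.H.Adj i j then
    (y.2.2.1 i - y.2.2.1 j) * (y.2.2.1 i - y.2.2.1 j) else 0 with ha
  have hnn : ∀ i j, 0 ≤ a i j := fun i j => by
    rw [ha]
    dsimp only
    split_ifs
    · exact mul_self_nonneg _
    · exact le_rfl
  have h1 : a i j ≤ ∑ i, ∑ j, a i j :=
    (Finset.single_le_sum (fun k _ => hnn i k) (Finset.mem_univ j)).trans
      (Finset.single_le_sum (f := fun i => ∑ j, a i j)
        (fun k _ => Finset.sum_nonneg fun l _ => hnn k l) (Finset.mem_univ i))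
  have h2 : a i j = (y.2.2.1 i - y.2.2.1 j) ^ 2 := by
    rw [ha]
    simp only [if_pos h, pow_two]
  have h3 := mul_le_mul_of_nonneg_left h1 hκ
  rw [h2] at h3
  rw [dissip, sum_mul_commLap]
  have h4 : κ * (1 / 2 * ∑ i, ∑ j, a i j) = (κ * ∑ i, ∑ j, a i j) / 2 := by ring
  have h5 : ∑ j, ∑ k, (if P.H.Adj j k then
    (y.2.2.1 j - y.2.2.1 k) * (y.2.2.1 j - y.2.2.1 k) else 0) = ∑ i, ∑ j, a i j := rfl
  linarith

/-- The net power at every node is balanced in the limit. -/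
theorem tendsto_imbalance (hb : P.BddTrajectory x) (hx : P.IsTrajectory d x)
    (hω : ∀ j, Tendsto (fun t => (x t).2.1 j) atTop (𝓝 0))
    (hρ : ∀ j, Tendsto (fun t => P.rho j t ((x t).2.2.2 j)) atTop (𝓝 0)) (j : N) :
    Tendsto (fun t => P.Pbar j + P.flow (x t).1 j - (x t).2.2.1 j / P.β j) atTop (𝓝 0) := by
  -- M_j ω_j converges and its derivative is the static imbalance plus ρ_j and damping, which vanish
  -- in the limit.
  refine tendsto_zero_of_tendsto_of_hasDerivWithinAt (F := fun t => P.M j * (x t).2.1 j)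
    (h := fun t => P.rho j t ((x t).2.2.2 j) - d j * (x t).2.1 j - P.D j * (x t).2.1 j)
    (fun t ht => ?_) ((hω j).const_mul (P.M j)) (hb.tame_imbalance hx j) ?_
  · refine ((P.hasDerivWithinAt_ω (hx.2 t ht) j).const_mul (P.M j)).congr_deriv ?_
    have := (P.M_pos j).ne'
    rw [field_ω]
    field_simp
    ring
  · simpa using ((hρ j).sub ((hω j).const_mul (d j))).sub ((hω j).const_mul (P.D j))

/-- Bounded trajectories with vanishing frequency deviation, internal-model state, price
differences and imbalance converge to the equilibrium. -/
theorem tendsto_equilibrium {xs : P.State} (hxs : P.IsEquilibrium d xs) (hx : P.IsTrajectory d x)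
    (hω : ∀ j, Tendsto (fun t => (x t).2.1 j) atTop (𝓝 0))
    (hν : ∀ j, Tendsto (fun t => (x t).2.2.2 j) atTop (𝓝 0))
    (hμ : ∀ i j, P.H.Adj i j → Tendsto (fun t => (x t).2.2.1 i - (x t).2.2.1 j) atTop (𝓝 0))
    (himb : ∀ j, Tendsto (fun t => P.Pbar j + P.flow (x t).1 j - (x t).2.2.1 j / P.β j)
      atTop (𝓝 0)) : Tendsto x atTop (𝓝 xs) := by
  classical
  obtain ⟨hadm, hω0, hν0, hμ0, hbal⟩ := (P.isEquilibrium_iff d xs).1 hxs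
  obtain ⟨θs, hθs⟩ := (P.admissible_iff _).1 hadm
  have hmem : ∀ t, 0 ≤ t → (x t).1 - xs.1 ∈ LinearMap.range P.angleDiff := fun t ht => by
    obtain ⟨θ, hθ⟩ := (P.admissible_iff _).1 (Admissible.of_isTrajectory hx ht)
    exact ⟨θ - θs, by rw [map_sub, hθ, hθs]⟩
  obtain ⟨c, hc, hle⟩ := LinearMap.exists_pos_mul_norm_le P.residual P.ker_residual
  -- Membership in the subspace is known for t ≥ 0; the value 0 elsewhere does not affect the limit.
  set u : ℝ → LinearMap.range P.angleDiff := fun t =>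
    if ht : 0 ≤ t then ⟨(x t).1 - xs.1, hmem t ht⟩ else 0 with hu
  have hu' : ∀ t, 0 ≤ t → (u t).1 = (x t).1 - xs.1 := fun t ht => by simp [hu, ht]
  set v : ℝ → N → ℝ := fun t => (x t).2.2.1 - xs.2.2.1 with hv
  have hr1 : Tendsto (fun t => (P.residual (u t, v t)).1) atTop (𝓝 0) := by
    rw [tendsto_pi_nhds]
    intro j
    refine (himb j).congr' ?_
    filter_upwards [eventually_ge_atTop 0] with t ht
    rw [residual_fst, hu' t ht, map_sub, hv]
    simp only [Pi.sub_apply, sub_div]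
    linarith [hbal j]
  have hr2 : Tendsto (fun t => (P.residual (u t, v t)).2) atTop (𝓝 0) := by
    rw [tendsto_pi_nhds]
    intro i
    rw [tendsto_pi_nhds]
    intro j
    simp only [residual_snd]
    split_ifs with h
    · refine (hμ i j h).congr fun t => ?_
      simp only [hv, Pi.sub_apply, hμ0 i j]
      ring
    · exact tendsto_const_nhds
  have hr : Tendsto (fun t => ‖P.residual (u t, v t)‖) atTop (𝓝 0) := by
    have := (hr1.prodMk_nhds hr2).norm
    simpa using this
  have huv : Tendsto (fun t => (u t, v t)) atTop (𝓝 0) := by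
    refine squeeze_zero_norm (fun t => ?_) (by simpa using hr.const_mul c⁻¹)
    rw [inv_mul_eq_div, le_div_iff₀ hc, mul_comm]
    exact hle _
  have hθ : Tendsto (fun t => (x t).1) atTop (𝓝 xs.1) := by
    have h1 : Tendsto (fun t => (u t).1) atTop (𝓝 0) :=
      (continuous_subtype_val.tendsto _).comp ((continuous_fst.tendsto _).comp huv)
    have h2 : Tendsto (fun t => (u t).1 + xs.1) atTop (𝓝 xs.1) := by
      simpa using h1.add_const xs.1
    refine h2.congr' ?_
    filter_upwards [eventually_ge_atTop 0] with t ht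
    rw [hu' t ht, sub_add_cancel]
  have hμ' : Tendsto (fun t => (x t).2.2.1) atTop (𝓝 xs.2.2.1) := by
    have h1 : Tendsto v atTop (𝓝 0) := (continuous_snd.tendsto _).comp huv
    simpa [hv] using h1.add_const xs.2.2.1
  have hω' : Tendsto (fun t => (x t).2.1) atTop (𝓝 xs.2.1) := by
    rw [hω0, tendsto_pi_nhds]
    exact hω
  have hν' : Tendsto (fun t => (x t).2.2.2) atTop (𝓝 xs.2.2.2) := by
    rw [hν0, tendsto_pi_nhds]
    exact hν
  exact hθ.prodMk_nhds (hω'.prodMk_nhds (hμ'.prodMk_nhds hν'))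

/-- Convergence of the closed loop from a sublevel set. -/
theorem tendsto_of_isTrajectory {xs : P.State} (hxs : P.IsEquilibrium d xs)
    {U : ∀ j, ℝ → NuSpace (P.s j) → ℝ} {Ulow Uup : ∀ j, NuSpace (P.s j) → ℝ} {b : N → ℝ}
    (hU : ∀ j, P.IsSubLyapunov j (U j) (Ulow j) (Uup j) (b j)) {φ : N → ℝ}
    (hφ : ∀ j t, 0 ≤ t → enorm2 (P.varphi j t) ≤ φ j) {C c c₂ c₃ : ℝ} (hc : 0 < c)
    (hsub : ∀ t, 0 ≤ t → ∀ ν : ∀ j, NuSpace (P.s j),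
      ∑ j, U j t (ν j) ≤ C → ∀ j, ‖ν j‖ ≤ c)
    (hgain : P.IsGainConst b φ c c₂ c₃) (hd : P.AssumptionA1 d c₃)
    (hx : P.IsTrajectory d x) (h0 : P.V U c₃ xs 0 (x 0) ≤ C) : Tendsto x atTop (𝓝 xs) := by
  have hc₃ : 0 < c₃ := one_pos.trans_le hgain.one_le
  have hκ : 0 < 1 / (2 * c₃ ^ 2) := by positivity
  obtain ⟨ε, hε, hdV⟩ := exists_dV_le P hxs hU hφ hc hgain hd
  have hCd := fun j => (hU j).contDiff
  have hVC : ∀ t, 0 ≤ t → P.V U c₃ xs t (x t) ≤ C := fun t ht =>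
    P.V_le_of_isTrajectory hCd hc hsub hε hκ.le hdV hx h0 ht
  have hνc : ∀ t, 0 ≤ t → ∀ j, ‖(x t).2.2.2 j‖ ≤ c := fun t ht =>
    hsub t ht _ ((P.sum_U_le_V U c₃ xs t (x t)).trans (hVC t ht))
  have hUnn : ∀ j t, 0 ≤ t → ∀ ν, 0 ≤ U j t ν := fun j t ht ν => (hU j).nonneg ht ν
  have hb : P.BddTrajectory x := P.bddTrajectory_of_V_le hUnn hc₃ hVC hνc
  have hdis : Tendsto (fun t => P.dissip ε (1 / (2 * c₃ ^ 2)) (x t)) atTop (𝓝 0) := by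
    refine tendsto_zero_of_hasDerivWithinAt_le_neg (F := fun t => P.V U c₃ xs t (x t))
      (fun t ht => P.hasDerivWithinAt_V hCd c₃ xs (hx.2 t ht)) (fun t ht => ?_)
      (fun t ht => hdV t (x t) ht (hνc t ht)) (fun t => P.dissip_nonneg hε.le hκ.le _)
      (hb.tame_dissip hx _ _)
    exact (Finset.sum_nonneg fun j _ => hUnn j t ht _).trans (P.sum_U_le_V U c₃ xs t (x t))
  have hω : ∀ j, Tendsto (fun t => (x t).2.1 j) atTop (𝓝 0) := fun j => by
    refine tendsto_zero_of_sq_le hε (Eventually.of_forall fun t => ?_) hdis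
    refine le_trans ?_ (P.le_dissip hε.le hκ.le (x t) j)
    gcongr
    exact le_add_of_nonneg_left (sq_nonneg _)
  have hν : ∀ j, Tendsto (fun t => ‖(x t).2.2.2 j‖) atTop (𝓝 0) := fun j => by
    refine tendsto_zero_of_sq_le hε (Eventually.of_forall fun t => ?_) hdis
    refine le_trans ?_ (P.le_dissip hε.le hκ.le (x t) j)
    gcongr
    exact le_add_of_nonneg_right (sq_nonneg _)
  have hμ : ∀ i j, P.H.Adj i j →
      Tendsto (fun t => (x t).2.2.1 i - (x t).2.2.1 j) atTop (𝓝 0) := fun i j hij =>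
    tendsto_zero_of_sq_le (half_pos hκ)
      (Eventually.of_forall fun t => sq_sub_le_dissip hε.le hκ.le (x t) hij) hdis
  have hρ : ∀ j, Tendsto (fun t => P.rho j t ((x t).2.2.2 j)) atTop (𝓝 0) := fun j => by
    refine squeeze_zero_norm' ?_ (by simpa using (hν j).const_mul c₃)
    filter_upwards [eventually_ge_atTop 0] with t ht
    exact P.abs_rho_le j (hφ j t ht) (hgain.c2_ge j) hgain.c3_ge_rho (hνc t ht j)
  exact tendsto_equilibrium hxs hx hω (fun j => tendsto_zero_iff_norm_tendsto_zero.2 (hν j)) hμ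
    (tendsto_imbalance hb hx hω hρ)

end Network

end FreqControl

end

theorem theorem2 {N : Type*} [Fintype N] [DecidableEq N] (P : FreqControl.Network N) (d : N → ℝ) :
    -- the equilibrium is well defined
    (∃! xs : P.State, P.IsEquilibrium d xs) ∧
    -- the functions `U_j` exist
    (∀ j, ∃ U Ulow Uup b, P.IsSubLyapunov j U Ulow Uup b) ∧
    -- convergence of every trajectory that starts in the sublevel set of `Vbar`
    (∀ xs : P.State, P.IsEquilibrium d xs →
      ∀ (U : ∀ j, ℝ → FreqControl.NuSpace (P.s j) → ℝ)
        (Ulow Uup : ∀ j, FreqControl.NuSpace (P.s j) → ℝ) (b : N → ℝ),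
        (∀ j, P.IsSubLyapunov j (U j) (Ulow j) (Uup j) (b j)) →
      ∀ (φbar : N → ℝ), (∀ j t, 0 ≤ t → FreqControl.enorm2 (P.varphi j t) ≤ φbar j) →
      ∀ (ctilde cbar c2 c3 : ℝ), 0 < cbar →
        (∀ t, 0 ≤ t → ∀ ν : ∀ j, FreqControl.NuSpace (P.s j),
          ∑ j, U j t (ν j) ≤ ctilde → ∀ j, ‖ν j‖ ≤ cbar) →
        P.IsGainConst b φbar cbar c2 c3 →
        P.AssumptionA1 d c3 →
      ∀ Vbar : P.State → ℝ, FreqControl.PosDefRadial xs Vbar →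
        (∀ t, 0 ≤ t → ∀ x, P.V U c3 xs t x ≤ Vbar x) →
      ∀ x : ℝ → P.State, P.IsTrajectory d x → Vbar (x 0) ≤ ctilde →
        Filter.Tendsto x Filter.atTop (nhds xs)) :=
  ⟨P.existsUnique_isEquilibrium d, P.exists_isSubLyapunov,
    -- The initial condition enters as V(0, x(0)) ≤ V̄(x(0)) ≤ c̃.
    fun _ hxs _ _ _ _ hU _ hφ _ _ _ _ hc hsub hgain hd _ _ hVbar x hx h0 =>
      FreqControl.Network.tendsto_of_isTrajectory hxs hU hφ hc hsub hgain hd hx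
        ((hVbar 0 le_rfl (x 0)).trans h0)⟩
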